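/- Let $G\rightrightarrows M$ be a symplectic groupoid: a Lie groupoid on finite-dimensional (smooth, Hausdorff, second countable) manifolds, with source and target $s,t$ and product $gh$ defined when $t(g)=s(h)$, and a symplectic form $\omega$ on $G$ such that the graph of the product is a Lagrangian submanifold of $G\times G\times\overline{G}$. For $n\ge 1$ let $$G_{(n)}=\{(g_1,\dots,g_n)\in G^n \mid t(g_k)=s(g_{k+1}),\ 1\le k<n\}$$ be the iterated fiber product, $m_n:G_{(n)}\to G$, $m_n(g_1,\dots,g_n)=g_1\cdots g_n$, and let $G^n$ carry the form $\omega^{(n)}=\sum_k \mathrm{pr}_k^*\omega$. A relational symplectic groupoid $(\mathcal G,L,I)$ is a symplectic manifold $\mathcal G$ with an immersed Lagrangian submanifold $L\subset\mathcal G^3$ and an antisymplectomorphism $I$ such that $L$ is cyclically symmetric; $I^2=\mathrm{Id}$; $I\circ L=L\circ T\circ(I\times I)$ as relations $\mathcal G\times\mathcal G\nrightarrow\mathcal G$, where $T$ is the transposition; with $L_3:=I\circ L$, $L_3\circ(L_3\times \mathrm{Id})=L_3\circ(\mathrm{Id}\times L_3)$ and this relation is immersed Lagrangian; $L_1:=L_3\circ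 \mathrm{graph}(I)$ is an immersed Lagrangian submanifold of $\mathcal G$; $L_3\circ(L_1\times L_1)=L_1$; and $L_3\circ(L_1\times\mathrm{Id})$ is an immersed Lagrangian submanifold of $\overline{\mathcal G}\times\mathcal G$. A morphism $(\mathcal G,L,I)\to(\mathcal G',L',I')$ is an immersed Lagrangian submanifold $F$ of $\mathcal G\times\overline{\mathcal G'}$ with $F\circ I=I'\circ F$ and $F^3(L)=L'$; it is an equivalence if the transpose $F^{op}$ is also a morphism. Then: 1. For every $n\ge1$, $G_{(n)}$ is an embedded coisotropic submanifold of $(G^n,\omega^{(n)})$, and $m_n$ is a surjective submersion with $m_n^*\omega=\omega^{(n)}|_{G_{(n)}}$. If the source fibres of $G$ are connected, then $m_n$ induces a bijection from the reduced space $\underline{G_{(n)}}$ (the space of leaves of the characteristic foliation of $G_{(n)}$) onto $G$; thus $(G,\omega)$ is the symplectic reduction of $G_{(n)}$. 2. For every $n\ge 1$, $G^n$ with $$L_{(n)}=\{(\alpha,\beta,\gamma)\in G_{(n)}^3\mid t(m_n(\alpha))=s(m_n(\beta)),\ m_n(\gamma)=(m_n(\alpha)m_n(\beta))^{-1}\},\qquad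 I_{(n)}(g_1,\dots,g_n)=(g_n^{-1},\dots,g_1^{-1})$$ is a relational symplectic groupoid. 3. With $P_n=\{(g,\alpha)\in G\times G^n\mid \alpha\in G_{(n)},\ m_n(\alpha)=g\}:G\nrightarrow G^n$, for all $i,j\ge1$ the relation $P_i\circ P_j^{op}:G^j\nrightarrow G^i$ is an equivalence from $(G^j,L_{(j)},I_{(j)})$ to $(G^i,L_{(i)},I_{(i)})$. In particular these relational symplectic groupoids are equivalent for all $i,j\ge 1$. -/

import Mathlib

open scoped Manifold ContDiff SetRel

noncomputable section

namespace RelSympl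

universe u

section Forms

variable {E : Type*} [NormedAddCommGroup E] [NormedSpace ℝ E] {H : Type*} [TopologicalSpace H]
  {E' : Type*} [NormedAddCommGroup E'] [NormedSpace ℝ E'] {H' : Type*} [TopologicalSpace H']

/-- A field of bilinear forms on the tangent spaces of `X` (no regularity required yet). -/
abbrev BilinField (J : ModelWithCorners ℝ E H) (X : Type*) [TopologicalSpace X]
    [ChartedSpace H X] : Type _ :=
  ∀ x : X, TangentSpace J x →ₗ[ℝ] TangentSpace J x →ₗ[ℝ] ℝ

/-- The coefficients, in the chart around `x₀`, of a field of bilinear forms: the value on the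
constant vector fields `v`, `w` at the point of `X` with chart coordinates `y`. -/
def chartCoeff (J : ModelWithCorners ℝ E H) {X : Type*} [TopologicalSpace X] [ChartedSpace H X]
    (Ω : BilinField J X) (x₀ : X) (v w : E) (y : E) : ℝ :=
  Ω ((extChartAt J x₀).symm y)
    (mfderivWithin 𝓘(ℝ, E) J (extChartAt J x₀).symm (Set.range J) y v)
    (mfderivWithin 𝓘(ℝ, E) J (extChartAt J x₀).symm (Set.range J) y w)

/-- A symplectic form: an alternating, nondegenerate, smooth and closed `2`-form. -/
structure IsSymplecticForm (J : ModelWithCorners ℝ E H) {X : Type*} [TopologicalSpace X]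
    [ChartedSpace H X] (Ω : BilinField J X) : Prop where
  alternating : ∀ (x : X) (v : TangentSpace J x), Ω x v v = 0
  nondegenerate : ∀ (x : X) (v : TangentSpace J x),
    (∀ w : TangentSpace J x, Ω x v w = 0) → v = 0
  smooth : ∀ (x₀ : X) (v w : E),
    ContDiffOn ℝ ∞ (chartCoeff J Ω x₀ v w) (extChartAt J x₀).target
  closed : ∀ (x₀ : X), ∀ y ∈ (extChartAt J x₀).target, ∀ u v w : E,
    fderivWithin ℝ (chartCoeff J Ω x₀ v w) (Set.range J) y u
      + fderivWithin ℝ (chartCoeff J Ω x₀ w u) (Set.range J) y v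
      + fderivWithin ℝ (chartCoeff J Ω x₀ u v) (Set.range J) y w = 0

/-- `(X, Ω)` is a (finite-dimensional, smooth, Hausdorff, second countable, boundaryless)
symplectic manifold. -/
structure IsSymplecticManifold (J : ModelWithCorners ℝ E H) {X : Type*} [TopologicalSpace X]
    [ChartedSpace H X] (Ω : BilinField J X) : Prop where
  finiteDimensional : FiniteDimensional ℝ E
  boundaryless : J.Boundaryless
  isManifold : IsManifold J ∞ X
  t2 : T2Space X
  secondCountable : SecondCountableTopology X
  isSymplecticForm : IsSymplecticForm J Ω

/-- The form `pr₁^* Ω + pr₂^* η` on a product of two manifolds. -/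
def prodForm {J : ModelWithCorners ℝ E H} {X : Type*} [TopologicalSpace X] [ChartedSpace H X]
    {J' : ModelWithCorners ℝ E' H'} {Y : Type*} [TopologicalSpace Y] [ChartedSpace H' Y]
    (Ω : BilinField J X) (η : BilinField J' Y) : BilinField (J.prod J') (X × Y) := fun p =>
  (Ω p.1).compl₁₂ (LinearMap.fst ℝ E E') (LinearMap.fst ℝ E E')
    + (η p.2).compl₁₂ (LinearMap.snd ℝ E E') (LinearMap.snd ℝ E E')

/-- The model of the `n`-th power of a manifold. -/
abbrev powModel (J : ModelWithCorners ℝ E H) (n : ℕ) :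
    ModelWithCorners ℝ (Fin n → E) (ModelPi fun _ : Fin n => H) :=
  ModelWithCorners.pi fun _ : Fin n => J

/-- The form `∑ k, pr_k^* Ω` on the `n`-th power of a manifold. -/
def powForm {J : ModelWithCorners ℝ E H} {X : Type*} [TopologicalSpace X] [ChartedSpace H X]
    (Ω : BilinField J X) (n : ℕ) : BilinField (powModel J n) (Fin n → X) := fun p =>
  ∑ k : Fin n, (Ω (p k)).compl₁₂ (LinearMap.proj (R := ℝ) (φ := fun _ : Fin n => E) k)
    (LinearMap.proj (R := ℝ) (φ := fun _ : Fin n => E) k)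

end Forms

section Submanifolds

variable {E : Type*} [NormedAddCommGroup E] [NormedSpace ℝ E] {H : Type*} [TopologicalSpace H]
  {E' : Type*} [NormedAddCommGroup E'] [NormedSpace ℝ E'] {H' : Type*} [TopologicalSpace H']

/-- An immersed submanifold structure on the subset `S` of `X`: a (Hausdorff, second countable)
manifold `carrier` with an injective immersion `incl` into `X` whose image is `S`. -/
structure ImmersedSubmanifold (J : ModelWithCorners ℝ E H) {X : Type u} [TopologicalSpace X]
    [ChartedSpace H X] (S : Set X) where
  dim : ℕ
  carrier : Type u
  [topologicalSpace : TopologicalSpace carrier]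
  [chartedSpace : ChartedSpace (EuclideanSpace ℝ (Fin dim)) carrier]
  [isManifold : IsManifold (𝓡 dim) ∞ carrier]
  [t2Space : T2Space carrier]
  [secondCountable : SecondCountableTopology carrier]
  incl : carrier → X
  contMDiff_incl : ContMDiff (𝓡 dim) J ∞ incl
  injective_incl : Function.Injective incl
  injective_mfderiv : ∀ p : carrier, Function.Injective (mfderiv (𝓡 dim) J incl p)
  range_incl : Set.range incl = S

namespace ImmersedSubmanifold

attribute [instance] topologicalSpace chartedSpace isManifold t2Space secondCountable

variable {J : ModelWithCorners ℝ E H} {X : Type u} [TopologicalSpace X]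
  [ChartedSpace H X] {S : Set X}

/-- The submanifold is embedded: it carries the subspace topology. -/
def IsEmbedded (Y : ImmersedSubmanifold J S) : Prop := Topology.IsEmbedding Y.incl

/-- The tangent space of the submanifold, as a subspace of the ambient tangent space. -/
def tangent (Y : ImmersedSubmanifold J S) (p : Y.carrier) :
    Submodule ℝ (TangentSpace J (Y.incl p)) :=
  LinearMap.range (mfderiv (𝓡 Y.dim) J Y.incl p).toLinearMap

/-- Every tangent space contains its `Ω`-orthogonal. -/
def IsCoisotropic (Y : ImmersedSubmanifold J S) (Ω : BilinField J X) : Prop :=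
  ∀ (p : Y.carrier) (v : TangentSpace J (Y.incl p)),
    (∀ w ∈ Y.tangent p, Ω (Y.incl p) v w = 0) → v ∈ Y.tangent p

/-- Every tangent space equals its `Ω`-orthogonal. -/
def IsLagrangian (Y : ImmersedSubmanifold J S) (Ω : BilinField J X) : Prop :=
  ∀ (p : Y.carrier) (v : TangentSpace J (Y.incl p)),
    v ∈ Y.tangent p ↔ ∀ w ∈ Y.tangent p, Ω (Y.incl p) v w = 0

/-- `p` and `q` are joined by a smooth path in the submanifold which is everywhere tangent to the
characteristic distribution, that is, to the kernel of the restriction of `Ω`. -/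
def CharPath (Y : ImmersedSubmanifold J S) (Ω : BilinField J X) (p q : Y.carrier) : Prop :=
  ∃ γ : ℝ → Y.carrier, ContMDiff 𝓘(ℝ, ℝ) (𝓡 Y.dim) ∞ γ ∧ γ 0 = p ∧ γ 1 = q ∧
    ∀ t : ℝ, ∀ w ∈ Y.tangent (γ t),
      Ω (Y.incl (γ t)) (mfderiv (𝓡 Y.dim) J Y.incl (γ t)
        (mfderiv 𝓘(ℝ, ℝ) (𝓡 Y.dim) γ t (1 : ℝ))) w = 0

/-- The reduced space: the space of leaves of the characteristic foliation. (`Quot` divides by the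
equivalence relation generated by `CharPath`.) -/
def Reduced (Y : ImmersedSubmanifold J S) (Ω : BilinField J X) : Type u :=
  Quot (Y.CharPath Ω)

/-- The leaf through a point. -/
def leaf (Y : ImmersedSubmanifold J S) (Ω : BilinField J X) (p : Y.carrier) : Y.Reduced Ω :=
  Quot.mk _ p

/-- The map `π`, defined on the submanifold, is a surjective submersion onto `(Q, η)` such that
`π^* η` is the restriction of `Ω`. -/
structure IsReductionMap (Y : ImmersedSubmanifold J S) (Ω : BilinField J X)
    {J' : ModelWithCorners ℝ E' H'} {Q : Type*} [TopologicalSpace Q] [ChartedSpace H' Q]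
    (η : BilinField J' Q) (π : Y.carrier → Q) : Prop where
  contMDiff : ContMDiff (𝓡 Y.dim) J' ∞ π
  surjective : Function.Surjective π
  submersion : ∀ p : Y.carrier, Function.Surjective (mfderiv (𝓡 Y.dim) J' π p)
  pullback_eq : ∀ (p : Y.carrier) (v w : TangentSpace (𝓡 Y.dim) p),
    η (π p) (mfderiv (𝓡 Y.dim) J' π p v) (mfderiv (𝓡 Y.dim) J' π p w)
      = Ω (Y.incl p) (mfderiv (𝓡 Y.dim) J Y.incl p v) (mfderiv (𝓡 Y.dim) J Y.incl p w)

end ImmersedSubmanifold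

/-- `S` is an immersed Lagrangian submanifold of `(X, Ω)`. -/
def IsImmersedLagrangian {J : ModelWithCorners ℝ E H} {X : Type u} [TopologicalSpace X]
    [ChartedSpace H X] (Ω : BilinField J X) (S : Set X) : Prop :=
  ∃ Y : ImmersedSubmanifold J S, Y.IsLagrangian Ω

/-- `S` is an embedded Lagrangian submanifold of `(X, Ω)`. -/
def IsEmbeddedLagrangian {J : ModelWithCorners ℝ E H} {X : Type u} [TopologicalSpace X]
    [ChartedSpace H X] (Ω : BilinField J X) (S : Set X) : Prop :=
  ∃ Y : ImmersedSubmanifold J S, Y.IsEmbedded ∧ Y.IsLagrangian Ω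

end Submanifolds

section Relations


/-- The product `R × S` of two relations. -/
def relProd {α β γ δ : Type*} (R : SetRel α β) (S : SetRel γ δ) : SetRel (α × γ) (β × δ) :=
  {p | (p.1.1, p.2.1) ∈ R ∧ (p.1.2, p.2.2) ∈ S}

variable {X : Type*}

/-- `L₃ = I ∘ L`. (`R ○ S` is "first `R`, then `S`".) -/
def L₃ (L : SetRel (X × X) X) (I : X → X) : SetRel (X × X) X := L ○ Function.graph I

/-- `L₁ = L₃ ∘ L_I`, where `L_I` is the graph of `I`. -/
def L₁ (L : SetRel (X × X) X) (I : X → X) : Set X := (L₃ L I).image (Function.graph I)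

/-- `L₂ = L₃ ∘ (L₁ × Id)`. -/
def L₂ (L : SetRel (X × X) X) (I : X → X) : SetRel X X :=
  {p | ∃ l ∈ L₁ L I, ((l, p.1), p.2) ∈ L₃ L I}

end Relations

section RelationalGroupoids


variable {E : Type*} [NormedAddCommGroup E] [NormedSpace ℝ E] {H : Type*} [TopologicalSpace H]
  {E' : Type*} [NormedAddCommGroup E'] [NormedSpace ℝ E'] {H' : Type*} [TopologicalSpace H']

/-- A (finite-dimensional) relational symplectic groupoid `(X, L, I)`. -/
structure IsRelationalSymplecticGroupoid {J : ModelWithCorners ℝ E H} {X : Type*}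
    [TopologicalSpace X] [ChartedSpace H X] (Ω : BilinField J X)
    (L : SetRel (X × X) X) (I : X → X) : Prop where
  isSymplecticManifold : IsSymplecticManifold J Ω
  lagrangian_L : IsImmersedLagrangian (prodForm (prodForm Ω Ω) Ω) L
  smooth_I : ContMDiff J J ∞ I
  bijective_I : Function.Bijective I
  anti_I : ∀ (x : X) (v w : TangentSpace J x),
    Ω (I x) (mfderiv J J I x v) (mfderiv J J I x w) = - Ω x v w
  -- `L` is cyclically symmetric
  cyclic : ∀ x y z : X, ((x, y), z) ∈ L → ((y, z), x) ∈ L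
  -- `I` is an involution
  involutive : ∀ x : X, I (I x) = x
  -- `I ∘ L = L ∘ T ∘ (I × I)`, with `T` the transposition
  inv_comp : L ○ Function.graph I =
    relProd (Function.graph I) (Function.graph I) ○ Function.graph (Prod.swap : X × X → X × X) ○ L
  -- `L₃ ∘ (L₃ × Id) = L₃ ∘ (Id × L₃)` is Lagrangian
  assoc : relProd (L₃ L I) SetRel.id ○ L₃ L I =
    Function.graph (Equiv.prodAssoc X X X) ○ relProd SetRel.id (L₃ L I) ○ L₃ L I
  lagrangian_assoc : IsImmersedLagrangian (prodForm (-prodForm (prodForm Ω Ω) Ω) Ω)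
    (relProd (L₃ L I) SetRel.id ○ L₃ L I)
  -- `L₁` is Lagrangian
  lagrangian_L₁ : IsImmersedLagrangian Ω (L₁ L I)
  -- `L₃ ∘ (L₁ × L₁) = L₁`
  L₃_L₁ : (L₃ L I).image (L₁ L I ×ˢ L₁ L I) = L₁ L I
  -- `L₂` is Lagrangian
  lagrangian_L₂ : IsImmersedLagrangian (prodForm (-Ω) Ω) (L₂ L I)

/-- `F` is a morphism from the relational symplectic groupoid `(X, L, I)` to `(X', L', I')`. -/
structure IsMorphism {J : ModelWithCorners ℝ E H} {X : Type*} [TopologicalSpace X]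
    [ChartedSpace H X] {J' : ModelWithCorners ℝ E' H'} {X' : Type*} [TopologicalSpace X']
    [ChartedSpace H' X'] (Ω : BilinField J X) (L : SetRel (X × X) X) (I : X → X)
    (Ω' : BilinField J' X') (L' : SetRel (X' × X') X') (I' : X' → X')
    (F : SetRel X X') : Prop where
  lagrangian : IsImmersedLagrangian (prodForm Ω (-Ω')) F
  comp_inv : Function.graph I ○ F = F ○ Function.graph I'
  map_L : (relProd (relProd F F) F).image L = L'

/-- `F` is an equivalence of relational symplectic groupoids: `F` and its transpose are
morphisms. -/
def IsEquivalence {J : ModelWithCorners ℝ E H} {X : Type*} [TopologicalSpace X]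
    [ChartedSpace H X] {J' : ModelWithCorners ℝ E' H'} {X' : Type*} [TopologicalSpace X']
    [ChartedSpace H' X'] (Ω : BilinField J X) (L : SetRel (X × X) X) (I : X → X)
    (Ω' : BilinField J' X') (L' : SetRel (X' × X') X') (I' : X' → X')
    (F : SetRel X X') : Prop :=
  IsMorphism Ω L I Ω' L' I' F ∧ IsMorphism Ω' L' I' Ω L I F.inv

end RelationalGroupoids

section Groupoids

variable {E : Type*} [NormedAddCommGroup E] [NormedSpace ℝ E]
  {B : Type*} [NormedAddCommGroup B] [NormedSpace ℝ B]

/-- A Lie groupoid `G ⇉ M`. The product `mul g h` is meaningful only when `tgt g = src h`; its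
other values are irrelevant. -/
structure LieGroupoid (E B : Type*) [NormedAddCommGroup E] [NormedSpace ℝ E]
    [NormedAddCommGroup B] [NormedSpace ℝ B] (G M : Type*) [TopologicalSpace G] [ChartedSpace E G]
    [TopologicalSpace M] [ChartedSpace B M] where
  src : G → M
  tgt : G → M
  unit : M → G
  inv : G → G
  mul : G → G → G
  smooth_src : ContMDiff 𝓘(ℝ, E) 𝓘(ℝ, B) ∞ src
  smooth_tgt : ContMDiff 𝓘(ℝ, E) 𝓘(ℝ, B) ∞ tgt
  smooth_unit : ContMDiff 𝓘(ℝ, B) 𝓘(ℝ, E) ∞ unit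
  smooth_inv : ContMDiff 𝓘(ℝ, E) 𝓘(ℝ, E) ∞ inv
  smooth_mul : ContMDiffOn (𝓘(ℝ, E).prod 𝓘(ℝ, E)) 𝓘(ℝ, E) ∞
    (fun p : G × G => mul p.1 p.2) {p | tgt p.1 = src p.2}
  submersion_src : ∀ g : G, Function.Surjective (mfderiv 𝓘(ℝ, E) 𝓘(ℝ, B) src g)
  src_unit : ∀ x, src (unit x) = x
  tgt_unit : ∀ x, tgt (unit x) = x
  src_mul : ∀ g h, tgt g = src h → src (mul g h) = src g
  tgt_mul : ∀ g h, tgt g = src h → tgt (mul g h) = tgt h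
  unit_mul : ∀ g, mul (unit (src g)) g = g
  mul_unit : ∀ g, mul g (unit (tgt g)) = g
  src_inv : ∀ g, src (inv g) = tgt g
  tgt_inv : ∀ g, tgt (inv g) = src g
  mul_inv : ∀ g, mul g (inv g) = unit (src g)
  inv_mul : ∀ g, mul (inv g) g = unit (tgt g)
  mul_assoc : ∀ g h k, tgt g = src h → tgt h = src k → mul (mul g h) k = mul g (mul h k)

namespace LieGroupoid

variable {G : Type*} {M : Type*} [TopologicalSpace G] [ChartedSpace E G]
  [TopologicalSpace M] [ChartedSpace B M] (𝓖 : LieGroupoid E B G M)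

/-- The graph of the multiplication, a subset of `(G × G) × G`. -/
def mulGraph : Set ((G × G) × G) := {p | 𝓖.tgt p.1.1 = 𝓖.src p.1.2 ∧ p.2 = 𝓖.mul p.1.1 p.1.2}

/-- `Ω` makes the Lie groupoid a symplectic groupoid: `Ω` is symplectic and the graph of the
multiplication is a Lagrangian submanifold of `G × G × Ḡ`. -/
structure IsSymplectic (Ω : BilinField 𝓘(ℝ, E) G) : Prop where
  isSymplecticForm : IsSymplecticForm 𝓘(ℝ, E) Ω
  lagrangian : IsEmbeddedLagrangian (prodForm (prodForm Ω Ω) (-Ω)) 𝓖.mulGraph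

/-- The fibres of the source map are connected. -/
def SourceConnected : Prop := ∀ x : M, IsConnected (𝓖.src ⁻¹' {x})

/-- The iterated fibre product `G_(n) ⊆ Gⁿ`: the composable strings. -/
def composable (n : ℕ) : Set (Fin n → G) :=
  {α | ∀ k l : Fin n, (k : ℕ) + 1 = l → 𝓖.tgt (α k) = 𝓖.src (α l)}

/-- The product `α₀ α₁ ⋯ αₙ` of a composable string with `n + 1` entries. -/
def strProd : ∀ n : ℕ, (Fin (n + 1) → G) → G
  | 0, α => α 0
  | n + 1, α => 𝓖.mul (α 0) (strProd n (Fin.tail α))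

/-- The relation `L = {(a, b, c) | a b c is a unit}` of a groupoid. -/
def rel : SetRel (G × G) G :=
  {p | 𝓖.tgt p.1.1 = 𝓖.src p.1.2 ∧ p.2 = 𝓖.inv (𝓖.mul p.1.1 p.1.2)}

/-- The relation `L` on the power with `n + 1` factors: triples of composable strings whose
classes satisfy the relation `L` of `G`. -/
def powRel (n : ℕ) : SetRel ((Fin (n + 1) → G) × (Fin (n + 1) → G)) (Fin (n + 1) → G) :=
  {p | p.1.1 ∈ 𝓖.composable (n + 1) ∧ p.1.2 ∈ 𝓖.composable (n + 1) ∧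
    p.2 ∈ 𝓖.composable (n + 1) ∧
    ((𝓖.strProd n p.1.1, 𝓖.strProd n p.1.2), 𝓖.strProd n p.2) ∈ 𝓖.rel}

/-- The involution `(g₀, …, gₙ) ↦ (gₙ⁻¹, …, g₀⁻¹)`. -/
def powInv (n : ℕ) (α : Fin (n + 1) → G) : Fin (n + 1) → G := fun k => 𝓖.inv (α (Fin.rev k))

/-- The canonical relation `P : G ↛ G^(n+1)`, relating `g` to the composable strings whose class
in the reduced space, identified with `G` by the product of strings, is `g`. -/
def P (n : ℕ) : SetRel G (Fin (n + 1) → G) :=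
  {p | p.2 ∈ 𝓖.composable (n + 1) ∧ 𝓖.strProd n p.2 = p.1}

end LieGroupoid

end Groupoids

end RelSympl

end

open RelSympl

/-!
All the submanifolds and reductions in question arise from one notion, `IsReduction Ω η C π d`: the
map `π`, defined on the subset `C` of a manifold, is smooth and locally trivial with fibres of
dimension `d` over a manifold `Q`, and `π^* η` is the restriction of `Ω` to `C`. It is closed under
composition, products, change of sign and transport along diffeomorphisms, and it is checked by
local trivializations, before any submanifold structure on `C` is chosen. Over a manifold, local
triviality provides charts of `C`, so that `C` is an embedded submanifold
(`IsLocParam.submanifold`); it is coisotropic as soon as `dim X = dim Q + 2 d`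
(`IsReductionMap.isCoisotropic`). Reductions to the one-point manifold are isotropic submanifolds,
and Lagrangian ones when the dimension is right. Composing, the preimage of a Lagrangian submanifold
of `Q` under a coisotropic reduction is Lagrangian (`IsReduction.isImmersedLagrangian_preimage`).

For a symplectic groupoid `G`, the product is a reduction of the composable pairs in `G × G` onto
`G`: it is locally trivial since a pair `(g, h)` is determined by `g h` and the position of `g` in
its source fibre, and the form is multiplicative since the graph of the product is isotropic. By
induction, the product of strings is a reduction of the composable strings in `G^n` onto `G`
(`IsSymplectic.isReduction_strProd`). The dimensions fit, because `dim G = 2 dim M`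
(`IsSymplectic.finrank_eq`), by comparing the two ways to compute the dimension of the graph of the
product. A reduction map is constant on the leaves of the characteristic foliation, and nearby
points of a fibre lie on a common leaf; hence the reduced space is `G` if the fibres are connected,
which follows from the connectedness of the source fibres by moving one entry of a string at a time
(`isPreconnected_fibre_strProd`).

Finally, each of the relations `L`, `L₃ ∘ (L₃ × Id)`, `L₁`, `L₂` of the power `G^n`, and the
relation `P_i ∘ P_j^op`, consists of tuples of composable strings whose products satisfy the
corresponding relation of `G`: it is the preimage, under products of the reduction above, of the
relation `{g h k = 1}`, the graph of the triple product, the units, or the diagonal. These are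
Lagrangian in powers of `G` because the form is multiplicative, so their preimages are Lagrangian,
while the algebraic identities between the relations reduce to those of a groupoid.
-/

noncomputable section

namespace RelSympl

open Set
open scoped Topology

universe u

/-! ### Powers of manifolds and of symplectic forms -/

section PowManifold

variable {E : Type*} [NormedAddCommGroup E] [NormedSpace ℝ E] {H : Type*} [TopologicalSpace H]
  {J : ModelWithCorners ℝ E H} {X : Type*} [TopologicalSpace X] [ChartedSpace H X]
  {E' : Type*} [NormedAddCommGroup E'] [NormedSpace ℝ E'] {H' : Type*} [TopologicalSpace H']
  {J' : ModelWithCorners ℝ E' H'} {N : Type*} [TopologicalSpace N] [ChartedSpace H' N]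

instance powModel_boundaryless [J.Boundaryless] (n : ℕ) : (powModel J n).Boundaryless := by
  constructor
  refine eq_univ_of_forall fun y => ⟨fun k => J.symm (y k), ?_⟩
  funext k
  exact J.right_inv (by rw [J.range_eq_univ]; trivial)

instance powModel_isManifold [IsManifold J ∞ X] (n : ℕ) :
    IsManifold (powModel J n) ∞ (Fin n → X) := by
  apply isManifold_of_contDiffOn
  rintro _ _ ⟨e, he, rfl⟩ ⟨e', he', rfl⟩
  rw [contDiffOn_pi]
  intro k
  have h := (contDiffGroupoid ∞ J).compatible (he k trivial) (he' k trivial)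
  rw [contDiffGroupoid, mem_groupoid_of_pregroupoid] at h
  refine ContDiffOn.comp (g := J ∘ ((e k).symm ≫ₕ e' k) ∘ J.symm) h.1
    (contDiff_apply ℝ E k).contDiffOn ?_
  rintro y ⟨hy, z, rfl⟩
  refine ⟨?_, ⟨z k, rfl⟩⟩
  simp only [mem_preimage, OpenPartialHomeomorph.trans_source, OpenPartialHomeomorph.symm_source,
    mem_inter_iff] at hy ⊢
  exact ⟨hy.1 k trivial, hy.2 k trivial⟩

theorem contMDiffWithinAt_pow {n : ℕ} {f : N → Fin n → X} {s : Set N} {x : N} :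
    ContMDiffWithinAt J' (powModel J n) ∞ f s x ↔
      ∀ k, ContMDiffWithinAt J' J ∞ (fun y => f y k) s x := by
  simp only [contMDiffWithinAt_iff]
  rw [continuousWithinAt_pi, forall_and]
  refine and_congr_right fun _ => ?_
  rw [contDiffWithinAt_pi]
  rfl

theorem contMDiffAt_pow {n : ℕ} {f : N → Fin n → X} {x : N} :
    ContMDiffAt J' (powModel J n) ∞ f x ↔ ∀ k, ContMDiffAt J' J ∞ (fun y => f y k) x :=
  contMDiffWithinAt_pow

theorem contMDiff_pow {n : ℕ} {f : N → Fin n → X} :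
    ContMDiff J' (powModel J n) ∞ f ↔ ∀ k, ContMDiff J' J ∞ (fun y => f y k) :=
  ⟨fun h k x => contMDiffAt_pow.1 (h x) k, fun h x => contMDiffAt_pow.2 fun k => h k x⟩

theorem contMDiff_eval [IsManifold J ∞ X] {n : ℕ} (k : Fin n) :
    ContMDiff (powModel J n) J ∞ (fun α : Fin n → X => α k) :=
  contMDiff_pow.1 contMDiff_id k

theorem hasMFDerivAt_pow {n : ℕ} {f : N → Fin n → X} {x : N}
    {f' : ∀ k, TangentSpace J' x →L[ℝ] TangentSpace J (f x k)}
    (h : ∀ k, HasMFDerivAt J' J (fun y => f y k) x (f' k)) :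
    HasMFDerivAt J' (powModel J n) f x
      (ContinuousLinearMap.pi (φ := fun _ : Fin n => E) fun k => f' k) := by
  refine ⟨continuousAt_pi.2 fun k => (h k).1, ?_⟩
  exact hasFDerivWithinAt_pi.2 fun k => (h k).2

theorem mfderiv_pow {n : ℕ} {f : N → Fin n → X} {x : N}
    (h : ∀ k, MDifferentiableAt J' J (fun y => f y k) x) (a : TangentSpace J' x) (k : Fin n) :
    (mfderiv J' (powModel J n) f x a : Fin n → E) k = mfderiv J' J (fun y => f y k) x a := by
  rw [(hasMFDerivAt_pow fun k => (h k).hasMFDerivAt).mfderiv]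
  rfl

theorem extChartAt_pow_target {n : ℕ} (x₀ : Fin n → X) :
    (extChartAt (powModel J n) x₀).target = Set.univ.pi fun k => (extChartAt J (x₀ k)).target := by
  ext y
  simp only [extChartAt_target, mem_inter_iff, mem_univ_pi, mem_preimage, forall_and]
  refine and_congr ⟨fun h k => h k trivial, fun h k _ => h k⟩ ⟨?_, fun h => ?_⟩
  · rintro ⟨z, rfl⟩ k
    exact ⟨z k, rfl⟩
  · choose z hz using h
    exact ⟨z, funext hz⟩

end PowManifold

section PowForm

variable {E : Type*} [NormedAddCommGroup E] [NormedSpace ℝ E]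
  {X : Type*} [TopologicalSpace X] [ChartedSpace E X] {Ω : BilinField 𝓘(ℝ, E) X}

/-- The tangent spaces of the power are compared with `Fin n → E` by definitional unfolding, so the
sum of forms is evaluated on a copy with these types. -/
theorem powForm_apply {H : Type*} [TopologicalSpace H] {J : ModelWithCorners ℝ E H}
    {X : Type*} [TopologicalSpace X] [ChartedSpace H X] (Ω : BilinField J X) {n : ℕ}
    (α : Fin n → X) (v w : Fin n → E) :
    powForm Ω n α v w = ∑ k, Ω (α k) (v k) (w k) := by
  let f : Fin n → (Fin n → E) →ₗ[ℝ] (Fin n → E) →ₗ[ℝ] ℝ := fun k =>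
    (show E →ₗ[ℝ] E →ₗ[ℝ] ℝ from Ω (α k)).compl₁₂
      (LinearMap.proj (R := ℝ) (φ := fun _ : Fin n => E) k)
      (LinearMap.proj (R := ℝ) (φ := fun _ : Fin n => E) k)
  have h : (∑ k, f k) v w = ∑ k, f k v w := by simp
  exact h

/-- The charts of the power are products of charts, so that the coefficients of the form on the
power are sums of coefficients of `Ω`, each depending on one block of coordinates only. -/
theorem chartCoeff_powForm [IsManifold 𝓘(ℝ, E) ∞ X] {n : ℕ} (x₀ : Fin n → X) (v w : Fin n → E)
    {y : Fin n → E} (hy : y ∈ (extChartAt (powModel 𝓘(ℝ, E) n) x₀).target) :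
    chartCoeff (powModel 𝓘(ℝ, E) n) (powForm Ω n) x₀ v w y =
      ∑ k, chartCoeff 𝓘(ℝ, E) Ω (x₀ k) (v k) (w k) (y k) := by
  have hk : ∀ k, HasMFDerivAt 𝓘(ℝ, E) 𝓘(ℝ, E) (extChartAt 𝓘(ℝ, E) (x₀ k)).symm (y k)
      (mfderiv 𝓘(ℝ, E) 𝓘(ℝ, E) (extChartAt 𝓘(ℝ, E) (x₀ k)).symm (y k)) := fun k => by
    have : y k ∈ (extChartAt 𝓘(ℝ, E) (x₀ k)).target :=
      (extChartAt_pow_target (J := 𝓘(ℝ, E)) x₀ ▸ hy) k trivial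
    have h := contMDiffOn_extChartAt_symm (I := 𝓘(ℝ, E)) (n := ∞) (x₀ k)
    exact ((h.contMDiffAt ((isOpen_extChartAt_target (x₀ k)).mem_nhds this)).mdifferentiableAt
      (by simp)).hasMFDerivAt
  have hcoord : ∀ k, HasMFDerivAt 𝓘(ℝ, Fin n → E) 𝓘(ℝ, E) (fun y : Fin n → E => y k) y
      (ContinuousLinearMap.proj (R := ℝ) (φ := fun _ : Fin n => E) k) := fun k =>
    (hasFDerivAt_apply k y).hasMFDerivAt
  have hD : HasMFDerivAt 𝓘(ℝ, Fin n → E) (powModel 𝓘(ℝ, E) n)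
      (extChartAt (powModel 𝓘(ℝ, E) n) x₀).symm y _ :=
    hasMFDerivAt_pow fun k =>
      HasMFDerivAt.comp (g := (extChartAt 𝓘(ℝ, E) (x₀ k)).symm) y (hk k) (hcoord k)
  unfold chartCoeff
  simp only [ModelWithCorners.range_eq_univ, mfderivWithin_univ]
  rw [hD.mfderiv]
  exact powForm_apply Ω _ _ _

/-- Powers of symplectic manifolds are symplectic. -/
theorem IsSymplecticForm.powForm [IsManifold 𝓘(ℝ, E) ∞ X] (hΩ : IsSymplecticForm 𝓘(ℝ, E) Ω)
    (n : ℕ) : IsSymplecticForm (powModel 𝓘(ℝ, E) n) (powForm Ω n) := by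
  refine ⟨fun α v => ?_, fun α v hv => ?_, fun x₀ v w => ?_, fun x₀ y hy u v w => ?_⟩
  · refine (powForm_apply Ω α v v).trans ?_
    exact Finset.sum_eq_zero fun k _ => hΩ.alternating _ _
  · funext k
    refine hΩ.nondegenerate (α k) _ fun a => ?_
    have := (powForm_apply Ω α v _).symm.trans (hv (Pi.single (M := fun _ : Fin n => E) k a))
    rw [Finset.sum_eq_single k] at this
    · exact (congrArg (Ω (α k) (v k))
        (Pi.single_eq_same (M := fun _ : Fin n => E) k a)).symm.trans this
    · intro l _ hl
      exact (congrArg (Ω (α l) (v l))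
        (Pi.single_eq_of_ne (M := fun _ : Fin n => E) hl a)).trans (map_zero _)
    · simp
  · refine ContDiffOn.congr ?_ fun y hy => chartCoeff_powForm x₀ v w hy
    refine ContDiffOn.sum fun k _ => ?_
    refine (hΩ.smooth (x₀ k) (v k) (w k)).comp (contDiff_apply ℝ E k).contDiffOn fun y hy => ?_
    exact (extChartAt_pow_target (J := 𝓘(ℝ, E)) x₀ ▸ hy) k trivial
  · have hyk : ∀ k, y k ∈ (extChartAt 𝓘(ℝ, E) (x₀ k)).target := fun k =>
      (extChartAt_pow_target (J := 𝓘(ℝ, E)) x₀ ▸ hy) k trivial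
    have key : ∀ u v w : Fin n → E,
        fderivWithin ℝ (chartCoeff (powModel 𝓘(ℝ, E) n) (RelSympl.powForm Ω n) x₀ v w)
          (Set.range (powModel 𝓘(ℝ, E) n)) y u =
        ∑ k, fderivWithin ℝ (chartCoeff 𝓘(ℝ, E) Ω (x₀ k) (v k) (w k))
          (Set.range 𝓘(ℝ, E)) (y k) (u k) := by
      intro u v w
      have hev : chartCoeff (powModel 𝓘(ℝ, E) n) (RelSympl.powForm Ω n) x₀ v w =ᶠ[𝓝 y]
          fun y => ∑ k, chartCoeff 𝓘(ℝ, E) Ω (x₀ k) (v k) (w k) (y k) := by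
        filter_upwards [(isOpen_extChartAt_target x₀).mem_nhds hy] with z hz
        exact chartCoeff_powForm x₀ v w hz
      have hd : ∀ k, HasFDerivAt (fun y : Fin n → E =>
            chartCoeff 𝓘(ℝ, E) Ω (x₀ k) (v k) (w k) (y k))
          ((fderiv ℝ (chartCoeff 𝓘(ℝ, E) Ω (x₀ k) (v k) (w k)) (y k)).comp
            (ContinuousLinearMap.proj k)) y := fun k => by
        have h1 : DifferentiableAt ℝ (chartCoeff 𝓘(ℝ, E) Ω (x₀ k) (v k) (w k)) (y k) :=
          ((hΩ.smooth (x₀ k) (v k) (w k)).contDiffAt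
            ((isOpen_extChartAt_target (x₀ k)).mem_nhds (hyk k))).differentiableAt (by simp)
        exact HasFDerivAt.comp (g := chartCoeff 𝓘(ℝ, E) Ω (x₀ k) (v k) (w k)) y h1.hasFDerivAt
          (hasFDerivAt_apply k y)
      simp only [ModelWithCorners.range_eq_univ, fderivWithin_univ]
      rw [hev.fderiv_eq, (HasFDerivAt.fun_sum fun k _ => hd k).fderiv]
      simp
    rw [key, key, key, ← Finset.sum_add_distrib, ← Finset.sum_add_distrib]
    exact Finset.sum_eq_zero fun k _ => hΩ.closed (x₀ k) (y k) (hyk k) (u k) (v k) (w k)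

end PowForm

/-! ### Local trivializations over subsets -/

section LocalTrivializations

/-- Standard Euclidean space. The one-point manifold is `Euc 0`. -/
abbrev Euc (d : ℕ) : Type := EuclideanSpace ℝ (Fin d)

variable {E₁ : Type*} [NormedAddCommGroup E₁] [NormedSpace ℝ E₁] {H₁ : Type*} [TopologicalSpace H₁]
  {J₁ : ModelWithCorners ℝ E₁ H₁} {X : Type*} [TopologicalSpace X] [ChartedSpace H₁ X]
  {E₂ : Type*} [NormedAddCommGroup E₂] [NormedSpace ℝ E₂] {H₂ : Type*} [TopologicalSpace H₂]
  {J₂ : ModelWithCorners ℝ E₂ H₂} {Q : Type*} [TopologicalSpace Q] [ChartedSpace H₂ Q]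
  {E₃ : Type*} [NormedAddCommGroup E₃] [NormedSpace ℝ E₃] {H₃ : Type*} [TopologicalSpace H₃]
  {J₃ : ModelWithCorners ℝ E₃ H₃} {R : Type*} [TopologicalSpace R] [ChartedSpace H₃ R]
  {E₄ : Type*} [NormedAddCommGroup E₄] [NormedSpace ℝ E₄] {H₄ : Type*} [TopologicalSpace H₄]
  {J₄ : ModelWithCorners ℝ E₄ H₄} {S : Type*} [TopologicalSpace S] [ChartedSpace H₄ S]
  {K : Type*} [NormedAddCommGroup K] [NormedSpace ℝ K]
  {K' : Type*} [NormedAddCommGroup K'] [NormedSpace ℝ K']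

/-- A local trivialization, with fibre an open part of the vector space `K`, of a map `π` defined
on a subset `C` of the manifold `X`: the part of `C` inside the open set `U` is identified with the
open subset `V` of `Q × K` in such a way that `π` becomes the first projection. The coordinate `κ`
has to be smooth only as a function on a subset; no manifold structure on `C` is presupposed. -/
structure LocalTriv (J₁ : ModelWithCorners ℝ E₁ H₁) (J₂ : ModelWithCorners ℝ E₂ H₂) (C : Set X)
    (π : X → Q) (K : Type*) [NormedAddCommGroup K] [NormedSpace ℝ K] where
  U : Set X
  V : Set (Q × K)
  ψ : Q × K → X
  κ : X → K
  isOpen_U : IsOpen U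
  isOpen_V : IsOpen V
  smooth_ψ : ContMDiffOn (J₂.prod 𝓘(ℝ, K)) J₁ ∞ ψ V
  smooth_κ : ContMDiffOn J₁ 𝓘(ℝ, K) ∞ κ (C ∩ U)
  mapsTo_ψ : ∀ v ∈ V, ψ v ∈ C ∩ U
  π_ψ : ∀ v ∈ V, π (ψ v) = v.1
  κ_ψ : ∀ v ∈ V, κ (ψ v) = v.2
  mem_V : ∀ c ∈ C ∩ U, (π c, κ c) ∈ V
  ψ_κ : ∀ c ∈ C ∩ U, ψ (π c, κ c) = c

/-- `π` is smooth on `C` and locally trivial with `d`-dimensional fibres; in particular `C` is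
locally diffeomorphic to `Q × ℝᵈ`. -/
structure IsLocTriv (J₁ : ModelWithCorners ℝ E₁ H₁) (J₂ : ModelWithCorners ℝ E₂ H₂) (C : Set X)
    (π : X → Q) (d : ℕ) : Prop where
  smooth : ContMDiffOn J₁ J₂ ∞ π C
  exists_triv : ∀ p ∈ C, ∃ T : LocalTriv J₁ J₂ C π (Euc d), p ∈ T.U

/-- Preimages of open sets under `f : C → Q` are cut out of `C` by open sets. -/
theorem ContMDiffOn.exists_isOpen_inter_preimage {f : X → Q} {C : Set X}
    (hf : ContMDiffOn J₁ J₂ ∞ f C) {U : Set Q} (hU : IsOpen U) :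
    ∃ W : Set X, IsOpen W ∧ ∀ c ∈ C, c ∈ W ↔ f c ∈ U := by
  obtain ⟨W, hW, h⟩ := continuousOn_iff'.1 hf.continuousOn U hU
  refine ⟨W, hW, fun c hc => ?_⟩
  have := Set.ext_iff.1 h c
  simp only [mem_inter_iff, mem_preimage, hc, and_true] at this
  exact this.symm

namespace LocalTriv

/-- Change of the fibre coordinate by a linear isomorphism. -/
def congrFibre {C : Set X} {π : X → Q} (T : LocalTriv J₁ J₂ C π K) (e : K ≃L[ℝ] K') :
    LocalTriv J₁ J₂ C π K' where
  U := T.U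
  V := {v : Q × K' | (v.1, e.symm v.2) ∈ T.V}
  ψ v := T.ψ (v.1, e.symm v.2)
  κ c := e (T.κ c)
  isOpen_U := T.isOpen_U
  isOpen_V := T.isOpen_V.preimage (by fun_prop)
  smooth_ψ := T.smooth_ψ.comp (ContMDiff.contMDiffOn (contMDiff_fst.prodMk
    (e.symm.contDiff.contMDiff.comp contMDiff_snd))) fun _ h => h
  smooth_κ := e.contDiff.contMDiff.comp_contMDiffOn T.smooth_κ
  mapsTo_ψ v hv := T.mapsTo_ψ _ hv
  π_ψ v hv := T.π_ψ _ hv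
  κ_ψ v hv := by rw [T.κ_ψ _ hv, e.apply_symm_apply]
  mem_V c hc := by simpa using T.mem_V c hc
  ψ_κ c hc := by simpa using T.ψ_κ c hc

/-- The composition of two locally trivial maps is locally trivial over the part of `C` that lies
over the domain of the second map; the fibre is the product of the fibres. -/
theorem exists_comp {C : Set X} {π : X → Q} {D : Set Q} {ρ : Q → R}
    (hπ : ContMDiffOn J₁ J₂ ∞ π C) (T : LocalTriv J₁ J₂ C π K) (T' : LocalTriv J₂ J₃ D ρ K')
    {p : X} (hpC : p ∈ C) (hp : p ∈ T.U) (hp' : π p ∈ T'.U) :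
    ∃ T'' : LocalTriv J₁ J₃ (C ∩ π ⁻¹' D) (ρ ∘ π) (K' × K), p ∈ T''.U := by
  obtain ⟨W, hW, hWC⟩ := hπ.exists_isOpen_inter_preimage T'.isOpen_U
  have hproj : ContMDiff (J₃.prod 𝓘(ℝ, K' × K)) (J₃.prod 𝓘(ℝ, K')) ∞
      (fun v : R × (K' × K) => (v.1, v.2.1)) :=
    contMDiff_fst.prodMk (contDiff_fst.contMDiff.comp contMDiff_snd)
  have hψ' : ContMDiffOn (J₃.prod 𝓘(ℝ, K' × K)) J₂ ∞ (fun v => T'.ψ (v.1, v.2.1))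
      {v : R × (K' × K) | (v.1, v.2.1) ∈ T'.V} := T'.smooth_ψ.comp hproj.contMDiffOn fun v hv => hv
  have hO : IsOpen {v : R × (K' × K) | (v.1, v.2.1) ∈ T'.V} :=
    T'.isOpen_V.preimage (by fun_prop)
  have hmid : ContMDiffOn (J₃.prod 𝓘(ℝ, K' × K)) (J₂.prod 𝓘(ℝ, K)) ∞
      (fun v => (T'.ψ (v.1, v.2.1), v.2.2)) {v : R × (K' × K) | (v.1, v.2.1) ∈ T'.V} :=
    hψ'.prodMk ((contDiff_snd.contMDiff.comp contMDiff_snd).contMDiffOn)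
  exact ⟨{
    U := T.U ∩ W
    V := {v | (v.1, v.2.1) ∈ T'.V} ∩ (fun v => (T'.ψ (v.1, v.2.1), v.2.2)) ⁻¹' T.V
    ψ := fun v => T.ψ (T'.ψ (v.1, v.2.1), v.2.2)
    κ := fun c => (T'.κ (π c), T.κ c)
    isOpen_U := T.isOpen_U.inter hW
    isOpen_V := hmid.continuousOn.isOpen_inter_preimage hO T.isOpen_V
    smooth_ψ := T.smooth_ψ.comp (hmid.mono inter_subset_left) fun v hv => hv.2
    smooth_κ := by
      refine ContMDiffOn.prodMk_space (T'.smooth_κ.comp (hπ.mono fun c hc => hc.1.1) ?_)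
        (T.smooth_κ.mono fun c hc => ⟨hc.1.1, hc.2.1⟩)
      exact fun c hc => ⟨hc.1.2, (hWC c hc.1.1).1 hc.2.2⟩
    mapsTo_ψ := by
      rintro v ⟨hv, hv'⟩
      have h1 := T.mapsTo_ψ _ hv'
      have h2 := T'.mapsTo_ψ _ hv
      have h3 := T.π_ψ _ hv'
      refine ⟨⟨h1.1, ?_⟩, h1.2, (hWC _ h1.1).2 ?_⟩
      · rw [mem_preimage, h3]; exact h2.1
      · rw [h3]; exact h2.2
    π_ψ := by
      rintro v ⟨hv, hv'⟩
      rw [Function.comp_apply, T.π_ψ _ hv', T'.π_ψ _ hv]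
    κ_ψ := by
      rintro v ⟨hv, hv'⟩
      rw [T.π_ψ _ hv', T'.κ_ψ _ hv, T.κ_ψ _ hv']
    mem_V := by
      rintro c ⟨⟨hc, hc'⟩, hU, hWc⟩
      have h1 : π c ∈ D ∩ T'.U := ⟨hc', (hWC c hc).1 hWc⟩
      refine ⟨T'.mem_V _ h1, ?_⟩
      simp only [mem_preimage, Function.comp_apply]
      rw [T'.ψ_κ _ h1]
      exact T.mem_V c ⟨hc, hU⟩
    ψ_κ := by
      rintro c ⟨⟨hc, hc'⟩, hU, hWc⟩
      have h1 : π c ∈ D ∩ T'.U := ⟨hc', (hWC c hc).1 hWc⟩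
      simp only [Function.comp_apply]
      rw [T'.ψ_κ _ h1, T.ψ_κ c ⟨hc, hU⟩] }, hp, (hWC p hpC).2 hp'⟩

/-- The product of two local trivializations. -/
def prod {C : Set X} {π : X → Q} {D : Set R} {ρ : R → S}
    (T : LocalTriv J₁ J₂ C π K) (T' : LocalTriv J₃ J₄ D ρ K') :
    LocalTriv (J₁.prod J₃) (J₂.prod J₄) (C ×ˢ D) (Prod.map π ρ) (K × K') where
  U := T.U ×ˢ T'.U
  V := {v | (v.1.1, v.2.1) ∈ T.V ∧ (v.1.2, v.2.2) ∈ T'.V}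
  ψ v := (T.ψ (v.1.1, v.2.1), T'.ψ (v.1.2, v.2.2))
  κ c := (T.κ c.1, T'.κ c.2)
  isOpen_U := T.isOpen_U.prod T'.isOpen_U
  isOpen_V := (T.isOpen_V.preimage (by fun_prop)).inter (T'.isOpen_V.preimage (by fun_prop))
  smooth_ψ := by
    refine ContMDiffOn.prodMk (T.smooth_ψ.comp (ContMDiff.contMDiffOn (ContMDiff.prodMk
      (contMDiff_fst.comp contMDiff_fst) (contDiff_fst.contMDiff.comp contMDiff_snd)))
      fun v hv => hv.1) (T'.smooth_ψ.comp (ContMDiff.contMDiffOn (ContMDiff.prodMk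
      (contMDiff_snd.comp contMDiff_fst) (contDiff_snd.contMDiff.comp contMDiff_snd)))
      fun v hv => hv.2)
  smooth_κ := ContMDiffOn.prodMk_space
    (T.smooth_κ.comp contMDiff_fst.contMDiffOn fun _ hc => ⟨hc.1.1, hc.2.1⟩)
    (T'.smooth_κ.comp contMDiff_snd.contMDiffOn fun _ hc => ⟨hc.1.2, hc.2.2⟩)
  mapsTo_ψ v hv := ⟨⟨(T.mapsTo_ψ _ hv.1).1, (T'.mapsTo_ψ _ hv.2).1⟩,
    (T.mapsTo_ψ _ hv.1).2, (T'.mapsTo_ψ _ hv.2).2⟩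
  π_ψ v hv := Prod.ext (T.π_ψ _ hv.1) (T'.π_ψ _ hv.2)
  κ_ψ v hv := Prod.ext (T.κ_ψ _ hv.1) (T'.κ_ψ _ hv.2)
  mem_V c hc := ⟨T.mem_V _ ⟨hc.1.1, hc.2.1⟩, T'.mem_V _ ⟨hc.1.2, hc.2.2⟩⟩
  ψ_κ c hc := Prod.ext (T.ψ_κ _ ⟨hc.1.1, hc.2.1⟩) (T'.ψ_κ _ ⟨hc.1.2, hc.2.2⟩)

theorem exists_transport {C : Set X} {π : X → Q} {D : Set R} {ρ : R → Q}
    (T : LocalTriv J₁ J₂ C π K) {i : X → R} {j : R → X} (hi : ContMDiffOn J₁ J₃ ∞ i C)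
    (hj : ContMDiffOn J₃ J₁ ∞ j D) (hiD : MapsTo i C D) (hjC : MapsTo j D C)
    (hji : ∀ c ∈ C, j (i c) = c) (hij : ∀ c ∈ D, i (j c) = c) (hρ : ∀ c ∈ D, ρ c = π (j c))
    {p : R} (hpD : p ∈ D) (hp : j p ∈ T.U) : ∃ T' : LocalTriv J₃ J₂ D ρ K, p ∈ T'.U := by
  obtain ⟨W, hW, hWC⟩ := hj.exists_isOpen_inter_preimage T.isOpen_U
  exact ⟨{
    U := W
    V := T.V
    ψ := i ∘ T.ψ
    κ := T.κ ∘ j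
    isOpen_U := hW
    isOpen_V := T.isOpen_V
    smooth_ψ := hi.comp T.smooth_ψ fun v hv => (T.mapsTo_ψ v hv).1
    smooth_κ := T.smooth_κ.comp (hj.mono inter_subset_left)
      fun c hc => ⟨hjC hc.1, (hWC c hc.1).1 hc.2⟩
    mapsTo_ψ := fun v hv => by
      have h := T.mapsTo_ψ v hv
      refine ⟨hiD h.1, (hWC _ (hiD h.1)).2 ?_⟩
      rw [hji _ h.1]
      exact h.2
    π_ψ := fun v hv => by
      have h := T.mapsTo_ψ v hv
      rw [Function.comp_apply, hρ _ (hiD h.1), hji _ h.1, T.π_ψ v hv]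
    κ_ψ := fun v hv => by
      have h := T.mapsTo_ψ v hv
      rw [Function.comp_apply, Function.comp_apply, hji _ h.1, T.κ_ψ v hv]
    mem_V := fun c hc => by
      rw [hρ c hc.1]
      exact T.mem_V _ ⟨hjC hc.1, (hWC c hc.1).1 hc.2⟩
    ψ_κ := fun c hc => by
      rw [hρ c hc.1, Function.comp_apply, Function.comp_apply,
        T.ψ_κ _ ⟨hjC hc.1, (hWC c hc.1).1 hc.2⟩, hij c hc.1] }, (hWC p hpD).2 hp⟩

end LocalTriv

namespace IsLocTriv

theorem of_finrank [FiniteDimensional ℝ K] {d : ℕ} (hd : Module.finrank ℝ K = d) {C : Set X}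
    {π : X → Q} (hπ : ContMDiffOn J₁ J₂ ∞ π C)
    (h : ∀ p ∈ C, ∃ T : LocalTriv J₁ J₂ C π K, p ∈ T.U) : IsLocTriv J₁ J₂ C π d := by
  refine ⟨hπ, fun p hp => ?_⟩
  obtain ⟨T, hT⟩ := h p hp
  exact ⟨T.congrFibre (ContinuousLinearEquiv.ofFinrankEq (by rw [hd, finrank_euclideanSpace_fin])),
    hT⟩

theorem comp {C : Set X} {π : X → Q} {D : Set Q} {ρ : Q → R} {d d' : ℕ}
    (h : IsLocTriv J₁ J₂ C π d) (h' : IsLocTriv J₂ J₃ D ρ d') :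
    IsLocTriv J₁ J₃ (C ∩ π ⁻¹' D) (ρ ∘ π) (d' + d) := by
  refine of_finrank (K := Euc d' × Euc d) (by simp)
    (h'.smooth.comp (h.smooth.mono inter_subset_left) fun c hc => hc.2) fun p hp => ?_
  obtain ⟨T, hT⟩ := h.exists_triv p hp.1
  obtain ⟨T', hT'⟩ := h'.exists_triv (π p) hp.2
  exact T.exists_comp h.smooth T' hp.1 hT hT'

theorem prod {C : Set X} {π : X → Q} {D : Set R} {ρ : R → S} {d d' : ℕ}
    (h : IsLocTriv J₁ J₂ C π d) (h' : IsLocTriv J₃ J₄ D ρ d') :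
    IsLocTriv (J₁.prod J₃) (J₂.prod J₄) (C ×ˢ D) (Prod.map π ρ) (d + d') := by
  refine of_finrank (K := Euc d × Euc d') (by simp) ?_ fun p hp => ?_
  · exact (h.smooth.comp contMDiff_fst.contMDiffOn fun _ hc => hc.1).prodMk
      (h'.smooth.comp contMDiff_snd.contMDiffOn fun _ hc => hc.2)
  obtain ⟨T, hT⟩ := h.exists_triv p.1 hp.1
  obtain ⟨T', hT'⟩ := h'.exists_triv p.2 hp.2
  exact ⟨T.prod T', hT, hT'⟩

/-- Local triviality is carried along a diffeomorphism `i` of the subset `C` onto the subset `D` of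
another manifold. -/
theorem transport {C : Set X} {π : X → Q} {D : Set R} {ρ : R → Q} {d : ℕ}
    (h : IsLocTriv J₁ J₂ C π d) {i : X → R} {j : R → X} (hi : ContMDiffOn J₁ J₃ ∞ i C)
    (hj : ContMDiffOn J₃ J₁ ∞ j D) (hiD : MapsTo i C D) (hjC : MapsTo j D C)
    (hji : ∀ c ∈ C, j (i c) = c) (hij : ∀ c ∈ D, i (j c) = c) (hρ : ∀ c ∈ D, ρ c = π (j c)) :
    IsLocTriv J₃ J₂ D ρ d := by
  refine ⟨(h.smooth.comp hj hjC).congr hρ, fun p hp => ?_⟩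
  obtain ⟨T, hT⟩ := h.exists_triv (j p) (hjC hp)
  exact T.exists_transport hi hj hiD hjC hji hij hρ hp hT

protected theorem id : IsLocTriv J₁ J₁ (univ : Set X) id 0 := by
  refine ⟨contMDiffOn_id, fun p _ => ⟨{
    U := univ
    V := univ
    ψ := Prod.fst
    κ := 0
    isOpen_U := isOpen_univ
    isOpen_V := isOpen_univ
    smooth_ψ := contMDiff_fst.contMDiffOn
    smooth_κ := contMDiffOn_const
    mapsTo_ψ := fun _ _ => ⟨trivial, trivial⟩
    π_ψ := fun _ _ => rfl
    κ_ψ := fun _ _ => Subsingleton.elim _ _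
    mem_V := fun _ _ => trivial
    ψ_κ := fun _ _ => rfl }, trivial⟩⟩

/-- A manifold is locally trivial over a point: its charts. -/
theorem toPoint {E : Type*} [NormedAddCommGroup E] [NormedSpace ℝ E] [FiniteDimensional ℝ E]
    {X : Type*} [TopologicalSpace X] [ChartedSpace E X] [IsManifold 𝓘(ℝ, E) ∞ X] :
    IsLocTriv 𝓘(ℝ, E) 𝓘(ℝ, Euc 0) (univ : Set X) (fun _ => (0 : Euc 0))
      (Module.finrank ℝ E) := by
  refine of_finrank (K := E) rfl contMDiffOn_const fun p _ => ⟨{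
    U := (extChartAt 𝓘(ℝ, E) p).source
    V := univ ×ˢ (extChartAt 𝓘(ℝ, E) p).target
    ψ := fun v => (extChartAt 𝓘(ℝ, E) p).symm v.2
    κ := extChartAt 𝓘(ℝ, E) p
    isOpen_U := isOpen_extChartAt_source p
    isOpen_V := isOpen_univ.prod (isOpen_extChartAt_target p)
    smooth_ψ := (contMDiffOn_extChartAt_symm p).comp contMDiff_snd.contMDiffOn fun v hv => hv.2
    smooth_κ := by
      have h := contMDiffOn_extChartAt (I := 𝓘(ℝ, E)) (n := ∞) (x := p)
      rw [← extChartAt_source 𝓘(ℝ, E)] at h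
      exact h.mono inter_subset_right
    mapsTo_ψ := fun v hv => ⟨trivial, PartialEquiv.map_target _ hv.2⟩
    π_ψ := fun _ _ => Subsingleton.elim _ _
    κ_ψ := fun v hv => PartialEquiv.right_inv _ hv.2
    mem_V := fun c hc => ⟨trivial, PartialEquiv.map_source _ hc.2⟩
    ψ_κ := fun c hc => PartialEquiv.left_inv _ hc.2 }, mem_extChartAt_source p⟩

end IsLocTriv

end LocalTrivializations

/-! ### Locally parametrized subsets are submanifolds -/

section Submanifold

variable {E₁ : Type*} [NormedAddCommGroup E₁] [NormedSpace ℝ E₁] {H₁ : Type*} [TopologicalSpace H₁]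
  {J₁ : ModelWithCorners ℝ E₁ H₁} {X : Type u} [TopologicalSpace X] [ChartedSpace H₁ X]
  {E₂ : Type*} [NormedAddCommGroup E₂] [NormedSpace ℝ E₂] {H₂ : Type*} [TopologicalSpace H₂]
  {J₂ : ModelWithCorners ℝ E₂ H₂} {N : Type*} [TopologicalSpace N] [ChartedSpace H₂ N]

/-- `C` is locally parametrized by `ℝᵈ`: it is locally trivial over the one-point manifold. -/
abbrev IsLocParam (J₁ : ModelWithCorners ℝ E₁ H₁) (C : Set X) (d : ℕ) : Prop :=
  IsLocTriv J₁ 𝓘(ℝ, Euc 0) C (fun _ => (0 : Euc 0)) d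

variable {C : Set X} {d : ℕ}

namespace LocalTriv

/-- The parametrization belonging to a local trivialization over a point. -/
def param (T : LocalTriv J₁ 𝓘(ℝ, Euc 0) C (fun _ => (0 : Euc 0)) (Euc d)) (v : Euc d) : X :=
  T.ψ (0, v)

/-- The domain of the parametrization belonging to a local trivialization over a point. -/
def domain (T : LocalTriv J₁ 𝓘(ℝ, Euc 0) C (fun _ => (0 : Euc 0)) (Euc d)) : Set (Euc d) :=
  {v | (0, v) ∈ T.V}

variable (T : LocalTriv J₁ 𝓘(ℝ, Euc 0) C (fun _ => (0 : Euc 0)) (Euc d))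

theorem isOpen_domain : IsOpen T.domain :=
  T.isOpen_V.preimage (Continuous.prodMk_right (0 : Euc 0))

theorem contMDiffOn_param : ContMDiffOn (𝓡 d) J₁ ∞ T.param T.domain :=
  T.smooth_ψ.comp (contMDiff_const.prodMk contMDiff_id).contMDiffOn fun _ hv => hv

open Classical in
/-- The chart of the subset `C` belonging to a local trivialization over a point. (The point `p`
supplies the junk values of the inverse.) -/
def chart (p : C) : OpenPartialHomeomorph C (Euc d) where
  toFun c := T.κ c
  invFun v := if h : v ∈ T.domain then ⟨T.param v, (T.mapsTo_ψ _ h).1⟩ else p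
  source := Subtype.val ⁻¹' T.U
  target := T.domain
  map_source' c hc := T.mem_V c ⟨c.2, hc⟩
  map_target' v hv := by
    rw [dif_pos hv]
    exact (T.mapsTo_ψ _ hv).2
  left_inv' c hc := by
    have h : T.κ c ∈ T.domain := T.mem_V c ⟨c.2, hc⟩
    rw [dif_pos h]
    exact Subtype.ext (T.ψ_κ c ⟨c.2, hc⟩)
  right_inv' v hv := by
    rw [dif_pos hv]
    exact T.κ_ψ _ hv
  open_source := T.isOpen_U.preimage continuous_subtype_val
  open_target := T.isOpen_domain
  continuousOn_toFun :=
    T.smooth_κ.continuousOn.comp continuous_subtype_val.continuousOn fun c hc => ⟨c.2, hc⟩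
  continuousOn_invFun := by
    rw [Topology.IsInducing.subtypeVal.continuousOn_iff]
    refine T.contMDiffOn_param.continuousOn.congr fun v hv => ?_
    simp only [Function.comp_apply]
    rw [dif_pos hv]

open Classical in
theorem val_chart_symm (p : C) {v : Euc d} (hv : v ∈ T.domain) :
    ((T.chart p).symm v : X) = T.param v := by
  change ((if h : v ∈ T.domain then (⟨T.param v, (T.mapsTo_ψ _ h).1⟩ : C) else p : C) : X) = _
  rw [dif_pos hv]

end LocalTriv

namespace IsLocParam

variable (h : IsLocParam J₁ C d)

/-- The manifold structure of a locally parametrized subset. -/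
abbrev chartedSpace : ChartedSpace (Euc d) C where
  atlas := {e | ∃ (T : LocalTriv J₁ 𝓘(ℝ, Euc 0) C (fun _ => (0 : Euc 0)) (Euc d)) (p : C),
    e = T.chart p}
  chartAt p := (h.exists_triv p p.2).choose.chart p
  mem_chart_source p := (h.exists_triv p p.2).choose_spec
  chart_mem_atlas p := ⟨_, p, rfl⟩

theorem isManifold : letI := h.chartedSpace; IsManifold (𝓡 d) ∞ C := by
  let := h.chartedSpace
  apply isManifold_of_contDiffOn
  rintro _ _ ⟨T, p, rfl⟩ ⟨T', p', rfl⟩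
  have hsub : ∀ v ∈ ((T.chart p).symm ≫ₕ T'.chart p').source,
      v ∈ T.domain ∧ T.param v ∈ T'.U := by
    intro v hv
    rw [OpenPartialHomeomorph.trans_source] at hv
    have hv' : ((T.chart p).symm v : X) ∈ T'.U := hv.2
    rw [T.val_chart_symm p hv.1] at hv'
    exact ⟨hv.1, hv'⟩
  rw [← contMDiffOn_iff_contDiffOn]
  refine ContMDiffOn.congr (f := T'.κ ∘ T.param) (T'.smooth_κ.comp
    (T.contMDiffOn_param.mono fun v hv => (hsub v hv.1).1) fun v hv => ?_) fun v hv => ?_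
  · exact ⟨(T.mapsTo_ψ _ (hsub v hv.1).1).1, (hsub v hv.1).2⟩
  · exact congrArg T'.κ (T.val_chart_symm p (hsub v hv.1).1)

theorem contMDiff_val : letI := h.chartedSpace; ContMDiff (𝓡 d) J₁ ∞ (Subtype.val : C → X) := by
  let := h.chartedSpace
  have := h.isManifold
  intro p
  set T := (h.exists_triv p p.2).choose
  have hp : p ∈ (chartAt (Euc d) p).source := mem_chart_source _ p
  have h1 : ContMDiffOn (𝓡 d) (𝓡 d) ∞ (chartAt (Euc d) p) (chartAt (Euc d) p).source :=
    contMDiffOn_chart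
  have h2 : ContMDiffOn (𝓡 d) J₁ ∞ (T.param ∘ chartAt (Euc d) p) (chartAt (Euc d) p).source :=
    T.contMDiffOn_param.comp h1 fun c hc => (chartAt (Euc d) p).map_source hc
  refine (h2.congr fun c hc => ?_).contMDiffAt ((chartAt (Euc d) p).open_source.mem_nhds hp)
  exact (T.ψ_κ c ⟨c.2, hc⟩).symm

/-- A map into the subset `C` which is smooth as a map into the ambient manifold is smooth. -/
theorem contMDiffWithinAt_of_val {f : N → C} {s : Set N} {z : N}
    (hf : ContMDiffWithinAt J₂ J₁ ∞ (fun y => (f y : X)) s z) :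
    letI := h.chartedSpace; ContMDiffWithinAt J₂ (𝓡 d) ∞ f s z := by
  let := h.chartedSpace
  have := h.isManifold
  set T := (h.exists_triv (f z) (f z).2).choose
  have hz : f z ∈ (chartAt (Euc d) (f z)).source := mem_chart_source _ _
  have hcont : ContinuousWithinAt f s z :=
    (Topology.IsInducing.subtypeVal.continuousWithinAt_iff).2 hf.continuousWithinAt
  have hsrc : ∀ᶠ y in 𝓝[s] z, f y ∈ (chartAt (Euc d) (f z)).source :=
    hcont ((chartAt (Euc d) (f z)).open_source.mem_nhds hz)
  have h1 : ContMDiffWithinAt J₂ (𝓡 d) ∞ (fun y => T.κ (f y)) s z := by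
    have hmaps : MapsTo (fun y => (f y : X))
        (s ∩ {y | f y ∈ (chartAt (Euc d) (f z)).source}) (C ∩ T.U) :=
      fun y hy => ⟨(f y).2, hy.2⟩
    have := (T.smooth_κ (f z) ⟨(f z).2, hz⟩).comp z (hf.mono inter_subset_left) hmaps
    exact this.mono_of_mem_nhdsWithin (Filter.inter_mem self_mem_nhdsWithin hsrc)
  have h2 : ContMDiffAt (𝓡 d) (𝓡 d) ∞ (chartAt (Euc d) (f z)).symm (T.κ (f z)) :=
    contMDiffOn_chart_symm.contMDiffAt ((chartAt (Euc d) (f z)).open_target.mem_nhds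
      ((chartAt (Euc d) (f z)).map_source hz))
  refine (h2.comp_contMDiffWithinAt z h1).congr_of_eventuallyEq ?_ ?_
  · filter_upwards [hsrc] with y hy
    exact ((chartAt (Euc d) (f z)).left_inv hy).symm
  · exact ((chartAt (Euc d) (f z)).left_inv hz).symm

theorem injective_mfderiv_val (p : C) :
    letI := h.chartedSpace; Function.Injective (mfderiv (𝓡 d) J₁ (Subtype.val : C → X) p) := by
  let := h.chartedSpace
  have := h.isManifold
  set T := (h.exists_triv p p.2).choose
  have hp : p ∈ (chartAt (Euc d) p).source := mem_chart_source _ p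
  -- the chart around `p` is the restriction of `T.κ`, hence factors through the inclusion
  have hincl : HasMFDerivAt (𝓡 d) J₁ (Subtype.val : C → X) p _ :=
    ((h.contMDiff_val p).mdifferentiableAt (by simp)).hasMFDerivAt
  have hκ : HasMFDerivWithinAt J₁ (𝓡 d) T.κ (C ∩ T.U) p _ :=
    ((T.smooth_κ p ⟨p.2, hp⟩).mdifferentiableWithinAt (by simp)).hasMFDerivWithinAt
  have hcomp := hκ.comp p hincl.hasMFDerivWithinAt
    (s := Subtype.val ⁻¹' T.U) fun c hc => ⟨c.2, hc⟩
  have hcomp' := hcomp.hasMFDerivAt ((chartAt (Euc d) p).open_source.mem_nhds hp)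
  have hinv : (mfderiv (𝓡 d) 𝓘(ℝ, Euc d) (extChartAt (𝓡 d) p) p).IsInvertible :=
    isInvertible_mfderiv_extChartAt (mem_extChartAt_source p)
  have hfun : (extChartAt (𝓡 d) p : C → Euc d) = T.κ ∘ Subtype.val := by
    funext c
    rfl
  rw [hfun, hcomp'.mfderiv] at hinv
  exact fun a b hab => hinv.injective (by
    rw [ContinuousLinearMap.comp_apply, ContinuousLinearMap.comp_apply]; exact congrArg _ hab)

/-- A locally parametrized subset is a submanifold. -/
def submanifold [T2Space X] [SecondCountableTopology X] : ImmersedSubmanifold J₁ C :=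
  letI := h.chartedSpace
  { dim := d
    carrier := C
    isManifold := h.isManifold
    incl := Subtype.val
    contMDiff_incl := h.contMDiff_val
    injective_incl := Subtype.val_injective
    injective_mfderiv := h.injective_mfderiv_val
    range_incl := Subtype.range_coe }

variable [T2Space X] [SecondCountableTopology X]

theorem submanifold_isEmbedded : h.submanifold.IsEmbedded :=
  Topology.IsEmbedding.subtypeVal

theorem submanifold_contMDiffAt {f : N → h.submanifold.carrier} {z : N}
    (hf : ContMDiffAt J₂ J₁ ∞ (fun y => h.submanifold.incl (f y)) z) :
    ContMDiffAt J₂ (𝓡 h.submanifold.dim) ∞ f z :=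
  h.contMDiffWithinAt_of_val hf

end IsLocParam

end Submanifold

/-! ### Symplectic linear algebra and pullbacks of forms -/

section LinearAlgebra

/-- If `N` is orthogonal to `T` and of at least the complementary dimension, then it is the whole
orthogonal of `T`. -/
theorem mem_of_forall_apply_eq_zero {V : Type*} [AddCommGroup V] [Module ℝ V]
    [FiniteDimensional ℝ V] (σ : V →ₗ[ℝ] V →ₗ[ℝ] ℝ) (halt : ∀ v, σ v v = 0)
    (hnd : ∀ v, (∀ w, σ v w = 0) → v = 0) {N T : Submodule ℝ V}
    (hdim : Module.finrank ℝ V ≤ Module.finrank ℝ N + Module.finrank ℝ T)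
    (hNT : ∀ n ∈ N, ∀ t ∈ T, σ n t = 0) {v : V} (hv : ∀ t ∈ T, σ v t = 0) : v ∈ N := by
  have hA : LinearMap.IsAlt σ := halt
  have hneg : ∀ x y, σ x y = 0 → σ y x = 0 := fun x y h => by rw [← hA.neg, h, neg_zero]
  have hB : LinearMap.BilinForm.Nondegenerate (R := ℝ) (M := V) σ := by
    refine ⟨hnd, fun y hy => hnd y fun x => hneg _ _ (hy x)⟩
  have hle : N ≤ LinearMap.BilinForm.orthogonal σ T := fun n hn t ht => hneg _ _ (hNT n hn t ht)
  have := Submodule.eq_of_le_of_finrank_le hle (by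
    rw [LinearMap.BilinForm.finrank_orthogonal hB]
    omega)
  rw [this]
  exact fun t ht => hneg _ _ (hv t ht)

end LinearAlgebra

section Nondegenerate

variable {E₁ : Type*} [NormedAddCommGroup E₁] [NormedSpace ℝ E₁] {H₁ : Type*} [TopologicalSpace H₁]
  {J₁ : ModelWithCorners ℝ E₁ H₁} {X : Type*} [TopologicalSpace X] [ChartedSpace H₁ X]
  {E₂ : Type*} [NormedAddCommGroup E₂] [NormedSpace ℝ E₂] {H₂ : Type*} [TopologicalSpace H₂]
  {J₂ : ModelWithCorners ℝ E₂ H₂} {Q : Type*} [TopologicalSpace Q] [ChartedSpace H₂ Q]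

/-- The pointwise part of the notion of a symplectic form. -/
structure IsAlmostSymplectic (Ω : BilinField J₁ X) : Prop where
  alternating : ∀ (x : X) (v : TangentSpace J₁ x), Ω x v v = 0
  nondegenerate : ∀ (x : X) (v : TangentSpace J₁ x),
    (∀ w : TangentSpace J₁ x, Ω x v w = 0) → v = 0

theorem IsSymplecticForm.isAlmostSymplectic {Ω : BilinField J₁ X} (h : IsSymplecticForm J₁ Ω) :
    IsAlmostSymplectic Ω :=
  ⟨h.alternating, h.nondegenerate⟩

theorem IsAlmostSymplectic.neg {Ω : BilinField J₁ X} (h : IsAlmostSymplectic Ω) :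
    IsAlmostSymplectic (-Ω) :=
  ⟨fun x v => neg_eq_zero.2 (h.alternating x v),
    fun x v hv => h.nondegenerate x v fun w => neg_eq_zero.1 (hv w)⟩

theorem prodForm_apply (Ω : BilinField J₁ X) (η : BilinField J₂ Q) (p : X × Q) (v w : E₁ × E₂) :
    prodForm Ω η p v w = Ω p.1 v.1 w.1 + η p.2 v.2 w.2 := rfl

theorem IsAlmostSymplectic.prodForm {Ω : BilinField J₁ X} {η : BilinField J₂ Q}
    (h : IsAlmostSymplectic Ω) (h' : IsAlmostSymplectic η) :
    IsAlmostSymplectic (prodForm Ω η) := by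
  refine ⟨fun x v => ?_, fun x v hv => Prod.ext ?_ ?_⟩
  · refine (prodForm_apply Ω η x v v).trans ?_
    erw [h.alternating, h'.alternating, add_zero]
  · refine h.nondegenerate x.1 v.1 fun w => ?_
    have := (prodForm_apply Ω η x v (w, 0)).symm.trans (hv (w, 0))
    erw [map_zero, add_zero] at this
    exact this
  · refine h'.nondegenerate x.2 v.2 fun w => ?_
    have := (prodForm_apply Ω η x v (0, w)).symm.trans (hv (0, w))
    erw [map_zero, zero_add] at this
    exact this

end Nondegenerate

section PullsBack

variable {E₁ : Type*} [NormedAddCommGroup E₁] [NormedSpace ℝ E₁] {H₁ : Type*} [TopologicalSpace H₁]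
  {J₁ : ModelWithCorners ℝ E₁ H₁} {X : Type*} [TopologicalSpace X] [ChartedSpace H₁ X]
  {E₂ : Type*} [NormedAddCommGroup E₂] [NormedSpace ℝ E₂] {H₂ : Type*} [TopologicalSpace H₂]
  {J₂ : ModelWithCorners ℝ E₂ H₂} {Q : Type*} [TopologicalSpace Q] [ChartedSpace H₂ Q]
  {E₃ : Type*} [NormedAddCommGroup E₃] [NormedSpace ℝ E₃] {H₃ : Type*} [TopologicalSpace H₃]
  {J₃ : ModelWithCorners ℝ E₃ H₃} {R : Type*} [TopologicalSpace R] [ChartedSpace H₃ R]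
  {E₄ : Type*} [NormedAddCommGroup E₄] [NormedSpace ℝ E₄] {H₄ : Type*} [TopologicalSpace H₄]
  {J₄ : ModelWithCorners ℝ E₄ H₄} {S : Type*} [TopologicalSpace S] [ChartedSpace H₄ S]

/-- The map `π`, defined on the subset `C`, satisfies `π^* η = Ω|_C`. This is tested on the smooth
maps `f` from Euclidean spaces into `C`, so that no tangent spaces of `C` are needed. -/
def PullsBack (Ω : BilinField J₁ X) (η : BilinField J₂ Q) (C : Set X) (π : X → Q) : Prop :=
  ∀ (m : ℕ) (f : Euc m → X) (z : Euc m), ContMDiffAt (𝓡 m) J₁ ∞ f z → (∀ᶠ y in 𝓝 z, f y ∈ C) →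
    ∀ a b : Euc m, η (π (f z)) (mfderiv (𝓡 m) J₂ (π ∘ f) z a) (mfderiv (𝓡 m) J₂ (π ∘ f) z b) =
      Ω (f z) (mfderiv (𝓡 m) J₁ f z a) (mfderiv (𝓡 m) J₁ f z b)

theorem contMDiffAt_comp_of_eventually {π : X → Q} {C : Set X} (hπ : ContMDiffOn J₁ J₂ ∞ π C)
    {f : R → X} {z : R} (hf : ContMDiffAt J₃ J₁ ∞ f z) (hC : ∀ᶠ y in 𝓝 z, f y ∈ C) :
    ContMDiffAt J₃ J₂ ∞ (π ∘ f) z := by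
  have h : ContMDiffWithinAt J₃ J₂ ∞ (π ∘ f) {y | f y ∈ C} z :=
    (hπ (f z) hC.self_of_nhds).comp z hf.contMDiffWithinAt fun y hy => hy
  exact h.contMDiffAt hC

namespace PullsBack

variable {Ω : BilinField J₁ X} {η : BilinField J₂ Q} {θ : BilinField J₃ R} {ζ : BilinField J₄ S}
  {C : Set X} {π : X → Q}

theorem mono (h : PullsBack Ω η C π) {D : Set X} (hD : D ⊆ C) : PullsBack Ω η D π :=
  fun m f z hf hC => h m f z hf (hC.mono fun _ hy => hD hy)

theorem congr (h : PullsBack Ω η C π) {ρ : X → Q} (hρ : ∀ c ∈ C, ρ c = π c) :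
    PullsBack Ω η C ρ := by
  intro m f z hf hC a b
  have he : ρ ∘ f =ᶠ[𝓝 z] π ∘ f := hC.mono fun y hy => hρ _ hy
  rw [he.mfderiv_eq, hρ _ hC.self_of_nhds]
  exact h m f z hf hC a b

theorem comp (h : PullsBack Ω η C π) {D : Set Q} {ρ : Q → R} (h' : PullsBack η θ D ρ)
    (hπ : ContMDiffOn J₁ J₂ ∞ π C) : PullsBack Ω θ (C ∩ π ⁻¹' D) (ρ ∘ π) := by
  intro m f z hf hC a b
  rw [← h m f z hf (hC.mono fun y hy => hy.1) a b]
  exact h' m (π ∘ f) z (contMDiffAt_comp_of_eventually hπ hf (hC.mono fun y hy => hy.1))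
    (hC.mono fun y hy => hy.2) a b

theorem neg (h : PullsBack Ω η C π) : PullsBack (-Ω) (-η) C π :=
  fun m f z hf hC a b => congrArg Neg.neg (h m f z hf hC a b)

theorem prod (h : PullsBack Ω η C π) {D : Set R} {ρ : R → S} (h' : PullsBack θ ζ D ρ)
    (hπ : ContMDiffOn J₁ J₂ ∞ π C) (hρ : ContMDiffOn J₃ J₄ ∞ ρ D) :
    PullsBack (prodForm Ω θ) (prodForm η ζ) (C ×ˢ D) (Prod.map π ρ) := by
  intro m f z hf hC a b
  have h1 : ContMDiffAt (𝓡 m) J₁ ∞ (fun y => (f y).1) z := hf.fst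
  have h2 : ContMDiffAt (𝓡 m) J₃ ∞ (fun y => (f y).2) z := hf.snd
  have c1 : ∀ᶠ y in 𝓝 z, (f y).1 ∈ C := hC.mono fun y hy => hy.1
  have c2 : ∀ᶠ y in 𝓝 z, (f y).2 ∈ D := hC.mono fun y hy => hy.2
  have e1 : mfderiv (𝓡 m) (J₁.prod J₃) f z = _ :=
    ((h1.mdifferentiableAt (by simp)).hasMFDerivAt.prodMk
      (h2.mdifferentiableAt (by simp)).hasMFDerivAt).mfderiv
  have e2 : mfderiv (𝓡 m) (J₂.prod J₄) (Prod.map π ρ ∘ f) z = _ :=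
    (((contMDiffAt_comp_of_eventually hπ h1 c1).mdifferentiableAt (by simp)).hasMFDerivAt.prodMk
      ((contMDiffAt_comp_of_eventually hρ h2 c2).mdifferentiableAt (by simp)).hasMFDerivAt).mfderiv
  rw [e1, e2]
  exact congrArg₂ (· + ·) (h m _ z h1 c1 a b) (h' m _ z h2 c2 a b)

protected theorem id : PullsBack Ω Ω (univ : Set X) id :=
  fun _ _ _ _ _ _ _ => rfl

end PullsBack

/-- Near every point a manifold without boundary is parametrized by a Euclidean space. -/
theorem exists_smooth_param [FiniteDimensional ℝ E₁] [J₁.Boundaryless] [IsManifold J₁ ∞ X]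
    (p : X) : ∃ (m : ℕ) (φ : Euc m → X) (z : Euc m), φ z = p ∧ ContMDiffAt (𝓡 m) J₁ ∞ φ z ∧
      Function.Surjective (mfderiv (𝓡 m) J₁ φ z) := by
  let L : Euc (Module.finrank ℝ E₁) ≃L[ℝ] E₁ := ContinuousLinearEquiv.ofFinrankEq (by simp)
  have hsymm : ContMDiffAt 𝓘(ℝ, E₁) J₁ ∞ (extChartAt J₁ p).symm (extChartAt J₁ p p) :=
    (contMDiffOn_extChartAt_symm p).contMDiffAt
      ((isOpen_extChartAt_target p).mem_nhds (mem_extChartAt_target p))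
  have hL : L (L.symm (extChartAt J₁ p p)) = extChartAt J₁ p p := L.apply_symm_apply _
  refine ⟨_, (extChartAt J₁ p).symm ∘ L, L.symm (extChartAt J₁ p p), ?_, ?_, ?_⟩
  · rw [Function.comp_apply, hL, extChartAt_to_inv]
  · exact ContMDiffAt.comp _ (hL.symm ▸ hsymm) L.contDiff.contMDiff.contMDiffAt
  · have h1 : HasMFDerivAt 𝓘(ℝ, E₁) J₁ (extChartAt J₁ p).symm (extChartAt J₁ p p) _ :=
      (hsymm.mdifferentiableAt (by simp)).hasMFDerivAt
    rw [← hL] at h1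
    have h2 : HasMFDerivAt (𝓡 (Module.finrank ℝ E₁)) 𝓘(ℝ, E₁) L (L.symm (extChartAt J₁ p p))
        (L : Euc (Module.finrank ℝ E₁) →L[ℝ] E₁) := L.hasFDerivAt.hasMFDerivAt
    rw [(h1.comp _ h2).mfderiv]
    have hinv := isInvertible_mfderivWithin_extChartAt_symm (I := J₁) (mem_extChartAt_target p)
    rw [J₁.range_eq_univ, mfderivWithin_univ, ← hL] at hinv
    exact hinv.surjective.comp L.surjective

/-- The identity `π^* η = Ω|_C`, tested on a map from an arbitrary manifold. -/
theorem PullsBack.apply_of_contMDiffAt [FiniteDimensional ℝ E₃] [J₃.Boundaryless]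
    [IsManifold J₃ ∞ R] {Ω : BilinField J₁ X} {η : BilinField J₂ Q} {C : Set X} {π : X → Q}
    (h : PullsBack Ω η C π) (hπ : ContMDiffOn J₁ J₂ ∞ π C) {F : R → X} {p : R}
    (hF : ContMDiffAt J₃ J₁ ∞ F p) (hC : ∀ᶠ y in 𝓝 p, F y ∈ C) (v w : TangentSpace J₃ p) :
    η (π (F p)) (mfderiv J₃ J₂ (π ∘ F) p v) (mfderiv J₃ J₂ (π ∘ F) p w) =
      Ω (F p) (mfderiv J₃ J₁ F p v) (mfderiv J₃ J₁ F p w) := by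
  obtain ⟨m, φ, z, rfl, hφ, hsurj⟩ := exists_smooth_param (J₁ := J₃) p
  obtain ⟨a, rfl⟩ := hsurj v
  obtain ⟨b, rfl⟩ := hsurj w
  have key := h m (F ∘ φ) z (hF.comp z hφ) (hφ.continuousAt.eventually hC) a b
  have e1 := mfderiv_comp z (hF.mdifferentiableAt (by simp)) (hφ.mdifferentiableAt (by simp))
  have e2 := mfderiv_comp z ((contMDiffAt_comp_of_eventually hπ hF hC).mdifferentiableAt (by simp))
    (hφ.mdifferentiableAt (by simp))
  rw [← Function.comp_assoc, e1, e2] at key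
  exact key

end PullsBack

/-! ### Coisotropic and Lagrangian submanifolds from dimension counts -/

section Coisotropic

variable {E₁ : Type*} [NormedAddCommGroup E₁] [NormedSpace ℝ E₁] {H₁ : Type*} [TopologicalSpace H₁]
  {J₁ : ModelWithCorners ℝ E₁ H₁} {X : Type u} [TopologicalSpace X] [ChartedSpace H₁ X]
  {E₂ : Type*} [NormedAddCommGroup E₂] [NormedSpace ℝ E₂] {H₂ : Type*} [TopologicalSpace H₂]
  {J₂ : ModelWithCorners ℝ E₂ H₂} {Q : Type*} [TopologicalSpace Q] [ChartedSpace H₂ Q]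
  {Ω : BilinField J₁ X} {η : BilinField J₂ Q} {C : Set X}

namespace ImmersedSubmanifold

theorem finrank_tangent (Y : ImmersedSubmanifold J₁ C) (p : Y.carrier) :
    Module.finrank ℝ (Y.tangent p) = Y.dim := by
  have h : Module.finrank ℝ (LinearMap.range (mfderiv (𝓡 Y.dim) J₁ Y.incl p).toLinearMap) =
      Module.finrank ℝ (Euc Y.dim) := LinearMap.finrank_range_of_inj (Y.injective_mfderiv p)
  exact h.trans (by simp)

/-- A submanifold with a reduction map onto `Q` is coisotropic as soon as the dimension of `Q` is
the expected one: the kernel of the derivative of the reduction map is orthogonal to the tangent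
space, and it has the dimension of the orthogonal. -/
theorem IsReductionMap.isCoisotropic [FiniteDimensional ℝ E₁] (hΩ : IsAlmostSymplectic Ω)
    {Y : ImmersedSubmanifold J₁ C} {π : Y.carrier → Q} (hπ : Y.IsReductionMap Ω η π)
    (hdim : Nonempty X →
      Module.finrank ℝ E₁ + Module.finrank ℝ E₂ = 2 * Y.dim) : Y.IsCoisotropic Ω := by
  intro p v hv
  let A : Euc Y.dim →ₗ[ℝ] E₁ := (mfderiv (𝓡 Y.dim) J₁ Y.incl p).toLinearMap
  let B : Euc Y.dim →ₗ[ℝ] E₂ := (mfderiv (𝓡 Y.dim) J₂ π p).toLinearMap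
  have hA : Function.Injective A := Y.injective_mfderiv p
  have hB : Function.Surjective B := hπ.submersion p
  have hker := LinearMap.finrank_range_add_finrank_ker B
  rw [LinearMap.range_eq_top.2 hB, finrank_top] at hker
  have hmap : Module.finrank ℝ ((LinearMap.ker B).map A) = Module.finrank ℝ (LinearMap.ker B) :=
    (Submodule.equivMapOfInjective A hA _).finrank_eq.symm
  have hT : Module.finrank ℝ (LinearMap.range A) = Y.dim := Y.finrank_tangent p
  have hE := hdim ⟨Y.incl p⟩
  have hEuc : Module.finrank ℝ (Euc Y.dim) = Y.dim := by simp
  let σ : E₁ →ₗ[ℝ] E₁ →ₗ[ℝ] ℝ := Ω (Y.incl p)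
  have hmem := mem_of_forall_apply_eq_zero (V := E₁) σ (hΩ.alternating _)
    (hΩ.nondegenerate _) (N := (LinearMap.ker B).map A) (T := LinearMap.range A) (by omega)
    (by
      rintro _ ⟨n, hn, rfl⟩ _ ⟨t, rfl⟩
      have h1 := hπ.pullback_eq p n t
      have h2 : mfderiv (𝓡 Y.dim) J₂ π p n = 0 := hn
      rw [h2, map_zero, LinearMap.zero_apply] at h1
      exact h1.symm) hv
  obtain ⟨n, -, rfl⟩ := hmem
  exact ⟨n, rfl⟩

/-- An isotropic submanifold of half the dimension is Lagrangian. -/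
theorem isLagrangian_of_isotropic [FiniteDimensional ℝ E₁] (hΩ : IsAlmostSymplectic Ω)
    {Y : ImmersedSubmanifold J₁ C}
    (hiso : ∀ (p : Y.carrier) (v w : TangentSpace (𝓡 Y.dim) p),
      Ω (Y.incl p) (mfderiv (𝓡 Y.dim) J₁ Y.incl p v) (mfderiv (𝓡 Y.dim) J₁ Y.incl p w) = 0)
    (hdim : Nonempty X → Module.finrank ℝ E₁ = 2 * Y.dim) : Y.IsLagrangian Ω := by
  intro p v
  constructor
  · rintro ⟨a, rfl⟩ _ ⟨b, rfl⟩
    exact hiso p a b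
  · intro hv
    have hT := Y.finrank_tangent p
    have hE := hdim ⟨Y.incl p⟩
    let σ : E₁ →ₗ[ℝ] E₁ →ₗ[ℝ] ℝ := Ω (Y.incl p)
    refine mem_of_forall_apply_eq_zero (V := E₁) σ (hΩ.alternating _)
      (hΩ.nondegenerate _) (N := Y.tangent p) (T := Y.tangent p) ?_ ?_ hv
    · exact (hE.trans (by rw [two_mul, ← hT]; rfl)).le
    · rintro _ ⟨a, rfl⟩ _ ⟨b, rfl⟩
      exact hiso p a b

/-- A Lagrangian submanifold has half the dimension. -/
theorem IsLagrangian.finrank_eq [FiniteDimensional ℝ E₁] (hΩ : IsAlmostSymplectic Ω)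
    {Y : ImmersedSubmanifold J₁ C} (hY : Y.IsLagrangian Ω) (p : Y.carrier) :
    Module.finrank ℝ E₁ = 2 * Y.dim := by
  have hT : Module.finrank ℝ (Y.tangent p) = Y.dim := Y.finrank_tangent p
  let σ : LinearMap.BilinForm ℝ E₁ := Ω (Y.incl p)
  have hA : LinearMap.IsAlt σ := hΩ.alternating _
  have hneg : ∀ x y, σ x y = 0 → σ y x = 0 := fun x y h => by rw [← hA.neg, h, neg_zero]
  have hB : σ.Nondegenerate :=
    ⟨hΩ.nondegenerate _, fun y hy => hΩ.nondegenerate _ y fun x => hneg _ _ (hy x)⟩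
  let T : Submodule ℝ E₁ := Y.tangent p
  have hperp : σ.orthogonal T = T := by
    ext v
    refine ⟨fun hv => (hY p v).2 fun w hw => hneg _ _ (hv w hw), fun hv w hw => ?_⟩
    exact hneg _ _ ((hY p v).1 hv w hw)
  have h1 := LinearMap.BilinForm.finrank_orthogonal hB T
  rw [hperp] at h1
  have h2 := Submodule.finrank_le T
  have hT' : Module.finrank ℝ T = Y.dim := hT
  omega

end ImmersedSubmanifold

/-- A subset with a locally trivial map onto open parts of a manifold is locally parametrized: the
map is composed with the map of the manifold to a point. -/
theorem IsLocTriv.isLocParam {E : Type*} [NormedAddCommGroup E] [NormedSpace ℝ E]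
    [FiniteDimensional ℝ E] {Q : Type*} [TopologicalSpace Q] [ChartedSpace E Q]
    [IsManifold 𝓘(ℝ, E) ∞ Q] {π : X → Q} {d : ℕ} (h : IsLocTriv J₁ 𝓘(ℝ, E) C π d) :
    IsLocParam J₁ C (Module.finrank ℝ E + d) := by
  have := h.comp IsLocTriv.toPoint
  rwa [preimage_univ, inter_univ] at this

variable [T2Space X] [SecondCountableTopology X]

/-- A locally trivial map pulling `η` back to the restriction of `Ω` is a reduction map. -/
theorem IsLocTriv.isReductionMap {E : Type*} [NormedAddCommGroup E] [NormedSpace ℝ E]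
    [FiniteDimensional ℝ E] {Q : Type*} [TopologicalSpace Q] [ChartedSpace E Q]
    [IsManifold 𝓘(ℝ, E) ∞ Q] {π : X → Q} {d d' : ℕ} (h : IsLocTriv J₁ 𝓘(ℝ, E) C π d)
    (hC : IsLocParam J₁ C d')
    (hsurj : ∀ q, ∃ c ∈ C, π c = q) {η : BilinField 𝓘(ℝ, E) Q} (hpull : PullsBack Ω η C π) :
    hC.submanifold.IsReductionMap Ω η fun p => π (hC.submanifold.incl p) := by
  have hmem : ∀ p, hC.submanifold.incl p ∈ C := fun p => Subtype.property (p := (· ∈ C)) p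
  have hsm : ContMDiff (𝓡 hC.submanifold.dim) 𝓘(ℝ, E) ∞ fun p => π (hC.submanifold.incl p) :=
    h.smooth.comp_contMDiff hC.submanifold.contMDiff_incl hmem
  refine ⟨hsm, fun q => ?_, fun p => ?_, fun p v w => ?_⟩
  · obtain ⟨c, hc, rfl⟩ := hsurj q
    exact ⟨⟨c, hc⟩, rfl⟩
  · -- a local section of `π` through `p`
    classical
    obtain ⟨T, hT⟩ := h.exists_triv (hC.submanifold.incl p) (hmem p)
    set x := hC.submanifold.incl p
    have hV : (π x, T.κ x) ∈ T.V := T.mem_V x ⟨hmem p, hT⟩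
    have hcont : Continuous fun q : Q => (q, T.κ x) := by fun_prop
    have hev : ∀ᶠ q in 𝓝 (π x), (q, T.κ x) ∈ T.V :=
      hcont.continuousAt.eventually (T.isOpen_V.mem_nhds hV)
    let s : Q → hC.submanifold.carrier := fun q =>
      if hq : (q, T.κ x) ∈ T.V then ⟨T.ψ (q, T.κ x), (T.mapsTo_ψ _ hq).1⟩ else p
    have hs : ∀ q, (q, T.κ x) ∈ T.V → hC.submanifold.incl (s q) = T.ψ (q, T.κ x) := by
      intro q hq
      exact (congrArg hC.submanifold.incl (dif_pos hq)).trans rfl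
    have hψ : ContMDiffAt 𝓘(ℝ, E) J₁ ∞ (fun q => T.ψ (q, T.κ x)) (π x) :=
      ContMDiffAt.comp (π x) (T.smooth_ψ.contMDiffAt (T.isOpen_V.mem_nhds hV))
        (contMDiffAt_id.prodMk contMDiffAt_const)
    have hssm : ContMDiffAt 𝓘(ℝ, E) (𝓡 hC.submanifold.dim) ∞ s (π x) :=
      hC.submanifold_contMDiffAt (hψ.congr_of_eventuallyEq (hev.mono fun q hq => hs q hq))
    have hsx : s (π x) = p := by
      refine hC.submanifold.injective_incl ((hs _ hV).trans (T.ψ_κ x ⟨hmem p, hT⟩))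
    have hid : (fun p => π (hC.submanifold.incl p)) ∘ s =ᶠ[𝓝 (π x)] id := by
      filter_upwards [hev] with q hq
      rw [Function.comp_apply, hs q hq, T.π_ψ _ hq]
      rfl
    have hd1 : HasMFDerivAt (𝓡 hC.submanifold.dim) 𝓘(ℝ, E)
        (fun p => π (hC.submanifold.incl p)) (s (π x)) _ :=
      ((hsm _).mdifferentiableAt (by simp)).hasMFDerivAt
    have hd := (hd1.comp (π x) (hssm.mdifferentiableAt (by simp)).hasMFDerivAt).mfderiv
    rw [hid.mfderiv_eq, mfderiv_id] at hd
    rw [← hsx]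
    intro v
    exact ⟨mfderiv 𝓘(ℝ, E) (𝓡 hC.submanifold.dim) s (π x) v,
      (congrArg (fun A => A v) hd).symm⟩
  · exact hpull.apply_of_contMDiffAt h.smooth (hC.submanifold.contMDiff_incl p)
      (Filter.Eventually.of_forall hmem) v w

/-- A locally parametrized, isotropic subset of half the dimension is an immersed Lagrangian
submanifold. -/
theorem IsLocParam.isImmersedLagrangian [FiniteDimensional ℝ E₁] {d : ℕ} (h : IsLocParam J₁ C d)
    (hΩ : IsAlmostSymplectic Ω) {η : BilinField 𝓘(ℝ, Euc 0) (Euc 0)}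
    (hpull : PullsBack Ω η C fun _ => (0 : Euc 0))
    (hdim : Nonempty X → Module.finrank ℝ E₁ = 2 * d) : IsImmersedLagrangian Ω C := by
  refine ⟨h.submanifold, ImmersedSubmanifold.isLagrangian_of_isotropic hΩ (fun p v w => ?_) hdim⟩
  have hmem : ∀ p, h.submanifold.incl p ∈ C := fun p => Subtype.property (p := (· ∈ C)) p
  have := hpull.apply_of_contMDiffAt h.smooth (h.submanifold.contMDiff_incl p)
      (Filter.Eventually.of_forall hmem) v w
  rw [← this]
  let σ : Euc 0 →ₗ[ℝ] Euc 0 →ₗ[ℝ] ℝ := η 0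
  have h0 : ∀ a b, σ a b = 0 := fun a b => by
    rw [Subsingleton.elim a 0, map_zero, LinearMap.zero_apply]
  exact h0 _ _

end Coisotropic

/-! ### Submersions, and maps into embedded submanifolds -/

section InverseFunction

variable {E : Type*} [NormedAddCommGroup E] [NormedSpace ℝ E] [CompleteSpace E]
  {F : Type*} [NormedAddCommGroup F] [NormedSpace ℝ F]

/-- The inverse function theorem, with a local inverse which is smooth on its whole domain. -/
theorem exists_openPartialHomeomorph_contDiffOn_symm {Φ : E → F} {O : Set E} (hO : IsOpen O)
    (hΦ : ContDiffOn ℝ ∞ Φ O) {y₀ : E} (hy₀ : y₀ ∈ O) {Φ' : E ≃L[ℝ] F}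
    (hΦ' : HasFDerivAt Φ (Φ' : E →L[ℝ] F) y₀) :
    ∃ e : OpenPartialHomeomorph E F, y₀ ∈ e.source ∧ e.source ⊆ O ∧ (∀ y, e y = Φ y) ∧
      ContDiffOn ℝ ∞ e.symm e.target := by
  have hat : ContDiffAt ℝ ∞ Φ y₀ := hΦ.contDiffAt (hO.mem_nhds hy₀)
  let e₀ := hat.toOpenPartialHomeomorph Φ hΦ' (by simp)
  have hcont : ContinuousAt (fderiv ℝ Φ) y₀ :=
    ((hΦ.continuousOn_fderiv_of_isOpen hO (by simp)).continuousAt (hO.mem_nhds hy₀))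
  have hinv : ∀ᶠ y in 𝓝 y₀, fderiv ℝ Φ y ∈ range ((↑) : (E ≃L[ℝ] F) → E →L[ℝ] F) := by
    refine hcont.eventually ?_
    rw [hΦ'.fderiv]
    exact ContinuousLinearEquiv.nhds Φ'
  obtain ⟨W, hW, hWo, hyW⟩ := eventually_nhds_iff.1 hinv
  have hs : (e₀.restr (O ∩ W)).source = e₀.source ∩ (O ∩ W) :=
    e₀.restr_source' _ (hO.inter hWo)
  -- on `W` the derivative is invertible, so the inverse is smooth at each point of the image
  refine ⟨e₀.restr (O ∩ W), ?_, ?_, fun y => rfl, fun w hw => ?_⟩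
  · rw [hs]
    exact ⟨hat.mem_toOpenPartialHomeomorph_source hΦ' (by simp), hy₀, hyW⟩
  · rw [hs]
    exact fun y hy => hy.2.1
  · have hmem := (e₀.restr (O ∩ W)).map_target hw
    rw [hs] at hmem
    obtain ⟨A, hA⟩ := hW _ hmem.2.2
    have hd := hΦ.contDiffAt (hO.mem_nhds hmem.2.1)
    refine (OpenPartialHomeomorph.contDiffAt_symm (e₀.restr (O ∩ W)) hw (f₀' := A) ?_
      hd).contDiffWithinAt
    rw [hA]
    exact (hd.differentiableAt (by simp)).hasFDerivAt

end InverseFunction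

section Submersion

variable {E : Type*} [NormedAddCommGroup E] [NormedSpace ℝ E] [FiniteDimensional ℝ E]
  {X : Type*} [TopologicalSpace X] [ChartedSpace E X] [IsManifold 𝓘(ℝ, E) ∞ X]
  {B : Type*} [NormedAddCommGroup B] [NormedSpace ℝ B]
  {Q : Type*} [TopologicalSpace Q] [ChartedSpace B Q] [IsManifold 𝓘(ℝ, B) ∞ Q]

/-- A surjective linear map is a coordinate projection: a projection onto its kernel supplies the
other coordinates. -/
theorem exists_prod_ker_equiv (A : E →L[ℝ] B) (hA : Function.Surjective A) :
    ∃ (P : E →L[ℝ] A.ker) (e : E ≃L[ℝ] B × A.ker), ∀ x, e x = (A x, P x) := by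
  obtain ⟨P, hP⟩ := Submodule.ClosedComplemented.of_finiteDimensional A.ker
  have : FiniteDimensional ℝ B := Module.Finite.of_surjective A.toLinearMap hA
  refine ⟨P, (LinearEquiv.ofBijective (A.prod P).toLinearMap ⟨?_, ?_⟩).toContinuousLinearEquiv,
    fun x => rfl⟩
  · rw [injective_iff_map_eq_zero]
    intro x hx
    have h1 : A x = 0 := congrArg Prod.fst hx
    have h2 : P x = 0 := congrArg Prod.snd hx
    have h3 := hP ⟨x, h1⟩
    rw [h2] at h3
    exact congrArg Subtype.val h3.symm
  · rintro ⟨b, k⟩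
    obtain ⟨r, rfl⟩ := hA b
    refine ⟨r + (k - P r : A.ker), ?_⟩
    have h1 : A (k - P r : A.ker) = 0 := (k - P r : A.ker).2
    change (A (r + (k - P r : A.ker)), P (r + (k - P r : A.ker))) = (A r, k)
    rw [map_add, map_add, hP, h1]
    simp

/-- A submersion is locally trivial. In charts, its coordinate expression `F`, completed by a linear
projection `P` onto the kernel of the derivative, is a local diffeomorphism; `P` is the fibre
coordinate. -/
theorem isLocTriv_of_submersion {f : X → Q} (hf : ContMDiff 𝓘(ℝ, E) 𝓘(ℝ, B) ∞ f)
    (hsurj : ∀ p, Function.Surjective (mfderiv 𝓘(ℝ, E) 𝓘(ℝ, B) f p)) :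
    IsLocTriv 𝓘(ℝ, E) 𝓘(ℝ, B) (univ : Set X) f (Module.finrank ℝ E - Module.finrank ℝ B) := by
  refine ⟨hf.contMDiffOn, fun p _ => ?_⟩
  let cX := extChartAt 𝓘(ℝ, E) p
  let cQ := extChartAt 𝓘(ℝ, B) (f p)
  let A : E →L[ℝ] B := mfderiv 𝓘(ℝ, E) 𝓘(ℝ, B) f p
  have hA : Function.Surjective A := hsurj p
  obtain ⟨P, A', hA'⟩ := exists_prod_ker_equiv A hA
  have hdim : Module.finrank ℝ A.ker = Module.finrank ℝ E - Module.finrank ℝ B := by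
    have := A.toLinearMap.finrank_range_add_finrank_ker
    rw [LinearMap.range_eq_top.2 hA, finrank_top] at this
    exact (Nat.sub_eq_of_eq_add' this.symm).symm
  let F : E → B := cQ ∘ f ∘ cX.symm
  -- the open set on which the coordinate expression `F` of `f` is defined
  let O : Set E := cX.target ∩ (f ∘ cX.symm) ⁻¹' cQ.source
  have hfc : ContMDiffOn 𝓘(ℝ, E) 𝓘(ℝ, B) ∞ (f ∘ cX.symm) cX.target :=
    hf.comp_contMDiffOn (contMDiffOn_extChartAt_symm p)
  have hO : IsOpen O := hfc.continuousOn.isOpen_inter_preimage (isOpen_extChartAt_target p)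
    (isOpen_extChartAt_source (f p))
  have hcQ : ContMDiffOn 𝓘(ℝ, B) 𝓘(ℝ, B) ∞ cQ cQ.source := by
    have h := contMDiffOn_extChartAt (I := 𝓘(ℝ, B)) (n := ∞) (x := f p)
    rwa [← extChartAt_source 𝓘(ℝ, B)] at h
  have hcX : ContMDiffOn 𝓘(ℝ, E) 𝓘(ℝ, E) ∞ cX cX.source := by
    have h := contMDiffOn_extChartAt (I := 𝓘(ℝ, E)) (n := ∞) (x := p)
    rwa [← extChartAt_source 𝓘(ℝ, E)] at h
  have hF : ContDiffOn ℝ ∞ F O :=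
    contMDiffOn_iff_contDiffOn.1 (hcQ.comp (hfc.mono inter_subset_left) fun y hy => hy.2)
  have hp0 : cX.symm (cX p) = p := extChartAt_to_inv p
  have hy₀ : cX p ∈ O := by
    refine ⟨mem_extChartAt_target p, ?_⟩
    rw [mem_preimage, Function.comp_apply, hp0]
    exact mem_extChartAt_source (f p)
  have hF' : HasFDerivAt F A (cX p) := by
    have h : HasFDerivWithinAt F A (range 𝓘(ℝ, E)) (cX p) :=
      ((hf p).mdifferentiableAt (by simp)).hasMFDerivAt.2
    rw [ModelWithCorners.range_eq_univ, hasFDerivWithinAt_univ] at h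
    exact h
  have hΦ : ContDiffOn ℝ ∞ (fun y => (F y, P y)) O := hF.prodMk P.contDiff.contDiffOn
  have hΦ' : HasFDerivAt (fun y => (F y, P y)) (A' : E →L[ℝ] B × A.ker) (cX p) := by
    have h := hF'.prodMk P.hasFDerivAt (x := cX p)
    convert h using 1
    ext x : 1
    exact hA' x
  obtain ⟨e, he₀, heO, he, hes⟩ := exists_openPartialHomeomorph_contDiffOn_symm hO hΦ hy₀ hΦ'
  have hsrc : ∀ x : X, x ∈ cX.source → cX x ∈ e.source → f x ∈ cQ.source := by
    intro x hx hxe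
    have := (heO hxe).2
    rwa [mem_preimage, Function.comp_apply, cX.left_inv hx] at this
  have heX : ∀ x : X, x ∈ cX.source → e (cX x) = (cQ (f x), P (cX x)) := by
    intro x hx
    rw [he]
    simp only [F, Function.comp_apply, cX.left_inv hx]
  let T : LocalTriv 𝓘(ℝ, E) 𝓘(ℝ, B) (univ : Set X) f A.ker := {
    U := cX.source ∩ cX ⁻¹' e.source
    V := (cQ.source ×ˢ univ) ∩ (fun v => (cQ v.1, v.2)) ⁻¹' e.target
    ψ := fun v => cX.symm (e.symm (cQ v.1, v.2))
    κ := fun x => P (cX x)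
    isOpen_U := hcX.continuousOn.isOpen_inter_preimage (isOpen_extChartAt_source p) e.open_source
    isOpen_V := by
      refine ContinuousOn.isOpen_inter_preimage ?_
        ((isOpen_extChartAt_source (f p)).prod isOpen_univ) e.open_target
      exact (hcQ.continuousOn.comp continuousOn_fst fun v hv => hv.1).prodMk continuousOn_snd
    smooth_ψ := by
      refine (contMDiffOn_extChartAt_symm p).comp (t := cX.target)
        (f := fun v : Q × A.ker => e.symm (cQ v.1, v.2)) ?_
        fun v hv => (heO (e.map_target hv.2)).1
      refine (contMDiffOn_iff_contDiffOn.2 hes).comp ?_ fun v hv => hv.2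
      exact (hcQ.comp contMDiffOn_fst fun v hv => hv.1.1).prodMk_space contMDiffOn_snd
    smooth_κ := P.contDiff.contMDiff.comp_contMDiffOn (hcX.mono fun x hx => hx.2.1)
    mapsTo_ψ := by
      intro v hv
      have h1 := e.map_target hv.2
      have h2 := (heO h1).1
      refine ⟨trivial, cX.map_target h2, ?_⟩
      rw [mem_preimage, cX.right_inv h2]
      exact h1
    π_ψ := by
      intro v hv
      have h1 := e.map_target hv.2
      have h2 := heO h1
      have h3 := e.right_inv hv.2
      rw [he] at h3
      exact cQ.injOn h2.2 hv.1.1 (congrArg Prod.fst h3)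
    κ_ψ := by
      intro v hv
      have h1 := e.map_target hv.2
      have h3 := e.right_inv hv.2
      rw [he] at h3
      rw [cX.right_inv (heO h1).1]
      exact congrArg Prod.snd h3
    mem_V := by
      rintro x ⟨-, hx, hxe⟩
      refine ⟨⟨hsrc x hx hxe, trivial⟩, ?_⟩
      rw [mem_preimage, ← heX x hx]
      exact e.map_source hxe
    ψ_κ := by
      rintro x ⟨-, hx, hxe⟩
      dsimp only
      rw [← heX x hx, e.left_inv hxe, cX.left_inv hx] }
  exact ⟨T.congrFibre (ContinuousLinearEquiv.ofFinrankEq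
    (by rw [hdim, finrank_euclideanSpace_fin])),
    mem_extChartAt_source p, he₀⟩

end Submersion

section Embedded

variable {E₁ : Type*} [NormedAddCommGroup E₁] [NormedSpace ℝ E₁] [FiniteDimensional ℝ E₁]
  {H₁ : Type*} [TopologicalSpace H₁]
  {J₁ : ModelWithCorners ℝ E₁ H₁} {X : Type u} [TopologicalSpace X] [ChartedSpace H₁ X]

/-- A continuous map is smooth if its composition with an immersion is smooth. In charts, a linear
left inverse of the derivative of the immersion makes the latter a local diffeomorphism of a
Euclidean space. -/
theorem contMDiffAt_of_comp_immersion {d : ℕ} {Y : Type*} [TopologicalSpace Y]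
    [ChartedSpace (Euc d) Y] [IsManifold (𝓡 d) ∞ Y] {E₂ : Type*} [NormedAddCommGroup E₂]
    [NormedSpace ℝ E₂] {H₂ : Type*} [TopologicalSpace H₂] {J₂ : ModelWithCorners ℝ E₂ H₂}
    {N : Type*} [TopologicalSpace N] [ChartedSpace H₂ N] {i : Y → X} {g : N → Y} {z : N}
    (hi : ContMDiffAt (𝓡 d) J₁ ∞ i (g z))
    (hinj : Function.Injective (mfderiv (𝓡 d) J₁ i (g z))) (hg : ContinuousAt g z)
    (hig : ContMDiffAt J₂ J₁ ∞ (i ∘ g) z) : ContMDiffAt J₂ (𝓡 d) ∞ g z := by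
  set p := g z with hp
  let c := extChartAt (𝓡 d) p
  let cX := extChartAt J₁ (i p)
  let F : Euc d → E₁ := cX ∘ i ∘ c.symm
  have hF : ContDiffAt ℝ ∞ F (c p) := by
    have h := (contMDiffAt_iff.1 hi).2
    rwa [ModelWithCorners.range_eq_univ, contDiffWithinAt_univ] at h
  let D : Euc d →L[ℝ] E₁ := mfderiv (𝓡 d) J₁ i p
  have hF' : HasFDerivAt F D (c p) := by
    have h : HasFDerivWithinAt F D (range (𝓡 d)) (c p) :=
      (hi.mdifferentiableAt (by simp)).hasMFDerivAt.2
    rwa [ModelWithCorners.range_eq_univ, hasFDerivWithinAt_univ] at h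
  obtain ⟨l₀, hl₀⟩ := D.toLinearMap.exists_leftInverse_of_injective (LinearMap.ker_eq_bot.2 hinj)
  let l : E₁ →L[ℝ] Euc d := LinearMap.toContinuousLinearMap l₀
  have hl : ∀ a, l (D a) = a := fun a => congrArg (fun B => B a) hl₀
  have hlF : ContDiffAt ℝ ∞ (l ∘ F) (c p) := l.contDiff.contDiffAt.comp _ hF
  have hlF' : HasFDerivAt (l ∘ F)
      ((ContinuousLinearEquiv.refl ℝ (Euc d) : Euc d →L[ℝ] Euc d)) (c p) := by
    have h := l.hasFDerivAt.comp (c p) hF'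
    have he : l.comp D = (ContinuousLinearEquiv.refl ℝ (Euc d) : Euc d →L[ℝ] Euc d) :=
      ContinuousLinearMap.ext hl
    rwa [he] at h
  let σ := hlF.localInverse hlF' (by simp)
  have hσ : ContDiffAt ℝ ∞ σ (l (F (c p))) := hlF.to_localInverse hlF' (by simp)
  have hσl : ∀ᶠ w in 𝓝 (c p), σ (l (F w)) = w :=
    (hlF.hasStrictFDerivAt' hlF' (by simp)).eventually_left_inverse
  have hFp : F (c p) = cX (i p) := by
    simp only [F, Function.comp_apply, c, extChartAt_to_inv]
  have hcg : ∀ᶠ y in 𝓝 z, g y ∈ c.source :=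
    hg.eventually ((isOpen_extChartAt_source p).mem_nhds (mem_extChartAt_source p))
  have hcc : ContinuousAt (c ∘ g) z := (continuousAt_extChartAt p).comp hg
  have hloc : c ∘ g =ᶠ[𝓝 z] fun y => σ (l (cX (i (g y)))) := by
    have h1 : ∀ᶠ y in 𝓝 z, σ (l (F (c (g y)))) = c (g y) :=
      hcc.eventually (p := fun w => σ (l (F w)) = w) hσl
    filter_upwards [h1, hcg] with y hy hyc
    rw [Function.comp_apply, ← hy]
    simp only [F, Function.comp_apply, c.left_inv hyc]
  have hcXf : ContMDiffAt J₂ 𝓘(ℝ, E₁) ∞ (fun y => cX (i (g y))) z :=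
    ContMDiffAt.comp (g := cX) z contMDiffAt_extChartAt hig
  rw [contMDiffAt_iff_target]
  refine ⟨hg, ContMDiffAt.congr_of_eventuallyEq ?_ hloc⟩
  refine ContMDiffAt.comp (g := σ) z ?_ (l.contDiff.contMDiff.contMDiffAt.comp z hcXf)
  rw [← hp, ← hFp]
  exact hσ.contMDiffAt

/-- The tangent spaces of an embedded submanifold contain the derivatives of all smooth maps whose
values lie in the submanifold. -/
theorem ImmersedSubmanifold.IsEmbedded.exists_mfderiv_eq {S : Set X} {Y : ImmersedSubmanifold J₁ S}
    (hY : Y.IsEmbedded) {m : ℕ} {f : Euc m → X} {z : Euc m} (hf : ContMDiffAt (𝓡 m) J₁ ∞ f z)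
    (hS : ∀ᶠ y in 𝓝 z, f y ∈ S) :
    ∃ (p : Y.carrier) (A : Euc m →L[ℝ] Euc Y.dim), Y.incl p = f z ∧
      ∀ a, (mfderiv (𝓡 Y.dim) J₁ Y.incl p (A a) : E₁) = mfderiv (𝓡 m) J₁ f z a := by
  classical
  have hmem : ∀ x ∈ S, ∃ q, Y.incl q = x := fun x hx => by
    rwa [← Y.range_incl] at hx
  obtain ⟨p, hp⟩ := hmem _ hS.self_of_nhds
  let g : Euc m → Y.carrier := fun y => if h : ∃ q, Y.incl q = f y then h.choose else p
  have hg : ∀ y, f y ∈ S → Y.incl (g y) = f y := by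
    intro y hy
    have h := hmem _ hy
    simp only [g, dif_pos h]
    exact h.choose_spec
  have hgf : Y.incl ∘ g =ᶠ[𝓝 z] f := hS.mono hg
  have hgc : ContinuousAt g z :=
    hY.isInducing.continuousAt_iff.2 (hf.continuousAt.congr hgf.symm)
  have hgsm : ContMDiffAt (𝓡 m) (𝓡 Y.dim) ∞ g z :=
    contMDiffAt_of_comp_immersion (Y.contMDiff_incl _) (Y.injective_mfderiv _) hgc
      (hf.congr_of_eventuallyEq hgf)
  refine ⟨g z, mfderiv (𝓡 m) (𝓡 Y.dim) g z, hg z hS.self_of_nhds, fun a => ?_⟩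
  have hd := mfderiv_comp z ((Y.contMDiff_incl (g z)).mdifferentiableAt (by simp))
    (hgsm.mdifferentiableAt (by simp))
  rw [hgf.mfderiv_eq] at hd
  rw [hd]
  rfl

end Embedded

/-! ### Reductions -/

section Reduction

variable {E₁ : Type*} [NormedAddCommGroup E₁] [NormedSpace ℝ E₁] {H₁ : Type*} [TopologicalSpace H₁]
  {J₁ : ModelWithCorners ℝ E₁ H₁} {X : Type u} [TopologicalSpace X] [ChartedSpace H₁ X]
  {E₂ : Type*} [NormedAddCommGroup E₂] [NormedSpace ℝ E₂] {H₂ : Type*} [TopologicalSpace H₂]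
  {J₂ : ModelWithCorners ℝ E₂ H₂} {Q : Type*} [TopologicalSpace Q] [ChartedSpace H₂ Q]
  {E₃ : Type*} [NormedAddCommGroup E₃] [NormedSpace ℝ E₃] {H₃ : Type*} [TopologicalSpace H₃]
  {J₃ : ModelWithCorners ℝ E₃ H₃} {R : Type*} [TopologicalSpace R] [ChartedSpace H₃ R]
  {E₄ : Type*} [NormedAddCommGroup E₄] [NormedSpace ℝ E₄] {H₄ : Type*} [TopologicalSpace H₄]
  {J₄ : ModelWithCorners ℝ E₄ H₄} {S : Type*} [TopologicalSpace S] [ChartedSpace H₄ S]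

/-- `π : C → Q` is locally trivial with fibres of dimension `d` and `π^* η = Ω|_C`. This describes
coisotropic reductions of `X` (when `dim X = dim Q + 2 d`) as well as, over the one-point manifold,
isotropic and Lagrangian submanifolds of `X`. -/
structure IsReduction (Ω : BilinField J₁ X) (η : BilinField J₂ Q) (C : Set X) (π : X → Q)
    (d : ℕ) : Prop where
  isLocTriv : IsLocTriv J₁ J₂ C π d
  pullsBack : PullsBack Ω η C π

/-- The reduction of an isotropic subset to the one-point manifold. -/
abbrev IsIsotropicParam (Ω : BilinField J₁ X) (C : Set X) (d : ℕ) : Prop :=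
  IsReduction Ω (0 : BilinField (𝓡 0) (Euc 0)) C (fun _ => (0 : Euc 0)) d

namespace IsReduction

variable {Ω : BilinField J₁ X} {η : BilinField J₂ Q} {θ : BilinField J₃ R} {ζ : BilinField J₄ S}
  {C : Set X} {π : X → Q} {d d' : ℕ}

theorem comp (h : IsReduction Ω η C π d) {D : Set Q} {ρ : Q → R} (h' : IsReduction η θ D ρ d') :
    IsReduction Ω θ (C ∩ π ⁻¹' D) (ρ ∘ π) (d' + d) :=
  ⟨h.isLocTriv.comp h'.isLocTriv, h.pullsBack.comp h'.pullsBack h.isLocTriv.smooth⟩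

theorem prod (h : IsReduction Ω η C π d) {D : Set R} {ρ : R → S} (h' : IsReduction θ ζ D ρ d') :
    IsReduction (prodForm Ω θ) (prodForm η ζ) (C ×ˢ D) (Prod.map π ρ) (d + d') :=
  ⟨h.isLocTriv.prod h'.isLocTriv,
    h.pullsBack.prod h'.pullsBack h.isLocTriv.smooth h'.isLocTriv.smooth⟩

theorem neg (h : IsReduction Ω η C π d) : IsReduction (-Ω) (-η) C π d :=
  ⟨h.isLocTriv, h.pullsBack.neg⟩

protected theorem id : IsReduction Ω Ω (univ : Set X) id 0 :=
  ⟨IsLocTriv.id, PullsBack.id⟩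

theorem transport (h : IsReduction Ω η C π d) {D : Set R} {ρ : R → Q} {i : X → R} {j : R → X}
    (hi : ContMDiffOn J₁ J₃ ∞ i C) (hj : ContMDiffOn J₃ J₁ ∞ j D) (hiD : MapsTo i C D)
    (hjC : MapsTo j D C) (hji : ∀ c ∈ C, j (i c) = c) (hij : ∀ c ∈ D, i (j c) = c)
    (hρ : ∀ c ∈ D, ρ c = π (j c)) (hθ : PullsBack θ Ω D j) : IsReduction θ η D ρ d := by
  refine ⟨h.isLocTriv.transport hi hj hiD hjC hji hij hρ, ?_⟩
  exact ((hθ.comp h.pullsBack hj).mono fun c hc => ⟨hc, hjC hc⟩).congr hρ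

/-- The preimage of a Lagrangian submanifold under a coisotropic reduction is Lagrangian. The
dimension of an empty manifold is arbitrary, hence the restriction to nonempty `X`. -/
theorem isImmersedLagrangian_preimage [FiniteDimensional ℝ E₁] [T2Space X]
    [SecondCountableTopology X] (h : IsReduction Ω η C π d) (hΩ : IsAlmostSymplectic Ω)
    {D : Set Q} (hD : IsIsotropicParam η D d')
    (hdim : Nonempty X → Module.finrank ℝ E₁ = 2 * (d' + d)) :
    IsImmersedLagrangian Ω (C ∩ π ⁻¹' D) := by
  have h' := h.comp hD
  exact IsLocParam.isImmersedLagrangian h'.isLocTriv hΩ h'.pullsBack hdim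

end IsReduction

end Reduction

/-! ### Algebra of composable strings -/

section Algebra

variable {E : Type*} [NormedAddCommGroup E] [NormedSpace ℝ E]
  {B : Type*} [NormedAddCommGroup B] [NormedSpace ℝ B]
  {G : Type*} {M : Type*} [TopologicalSpace G] [ChartedSpace E G]
  [TopologicalSpace M] [ChartedSpace B M]

namespace LieGroupoid

variable (𝓖 : LieGroupoid E B G M)

/-- The composable pairs. -/
def pairs : Set (G × G) := {p | 𝓖.tgt p.1 = 𝓖.src p.2}

/-- The graph of the triple product `(g, h, k) ↦ g h k`. -/
def tripleGraph : Set (((G × G) × G) × G) :=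
  {p | (𝓖.tgt p.1.1.1 = 𝓖.src p.1.1.2 ∧ 𝓖.tgt p.1.1.2 = 𝓖.src p.1.2) ∧
    p.2 = 𝓖.mul (𝓖.mul p.1.1.1 p.1.1.2) p.1.2}

theorem contMDiffOn_mul : ContMDiffOn (𝓘(ℝ, E).prod 𝓘(ℝ, E)) 𝓘(ℝ, E) ∞
    (fun p : G × G => 𝓖.mul p.1 p.2) 𝓖.pairs := 𝓖.smooth_mul

variable {𝓖} in
theorem contMDiffAt_mul {E' : Type*} [NormedAddCommGroup E'] [NormedSpace ℝ E'] {H' : Type*}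
    [TopologicalSpace H'] {J' : ModelWithCorners ℝ E' H'} {N : Type*} [TopologicalSpace N]
    [ChartedSpace H' N] {f g : N → G} {z : N} (hf : ContMDiffAt J' 𝓘(ℝ, E) ∞ f z)
    (hg : ContMDiffAt J' 𝓘(ℝ, E) ∞ g z) (h : ∀ᶠ y in 𝓝 z, 𝓖.tgt (f y) = 𝓖.src (g y)) :
    ContMDiffAt J' 𝓘(ℝ, E) ∞ (fun y => 𝓖.mul (f y) (g y)) z :=
  contMDiffAt_comp_of_eventually 𝓖.contMDiffOn_mul (hf.prodMk hg) h

theorem inv_mul_cancel_left {g h : G} (hgh : 𝓖.tgt g = 𝓖.src h) :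
    𝓖.mul (𝓖.inv g) (𝓖.mul g h) = h := by
  rw [← 𝓖.mul_assoc _ _ _ (𝓖.tgt_inv g) hgh, 𝓖.inv_mul, hgh, 𝓖.unit_mul]

theorem mul_inv_cancel_left {g h : G} (hgh : 𝓖.src g = 𝓖.src h) :
    𝓖.mul g (𝓖.mul (𝓖.inv g) h) = h := by
  rw [← 𝓖.mul_assoc _ _ _ (𝓖.src_inv g).symm (by rw [𝓖.tgt_inv, hgh]), 𝓖.mul_inv, hgh, 𝓖.unit_mul]

theorem mul_inv_cancel_right {g h : G} (hgh : 𝓖.tgt g = 𝓖.src h) :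
    𝓖.mul (𝓖.mul g h) (𝓖.inv h) = g := by
  rw [𝓖.mul_assoc _ _ _ hgh (𝓖.src_inv h).symm, 𝓖.mul_inv, ← hgh, 𝓖.mul_unit]

theorem eq_inv_of_mul_eq_unit {g h : G} (hgh : 𝓖.tgt g = 𝓖.src h)
    (hu : 𝓖.mul g h = 𝓖.unit (𝓖.src g)) : h = 𝓖.inv g := by
  rw [← 𝓖.inv_mul_cancel_left hgh, hu, ← 𝓖.tgt_inv, 𝓖.mul_unit]

theorem inv_inv (g : G) : 𝓖.inv (𝓖.inv g) = g :=
  (𝓖.eq_inv_of_mul_eq_unit (𝓖.tgt_inv g) (by rw [𝓖.inv_mul, 𝓖.src_inv])).symm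

theorem mul_inv_rev {g h : G} (hgh : 𝓖.tgt g = 𝓖.src h) :
    𝓖.inv (𝓖.mul g h) = 𝓖.mul (𝓖.inv h) (𝓖.inv g) := by
  have h1 : 𝓖.tgt (𝓖.inv h) = 𝓖.src (𝓖.inv g) := by rw [𝓖.tgt_inv, 𝓖.src_inv, hgh]
  refine (𝓖.eq_inv_of_mul_eq_unit ?_ ?_).symm
  · rw [𝓖.tgt_mul _ _ hgh, 𝓖.src_mul _ _ h1, 𝓖.src_inv]
  · rw [← 𝓖.mul_assoc _ _ _ (by rw [𝓖.tgt_mul _ _ hgh, 𝓖.src_inv]) h1,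
      𝓖.mul_inv_cancel_right hgh, 𝓖.mul_inv, 𝓖.src_mul _ _ hgh]

theorem mem_composable_succ {n : ℕ} {α : Fin (n + 2) → G} :
    α ∈ 𝓖.composable (n + 2) ↔
      𝓖.tgt (α 0) = 𝓖.src (α 1) ∧ Fin.tail α ∈ 𝓖.composable (n + 1) := by
  constructor
  · intro h
    refine ⟨h 0 1 (by simp), fun k l hkl => h k.succ l.succ (by simpa using hkl)⟩
  · rintro ⟨h0, h⟩ k l hkl
    obtain ⟨l', rfl⟩ := Fin.exists_succ_eq.2 (show l ≠ 0 by rintro rfl; simp at hkl)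
    induction k using Fin.cases with
    | zero =>
      have : l' = 0 := Fin.ext (by simpa using hkl.symm)
      subst this
      exact h0
    | succ k' => exact h k' l' (by simpa using hkl)

theorem src_strProd {n : ℕ} {α : Fin (n + 1) → G} (h : α ∈ 𝓖.composable (n + 1)) :
    𝓖.src (𝓖.strProd n α) = 𝓖.src (α 0) := by
  induction n with
  | zero => rfl
  | succ n ih =>
    have h' := 𝓖.mem_composable_succ.1 h
    refine 𝓖.src_mul _ _ ?_
    rw [ih h'.2]
    exact h'.1

theorem mem_composable_succ_iff_strProd {n : ℕ} {α : Fin (n + 2) → G} :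
    α ∈ 𝓖.composable (n + 2) ↔ Fin.tail α ∈ 𝓖.composable (n + 1) ∧
      𝓖.tgt (α 0) = 𝓖.src (𝓖.strProd n (Fin.tail α)) := by
  rw [mem_composable_succ, and_comm]
  exact and_congr_right fun h => by rw [𝓖.src_strProd h]; rfl

theorem tgt_strProd {n : ℕ} {α : Fin (n + 1) → G} (h : α ∈ 𝓖.composable (n + 1)) :
    𝓖.tgt (𝓖.strProd n α) = 𝓖.tgt (α (Fin.last n)) := by
  induction n with
  | zero => rfl
  | succ n ih =>
    have h' := 𝓖.mem_composable_succ_iff_strProd.1 h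
    exact (𝓖.tgt_mul _ _ h'.2).trans (ih h'.1)

/-- Strings may be multiplied from the left as well as from the right. -/
theorem strProd_snoc {n : ℕ} {α : Fin (n + 2) → G} (h : α ∈ 𝓖.composable (n + 2)) :
    𝓖.strProd (n + 1) α =
      𝓖.mul (𝓖.strProd n (Fin.init α)) (α (Fin.last (n + 1))) := by
  induction n with
  | zero => rfl
  | succ n ih =>
    have h' := 𝓖.mem_composable_succ.1 h
    have hinit : Fin.init (Fin.tail α) ∈ 𝓖.composable (n + 1) :=
      fun k l hkl => h'.2 k.castSucc l.castSucc hkl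
    have h1 : 𝓖.tgt (𝓖.strProd n (Fin.init (Fin.tail α))) = 𝓖.src (α (Fin.last (n + 2))) := by
      rw [𝓖.tgt_strProd hinit]
      exact h'.2 (Fin.last n).castSucc (Fin.last (n + 1)) rfl
    have h2 : 𝓖.tgt (α 0) = 𝓖.src (𝓖.strProd n (Fin.init (Fin.tail α))) := by
      rw [𝓖.src_strProd hinit]
      exact h'.1
    exact (congrArg (𝓖.mul (α 0)) (ih h'.2)).trans (𝓖.mul_assoc _ _ _ h2 h1).symm

theorem powInv_mem_composable {n : ℕ} {α : Fin (n + 1) → G} (h : α ∈ 𝓖.composable (n + 1)) :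
    𝓖.powInv n α ∈ 𝓖.composable (n + 1) := by
  intro k l hkl
  rw [powInv, powInv, 𝓖.tgt_inv, 𝓖.src_inv]
  exact (h _ _ (by simp only [Fin.val_rev]; omega)).symm

theorem powInv_powInv {n : ℕ} (α : Fin (n + 1) → G) : 𝓖.powInv n (𝓖.powInv n α) = α := by
  funext k
  simp only [powInv, Fin.rev_rev, 𝓖.inv_inv]

theorem powInv_mem_composable_iff {n : ℕ} {α : Fin (n + 1) → G} :
    𝓖.powInv n α ∈ 𝓖.composable (n + 1) ↔ α ∈ 𝓖.composable (n + 1) :=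
  ⟨fun h => 𝓖.powInv_powInv α ▸ 𝓖.powInv_mem_composable h, 𝓖.powInv_mem_composable⟩

theorem strProd_powInv {n : ℕ} {α : Fin (n + 1) → G} (h : α ∈ 𝓖.composable (n + 1)) :
    𝓖.strProd n (𝓖.powInv n α) = 𝓖.inv (𝓖.strProd n α) := by
  induction n with
  | zero => rfl
  | succ n ih =>
    have h' := 𝓖.mem_composable_succ_iff_strProd.1 h
    have hinit : Fin.init (𝓖.powInv (n + 1) α) = 𝓖.powInv n (Fin.tail α) := by
      funext k
      simp only [Fin.init, powInv, Fin.tail, Fin.rev_castSucc]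
    have hlast : 𝓖.powInv (n + 1) α (Fin.last (n + 1)) = 𝓖.inv (α 0) := by
      simp only [powInv, Fin.rev_last]
    rw [𝓖.strProd_snoc (𝓖.powInv_mem_composable h), hinit, hlast, ih h'.1]
    exact (𝓖.mul_inv_rev h'.2).symm

/-- The composable string `(g, 1, …, 1)` with product `g`. -/
def unitString (n : ℕ) (g : G) : Fin (n + 1) → G :=
  Fin.cons g fun _ => 𝓖.unit (𝓖.tgt g)

theorem unitString_mem (n : ℕ) (g : G) : 𝓖.unitString n g ∈ 𝓖.composable (n + 1) := by
  intro k l hkl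
  obtain ⟨l', rfl⟩ := Fin.exists_succ_eq.2 (show l ≠ 0 by rintro rfl; simp at hkl)
  have h2 : 𝓖.src (𝓖.unitString n g l'.succ) = 𝓖.tgt g := 𝓖.src_unit _
  rw [h2]
  induction k using Fin.cases with
  | zero => rfl
  | succ k' => exact 𝓖.tgt_unit _

theorem strProd_unitString (n : ℕ) (g : G) : 𝓖.strProd n (𝓖.unitString n g) = g := by
  induction n generalizing g with
  | zero => rfl
  | succ n ih =>
    have htail : Fin.tail (𝓖.unitString (n + 1) g) = 𝓖.unitString n (𝓖.unit (𝓖.tgt g)) := by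
      funext k
      induction k using Fin.cases with
      | zero => rfl
      | succ k' => exact congrArg 𝓖.unit (𝓖.tgt_unit _).symm
    change 𝓖.mul g (𝓖.strProd n (Fin.tail (𝓖.unitString (n + 1) g))) = g
    rw [htail, ih, 𝓖.mul_unit]

theorem exists_strProd_eq (n : ℕ) (g : G) : ∃ α ∈ 𝓖.composable (n + 1), 𝓖.strProd n α = g :=
  ⟨_, 𝓖.unitString_mem n g, 𝓖.strProd_unitString n g⟩

end LieGroupoid

end Algebra

/-! ### Pullbacks along parametrizations, and multiplicativity of the symplectic form -/

section PullForm

variable {E₁ : Type*} [NormedAddCommGroup E₁] [NormedSpace ℝ E₁] {H₁ : Type*} [TopologicalSpace H₁]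
  {J₁ : ModelWithCorners ℝ E₁ H₁} {X : Type*} [TopologicalSpace X] [ChartedSpace H₁ X]
  {E₂ : Type*} [NormedAddCommGroup E₂] [NormedSpace ℝ E₂] {H₂ : Type*} [TopologicalSpace H₂]
  {J₂ : ModelWithCorners ℝ E₂ H₂} {Q : Type*} [TopologicalSpace Q] [ChartedSpace H₂ Q]
  {m : ℕ} {Ω : BilinField J₁ X} {η : BilinField J₂ Q}

/-- The value at `z` of the form `f^* Ω` on the vectors `a` and `b`. -/
def pullForm (Ω : BilinField J₁ X) (f : Euc m → X) (z a b : Euc m) : ℝ :=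
  Ω (f z) (mfderiv (𝓡 m) J₁ f z a) (mfderiv (𝓡 m) J₁ f z b)

theorem PullsBack.pullForm_eq {C : Set X} {π : X → Q} (h : PullsBack Ω η C π) {f : Euc m → X}
    {z : Euc m} (hf : ContMDiffAt (𝓡 m) J₁ ∞ f z) (hC : ∀ᶠ y in 𝓝 z, f y ∈ C) (a b : Euc m) :
    pullForm η (π ∘ f) z a b = pullForm Ω f z a b :=
  h m f z hf hC a b

theorem pullForm_congr {f g : Euc m → X} {z : Euc m} (h : f =ᶠ[𝓝 z] g) (a b : Euc m) :
    pullForm Ω f z a b = pullForm Ω g z a b := by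
  unfold pullForm
  rw [h.mfderiv_eq, h.eq_of_nhds]

theorem pullForm_neg (f : Euc m → X) (z a b : Euc m) :
    pullForm (-Ω) f z a b = -pullForm Ω f z a b := rfl

theorem pullForm_prodForm {f : Euc m → X × Q} {z : Euc m}
    (hf : ContMDiffAt (𝓡 m) (J₁.prod J₂) ∞ f z) (a b : Euc m) :
    pullForm (prodForm Ω η) f z a b =
      pullForm Ω (fun y => (f y).1) z a b + pullForm η (fun y => (f y).2) z a b := by
  have e1 : mfderiv (𝓡 m) (J₁.prod J₂) f z = _ :=
    ((hf.fst.mdifferentiableAt (by simp)).hasMFDerivAt.prodMk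
      (hf.snd.mdifferentiableAt (by simp)).hasMFDerivAt).mfderiv
  unfold pullForm
  rw [e1]
  rfl

theorem pullForm_powForm {n : ℕ} {f : Euc m → Fin n → X} {z : Euc m}
    (hf : ContMDiffAt (𝓡 m) (powModel J₁ n) ∞ f z) (a b : Euc m) :
    pullForm (powForm Ω n) f z a b = ∑ k, pullForm Ω (fun y => f y k) z a b := by
  have h := fun k => (contMDiffAt_pow.1 hf k).mdifferentiableAt (n := ∞) (by simp)
  refine (powForm_apply Ω (f z) _ _).trans (Finset.sum_congr rfl fun k _ => ?_)
  rw [mfderiv_pow h a k, mfderiv_pow h b k]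
  rfl

/-- A set is isotropic if the form pulls back to zero along all maps into the set. -/
theorem pullsBack_zero {C : Set X} (q₀ : Q) (h : ∀ (m : ℕ) (f : Euc m → X) (z : Euc m),
    ContMDiffAt (𝓡 m) J₁ ∞ f z → (∀ᶠ y in 𝓝 z, f y ∈ C) → ∀ a b, pullForm Ω f z a b = 0) :
    PullsBack Ω (0 : BilinField J₂ Q) C fun _ => q₀ :=
  fun m f z hf hC a b => (h m f z hf hC a b).symm

end PullForm

section Dimension

variable {E₁ : Type*} [NormedAddCommGroup E₁] [NormedSpace ℝ E₁] [FiniteDimensional ℝ E₁]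
  {H₁ : Type*} [TopologicalSpace H₁] {J₁ : ModelWithCorners ℝ E₁ H₁} {X : Type u}
  [TopologicalSpace X] [ChartedSpace H₁ X]

/-- An embedded submanifold structure has the largest dimension among all submanifold structures on
the same subset. -/
theorem ImmersedSubmanifold.IsEmbedded.dim_le {S : Set X} {Y Z : ImmersedSubmanifold J₁ S}
    (hY : Y.IsEmbedded) (p : Z.carrier) : Z.dim ≤ Y.dim := by
  have hmem : ∀ q : Z.carrier, ∃ q' : Y.carrier, Y.incl q' = Z.incl q := fun q => by
    have h1 : Z.incl q ∈ S := Z.range_incl.subset (mem_range_self q)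
    exact Y.range_incl.superset h1
  choose g hg using hmem
  have hfun : Y.incl ∘ g = Z.incl := funext hg
  have hcont : ContinuousAt g p :=
    hY.isInducing.continuousAt_iff.2 (hfun ▸ (Z.contMDiff_incl p).continuousAt)
  have hsm : ContMDiffAt (𝓡 Z.dim) (𝓡 Y.dim) ∞ g p :=
    contMDiffAt_of_comp_immersion (Y.contMDiff_incl _) (Y.injective_mfderiv _) hcont
      (hfun ▸ Z.contMDiff_incl p)
  have hd := mfderiv_comp p ((Y.contMDiff_incl (g p)).mdifferentiableAt (by simp))
    (hsm.mdifferentiableAt (by simp))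
  rw [hfun] at hd
  have hinj : Function.Injective (mfderiv (𝓡 Z.dim) (𝓡 Y.dim) g p) := by
    intro a b hab
    refine Z.injective_mfderiv p ?_
    rw [hd]
    exact congrArg (mfderiv (𝓡 Y.dim) J₁ Y.incl (g p)) hab
  let A : Euc Z.dim →L[ℝ] Euc Y.dim := mfderiv (𝓡 Z.dim) (𝓡 Y.dim) g p
  have := LinearMap.finrank_le_finrank_of_injective (f := A.toLinearMap) hinj
  simpa using this

end Dimension

section Multiplicative

variable {E : Type*} [NormedAddCommGroup E] [NormedSpace ℝ E] [FiniteDimensional ℝ E]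
  {B : Type*} [NormedAddCommGroup B] [NormedSpace ℝ B]
  {G : Type u} {M : Type*} [TopologicalSpace G] [ChartedSpace E G]
  [TopologicalSpace M] [ChartedSpace B M]
  {𝓖 : LieGroupoid E B G M} {Ω : BilinField 𝓘(ℝ, E) G}

namespace LieGroupoid

namespace IsSymplectic

/-- The form of a symplectic groupoid is multiplicative, because the graph of the product is
isotropic. -/
theorem pullsBack_mul (hΩ : 𝓖.IsSymplectic Ω) :
    PullsBack (prodForm Ω Ω) Ω 𝓖.pairs fun p => 𝓖.mul p.1 p.2 := by
  intro m f z hf hC a b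
  obtain ⟨Y, hemb, hlag⟩ := hΩ.lagrangian
  have hmul := contMDiffAt_comp_of_eventually 𝓖.contMDiffOn_mul hf hC
  have hF : ContMDiffAt (𝓡 m) ((𝓘(ℝ, E).prod 𝓘(ℝ, E)).prod 𝓘(ℝ, E)) ∞
      (fun y => (f y, 𝓖.mul (f y).1 (f y).2)) z := hf.prodMk hmul
  obtain ⟨p, A, hp, hA⟩ := hemb.exists_mfderiv_eq hF (hC.mono fun y hy => ⟨hy, rfl⟩)
  have h0 := (hlag p (mfderiv (𝓡 Y.dim) _ Y.incl p (A a))).1 ⟨_, rfl⟩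
    (mfderiv (𝓡 Y.dim) _ Y.incl p (A b)) ⟨_, rfl⟩
  have h1 : pullForm (prodForm (prodForm Ω Ω) (-Ω)) (fun y => (f y, 𝓖.mul (f y).1 (f y).2))
      z a b = 0 := by
    unfold pullForm
    rw [← h0]
    have e : ∀ (x y : (G × G) × G) (v w v' w' : (E × E) × E), x = y → v = v' → w = w' →
        prodForm (prodForm Ω Ω) (-Ω) x v w = prodForm (prodForm Ω Ω) (-Ω) y v' w' := by
      rintro x _ v w _ _ rfl rfl rfl
      rfl
    exact e _ _ _ _ _ _ hp.symm (hA a).symm (hA b).symm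
  rw [pullForm_prodForm hF, pullForm_neg, add_neg_eq_zero] at h1
  exact h1.symm

theorem pullForm_mul (hΩ : 𝓖.IsSymplectic Ω) {m : ℕ} {f g : Euc m → G} {z : Euc m}
    (hf : ContMDiffAt (𝓡 m) 𝓘(ℝ, E) ∞ f z) (hg : ContMDiffAt (𝓡 m) 𝓘(ℝ, E) ∞ g z)
    (h : ∀ᶠ y in 𝓝 z, 𝓖.tgt (f y) = 𝓖.src (g y)) (a b : Euc m) :
    pullForm Ω (fun y => 𝓖.mul (f y) (g y)) z a b = pullForm Ω f z a b + pullForm Ω g z a b := by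
  have h1 := hΩ.pullsBack_mul.pullForm_eq (hf.prodMk hg) h a b
  rw [pullForm_prodForm (hf.prodMk hg)] at h1
  exact h1

/-- The units are isotropic, because `1 = 1 · 1`. -/
theorem pullForm_unit (hΩ : 𝓖.IsSymplectic Ω) {m : ℕ} {f : Euc m → G} {z : Euc m}
    (hf : ContMDiffAt (𝓡 m) 𝓘(ℝ, E) ∞ f z) (h : ∀ᶠ y in 𝓝 z, f y ∈ range 𝓖.unit)
    (a b : Euc m) : pullForm Ω f z a b = 0 := by
  have h1 : ∀ᶠ y in 𝓝 z, 𝓖.tgt (f y) = 𝓖.src (f y) := by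
    filter_upwards [h] with y hy
    obtain ⟨x, hx⟩ := hy
    rw [← hx, 𝓖.tgt_unit, 𝓖.src_unit]
  have h2 : (fun y => 𝓖.mul (f y) (f y)) =ᶠ[𝓝 z] f := by
    filter_upwards [h] with y hy
    obtain ⟨x, hx⟩ := hy
    have := 𝓖.unit_mul (𝓖.unit x)
    rwa [𝓖.src_unit, hx] at this
  have h3 := hΩ.pullForm_mul hf hf h1 a b
  rw [pullForm_congr h2] at h3
  linarith

/-- The inversion is antisymplectic, because `g g⁻¹` is a unit. -/
theorem pullForm_inv (hΩ : 𝓖.IsSymplectic Ω) {m : ℕ} {f : Euc m → G} {z : Euc m}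
    (hf : ContMDiffAt (𝓡 m) 𝓘(ℝ, E) ∞ f z) (a b : Euc m) :
    pullForm Ω (fun y => 𝓖.inv (f y)) z a b = -pullForm Ω f z a b := by
  have hi : ContMDiffAt (𝓡 m) 𝓘(ℝ, E) ∞ (fun y => 𝓖.inv (f y)) z := (𝓖.smooth_inv _).comp z hf
  have h1 : ∀ᶠ y in 𝓝 z, 𝓖.tgt (f y) = 𝓖.src (𝓖.inv (f y)) :=
    Filter.Eventually.of_forall fun y => (𝓖.src_inv _).symm
  have h2 := hΩ.pullForm_mul hf hi h1 a b
  rw [hΩ.pullForm_unit (contMDiffAt_mul hf hi h1)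
    (Filter.Eventually.of_forall fun y => ⟨_, (𝓖.mul_inv _).symm⟩)] at h2
  linarith

end IsSymplectic

end LieGroupoid

end Multiplicative

/-! ### The product as a locally trivial map -/

section Groupoid

variable {E : Type*} [NormedAddCommGroup E] [NormedSpace ℝ E] [FiniteDimensional ℝ E]
  {B : Type*} [NormedAddCommGroup B] [NormedSpace ℝ B]
  {G : Type u} {M : Type*} [TopologicalSpace G] [ChartedSpace E G] [IsManifold 𝓘(ℝ, E) ∞ G]
  [TopologicalSpace M] [ChartedSpace B M] [IsManifold 𝓘(ℝ, B) ∞ M]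

namespace LieGroupoid

/-- The dimension of the source fibres. (Truncation matters only if `G` is empty.) -/
def fibreDim (_ : LieGroupoid E B G M) : ℕ := Module.finrank ℝ E - Module.finrank ℝ B

variable (𝓖 : LieGroupoid E B G M)

theorem isLocTriv_src : IsLocTriv 𝓘(ℝ, E) 𝓘(ℝ, B) univ 𝓖.src 𝓖.fibreDim :=
  isLocTriv_of_submersion 𝓖.smooth_src 𝓖.submersion_src

/-- The product is locally trivial: a composable pair `(g, h)` is determined by `g h` and by the
position of `g` in its source fibre. -/
theorem isLocTriv_mul : IsLocTriv (𝓘(ℝ, E).prod 𝓘(ℝ, E)) 𝓘(ℝ, E) 𝓖.pairs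
    (fun p => 𝓖.mul p.1 p.2) 𝓖.fibreDim := by
  refine ⟨𝓖.contMDiffOn_mul, fun p hp => ?_⟩
  obtain ⟨T, hT⟩ := 𝓖.isLocTriv_src.exists_triv p.1 trivial
  have hcont : Continuous fun v : G × Euc 𝓖.fibreDim => (𝓖.src v.1, v.2) :=
    (𝓖.smooth_src.continuous.comp continuous_fst).prodMk continuous_snd
  have hΦ : ContMDiffOn (𝓘(ℝ, E).prod (𝓡 𝓖.fibreDim)) 𝓘(ℝ, E) ∞
      (fun v : G × Euc 𝓖.fibreDim => T.ψ (𝓖.src v.1, v.2))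
      {v : G × Euc 𝓖.fibreDim | (𝓖.src v.1, v.2) ∈ T.V} :=
    T.smooth_ψ.comp ((𝓖.smooth_src.comp contMDiff_fst).prodMk contMDiff_snd).contMDiffOn
      fun v hv => hv
  have hsrc : ∀ v : G × Euc 𝓖.fibreDim, (𝓖.src v.1, v.2) ∈ T.V →
      𝓖.src (T.ψ (𝓖.src v.1, v.2)) = 𝓖.src v.1 := fun v hv => T.π_ψ _ hv
  have hpair : ∀ v : G × Euc 𝓖.fibreDim, (𝓖.src v.1, v.2) ∈ T.V →
      𝓖.tgt (𝓖.inv (T.ψ (𝓖.src v.1, v.2))) = 𝓖.src v.1 := fun v hv => by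
    rw [𝓖.tgt_inv, hsrc v hv]
  refine ⟨{
    U := T.U ×ˢ univ
    V := {v : G × Euc 𝓖.fibreDim | (𝓖.src v.1, v.2) ∈ T.V}
    ψ := fun v => (T.ψ (𝓖.src v.1, v.2), 𝓖.mul (𝓖.inv (T.ψ (𝓖.src v.1, v.2))) v.1)
    κ := fun p => T.κ p.1
    isOpen_U := T.isOpen_U.prod isOpen_univ
    isOpen_V := T.isOpen_V.preimage hcont
    smooth_ψ := hΦ.prodMk (𝓖.contMDiffOn_mul.comp
      ((𝓖.smooth_inv.comp_contMDiffOn hΦ).prodMk contMDiffOn_fst) fun v hv => hpair v hv)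
    smooth_κ := T.smooth_κ.comp contMDiff_fst.contMDiffOn fun c hc => ⟨trivial, hc.2.1⟩
    mapsTo_ψ := fun v hv => by
      refine ⟨?_, (T.mapsTo_ψ _ hv).2, trivial⟩
      change 𝓖.tgt _ = 𝓖.src _
      rw [𝓖.src_mul _ _ (hpair v hv), 𝓖.src_inv]
    π_ψ := fun v hv => 𝓖.mul_inv_cancel_left (hsrc v hv)
    κ_ψ := fun v hv => T.κ_ψ _ hv
    mem_V := fun c hc => by
      have := T.mem_V c.1 ⟨trivial, hc.2.1⟩
      rw [mem_ofPred_eq, 𝓖.src_mul _ _ hc.1]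
      exact this
    ψ_κ := fun c hc => by
      have := T.ψ_κ c.1 ⟨trivial, hc.2.1⟩
      dsimp only
      rw [𝓖.src_mul _ _ hc.1, this, 𝓖.inv_mul_cancel_left hc.1] }, hT, trivial⟩

theorem isLocParam_pairs :
    IsLocParam (𝓘(ℝ, E).prod 𝓘(ℝ, E)) 𝓖.pairs (Module.finrank ℝ E + 𝓖.fibreDim) :=
  𝓖.isLocTriv_mul.isLocParam

theorem isLocParam_mulGraph : IsLocParam ((𝓘(ℝ, E).prod 𝓘(ℝ, E)).prod 𝓘(ℝ, E)) 𝓖.mulGraph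
    (Module.finrank ℝ E + 𝓖.fibreDim) :=
  𝓖.isLocParam_pairs.transport (i := fun p => (p, 𝓖.mul p.1 p.2)) (j := Prod.fst)
    (contMDiffOn_id.prodMk 𝓖.contMDiffOn_mul) contMDiff_fst.contMDiffOn (fun _ hp => ⟨hp, rfl⟩)
    (fun _ hp => hp.1) (fun _ _ => rfl) (fun _ hp => Prod.ext rfl hp.2.symm) fun _ _ => rfl

variable {𝓖} {Ω : BilinField 𝓘(ℝ, E) G} [T2Space G] [SecondCountableTopology G]

/-- As a Lagrangian submanifold, the graph of the product has half the dimension of `G × G × G`; as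
a graph over the composable pairs, it has dimension `2 dim G - dim M`. -/
theorem IsSymplectic.finrank_eq (hΩ : 𝓖.IsSymplectic Ω) (hG : Nonempty G) :
    Module.finrank ℝ E = 2 * Module.finrank ℝ B := by
  obtain ⟨Y, hemb, hlag⟩ := hΩ.lagrangian
  let Z := 𝓖.isLocParam_mulGraph.submanifold
  obtain ⟨g⟩ := hG
  have hg : ((g, 𝓖.unit (𝓖.tgt g)), g) ∈ 𝓖.mulGraph :=
    ⟨(𝓖.src_unit _).symm, (𝓖.mul_unit g).symm⟩
  have hg' := hg
  rw [← Y.range_incl] at hg'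
  obtain ⟨p, -⟩ := hg'
  have h1 : Z.dim ≤ Y.dim := hemb.dim_le (⟨_, hg⟩ : 𝓖.mulGraph)
  have h2 : Y.dim ≤ Z.dim := 𝓖.isLocParam_mulGraph.submanifold_isEmbedded.dim_le p
  have hsym := hΩ.isSymplecticForm.isAlmostSymplectic
  have h3 := hlag.finrank_eq ((hsym.prodForm hsym).prodForm hsym.neg) p
  have h4 : Z.dim = Module.finrank ℝ E + 𝓖.fibreDim := rfl
  -- as the source map is a submersion, the subtraction in `fibreDim` is not truncated
  have h5 : Module.finrank ℝ B ≤ Module.finrank ℝ E :=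
    LinearMap.finrank_le_finrank_of_surjective
      (f := (mfderiv 𝓘(ℝ, E) 𝓘(ℝ, B) 𝓖.src g : E →L[ℝ] B).toLinearMap) (𝓖.submersion_src g)
  rw [Module.finrank_prod, Module.finrank_prod] at h3
  unfold fibreDim at h4
  omega

theorem IsSymplectic.fibreDim_eq (hΩ : 𝓖.IsSymplectic Ω) (hG : Nonempty G) :
    𝓖.fibreDim = Module.finrank ℝ B := by
  have := hΩ.finrank_eq hG
  unfold fibreDim
  omega

end LieGroupoid

end Groupoid

/-! ### Reductions of the groupoid and of its strings -/

section Units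

variable {E : Type*} [NormedAddCommGroup E] [NormedSpace ℝ E] [FiniteDimensional ℝ E]
  {B : Type*} [NormedAddCommGroup B] [NormedSpace ℝ B] [FiniteDimensional ℝ B]
  {G : Type u} {M : Type*} [TopologicalSpace G] [ChartedSpace E G]
  [TopologicalSpace M] [ChartedSpace B M] [IsManifold 𝓘(ℝ, B) ∞ M]
  {𝓖 : LieGroupoid E B G M} {Ω : BilinField 𝓘(ℝ, E) G}

namespace LieGroupoid

/-- The units form a Lagrangian submanifold. -/
theorem IsSymplectic.isIsotropicParam_unit (hΩ : 𝓖.IsSymplectic Ω) :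
    IsIsotropicParam Ω (range 𝓖.unit) (Module.finrank ℝ B) := by
  refine ⟨(IsLocTriv.toPoint (X := M)).transport (i := 𝓖.unit) (j := 𝓖.src)
    𝓖.smooth_unit.contMDiffOn 𝓖.smooth_src.contMDiffOn (fun x _ => ⟨x, rfl⟩)
    (fun _ _ => trivial) (fun x _ => 𝓖.src_unit x) ?_ (fun _ _ => rfl), pullsBack_zero 0 ?_⟩
  · rintro _ ⟨x, rfl⟩
    rw [𝓖.src_unit]
  · exact fun m f z hf hC a b => hΩ.pullForm_unit hf hC a b

end LieGroupoid

end Units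

section SymplecticGroupoid

variable {E : Type*} [NormedAddCommGroup E] [NormedSpace ℝ E] [FiniteDimensional ℝ E]
  {B : Type*} [NormedAddCommGroup B] [NormedSpace ℝ B]
  {G : Type u} {M : Type*} [TopologicalSpace G] [ChartedSpace E G] [IsManifold 𝓘(ℝ, E) ∞ G]
  [TopologicalSpace M] [ChartedSpace B M] [IsManifold 𝓘(ℝ, B) ∞ M]
  {𝓖 : LieGroupoid E B G M} {Ω : BilinField 𝓘(ℝ, E) G}

namespace LieGroupoid

namespace IsSymplectic

theorem isReduction_mul (hΩ : 𝓖.IsSymplectic Ω) :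
    IsReduction (prodForm Ω Ω) Ω 𝓖.pairs (fun p => 𝓖.mul p.1 p.2) 𝓖.fibreDim :=
  ⟨𝓖.isLocTriv_mul, hΩ.pullsBack_mul⟩

/-- The composable strings reduce to `G`. A string is split into its first entry and the
rest, so that the product of strings is the product of `G` after the product of shorter strings. -/
theorem isReduction_strProd (hΩ : 𝓖.IsSymplectic Ω) (n : ℕ) :
    IsReduction (powForm Ω (n + 1)) Ω (𝓖.composable (n + 1)) (𝓖.strProd n) (n * 𝓖.fibreDim) := by
  induction n with
  | zero =>
    rw [zero_mul]
    refine (IsReduction.id (Ω := Ω)).transport (i := fun g _ => g) (j := fun α => α 0)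
      (contMDiff_pow.2 fun _ => contMDiff_id).contMDiffOn (contMDiff_eval 0).contMDiffOn
      (fun g _ k l hkl => ?_) (fun _ _ => trivial) (fun _ _ => rfl) (fun α _ => ?_)
      (fun _ _ => rfl) ?_
    · omega
    · funext k
      exact congrArg α (Fin.ext (by simp only [Fin.val_zero]; omega))
    · intro m f z hf _ a b
      have := pullForm_powForm (Ω := Ω) hf a b
      rw [Fin.sum_univ_one] at this
      exact this.symm
  | succ n ih =>
    have h := ((IsReduction.id (Ω := Ω)).prod ih).comp hΩ.isReduction_mul
    have hd : 𝓖.fibreDim + (0 + n * 𝓖.fibreDim) = (n + 1) * 𝓖.fibreDim := by ring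
    rw [hd] at h
    refine h.transport (i := fun p => Fin.cons p.1 p.2) (j := fun α => (α 0, Fin.tail α))
      (contMDiff_pow.2 fun k => ?_).contMDiffOn
      ((contMDiff_eval 0).prodMk (contMDiff_pow.2 fun k => contMDiff_eval k.succ)).contMDiffOn
      ?_ ?_ (fun _ _ => rfl) (fun α _ => Fin.cons_self_tail α) (fun _ _ => rfl) ?_
    · induction k using Fin.cases with
      | zero => exact contMDiff_fst
      | succ k => exact (contMDiff_eval k).comp contMDiff_snd
    · rintro p ⟨hp, hp'⟩
      exact 𝓖.mem_composable_succ_iff_strProd.2 ⟨hp.2, hp'⟩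
    · intro α hα
      have hα' := 𝓖.mem_composable_succ_iff_strProd.1 hα
      exact ⟨⟨trivial, hα'.1⟩, hα'.2⟩
    · intro m f z hf _ a b
      have hf' := contMDiffAt_pow.1 hf
      have htail : ContMDiffAt (𝓡 m) (powModel 𝓘(ℝ, E) (n + 1)) ∞ (fun y => Fin.tail (f y)) z :=
        contMDiffAt_pow.2 fun k => hf' k.succ
      have h1 := pullForm_prodForm (Ω := Ω) (η := powForm Ω (n + 1)) ((hf' 0).prodMk htail) a b
      have h2 := pullForm_powForm (Ω := Ω) hf a b
      rw [Fin.sum_univ_succ] at h2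
      rw [pullForm_powForm htail] at h1
      exact h1.trans h2.symm

/-- The relation `{(g, h, k) | g h k is a unit}` is a Lagrangian submanifold. -/
theorem isIsotropicParam_rel (hΩ : 𝓖.IsSymplectic Ω) :
    IsIsotropicParam (prodForm (prodForm Ω Ω) Ω) 𝓖.rel (Module.finrank ℝ E + 𝓖.fibreDim) := by
  refine ⟨𝓖.isLocParam_pairs.transport (i := fun p => (p, 𝓖.inv (𝓖.mul p.1 p.2))) (j := Prod.fst)
    (contMDiffOn_id.prodMk (𝓖.smooth_inv.comp_contMDiffOn 𝓖.contMDiffOn_mul))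
    contMDiff_fst.contMDiffOn (fun _ hp => ⟨hp, rfl⟩) (fun _ hp => hp.1) (fun _ _ => rfl)
    (fun _ hp => Prod.ext rfl hp.2.symm) fun _ _ => rfl, pullsBack_zero 0 ?_⟩
  intro m f z hf hC a b
  have h0 : (fun y => (f y).2) =ᶠ[𝓝 z] fun y => 𝓖.inv (𝓖.mul (f y).1.1 (f y).1.2) :=
    hC.mono fun y hy => hy.2
  have h1 : ∀ᶠ y in 𝓝 z, 𝓖.tgt (f y).1.1 = 𝓖.src (f y).1.2 := hC.mono fun y hy => hy.1
  rw [pullForm_prodForm hf, pullForm_prodForm hf.fst, pullForm_congr h0,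
    hΩ.pullForm_inv (contMDiffAt_mul hf.fst.fst hf.fst.snd h1),
    hΩ.pullForm_mul hf.fst.fst hf.fst.snd h1]
  ring

end IsSymplectic

/-- The graph of the triple product is a Lagrangian submanifold. -/
theorem IsSymplectic.isIsotropicParam_tripleGraph (hΩ : 𝓖.IsSymplectic Ω) :
    IsIsotropicParam (prodForm (-prodForm (prodForm Ω Ω) Ω) Ω) 𝓖.tripleGraph
      (Module.finrank ℝ E + 2 * 𝓖.fibreDim) := by
  have h := ((hΩ.isReduction_mul.prod (IsReduction.id (Ω := Ω))).comp
    hΩ.isReduction_mul).isLocTriv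
  have hd : Module.finrank ℝ E + (𝓖.fibreDim + (𝓖.fibreDim + 0)) =
    Module.finrank ℝ E + 2 * 𝓖.fibreDim := by ring
  have hp := h.isLocParam
  rw [hd] at hp
  refine ⟨hp.transport (i := fun p => (p, 𝓖.mul (𝓖.mul p.1.1 p.1.2) p.2)) (j := Prod.fst)
    (contMDiffOn_id.prodMk h.smooth) contMDiff_fst.contMDiffOn ?_ ?_ (fun _ _ => rfl)
    (fun _ hp => Prod.ext rfl hp.2.symm) fun _ _ => rfl, pullsBack_zero 0 ?_⟩
  · rintro p ⟨⟨hp1, -⟩, hp2⟩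
    exact ⟨⟨hp1, (𝓖.tgt_mul _ _ hp1).symm.trans hp2⟩, rfl⟩
  · rintro p ⟨⟨hp1, hp2⟩, -⟩
    exact ⟨⟨hp1, trivial⟩, (𝓖.tgt_mul _ _ hp1).trans hp2⟩
  intro m f z hf hC a b
  have h0 : (fun y => (f y).2) =ᶠ[𝓝 z]
      fun y => 𝓖.mul (𝓖.mul (f y).1.1.1 (f y).1.1.2) (f y).1.2 := hC.mono fun y hy => hy.2
  have h1 : ∀ᶠ y in 𝓝 z, 𝓖.tgt (f y).1.1.1 = 𝓖.src (f y).1.1.2 := hC.mono fun y hy => hy.1.1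
  have h2 : ∀ᶠ y in 𝓝 z,
      𝓖.tgt (𝓖.mul (f y).1.1.1 (f y).1.1.2) = 𝓖.src (f y).1.2 :=
    hC.mono fun y hy => (𝓖.tgt_mul _ _ hy.1.1).trans hy.1.2
  have hm := contMDiffAt_mul hf.fst.fst.fst hf.fst.fst.snd h1
  rw [pullForm_prodForm hf, pullForm_neg, pullForm_prodForm hf.fst, pullForm_prodForm hf.fst.fst,
    pullForm_congr h0, hΩ.pullForm_mul hm hf.fst.snd h2,
    hΩ.pullForm_mul hf.fst.fst.fst hf.fst.fst.snd h1]
  ring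

end LieGroupoid

/-- The diagonal of a symplectic manifold is Lagrangian. -/
theorem isIsotropicParam_diagonal (Ω : BilinField 𝓘(ℝ, E) G) :
    IsIsotropicParam (prodForm Ω (-Ω)) (diagonal G) (Module.finrank ℝ E) := by
  refine ⟨(IsLocTriv.toPoint (X := G)).transport (i := fun g => (g, g)) (j := Prod.fst)
    (contMDiff_id.prodMk contMDiff_id).contMDiffOn contMDiff_fst.contMDiffOn (fun _ _ => rfl)
    (fun _ _ => trivial) (fun _ _ => rfl) (fun _ hp => Prod.ext rfl hp) (fun _ _ => rfl),
    pullsBack_zero 0 ?_⟩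
  intro m f z hf hC a b
  have h0 : (fun y => (f y).2) =ᶠ[𝓝 z] fun y => (f y).1 := hC.mono fun y hy => hy.symm
  rw [pullForm_prodForm hf, pullForm_neg, pullForm_congr h0, add_neg_cancel]

end SymplecticGroupoid

/-! ### Leaves of the characteristic foliation -/

section Leaves

variable {E₁ : Type*} [NormedAddCommGroup E₁] [NormedSpace ℝ E₁] {H₁ : Type*} [TopologicalSpace H₁]
  {J₁ : ModelWithCorners ℝ E₁ H₁} {X : Type u} [TopologicalSpace X] [ChartedSpace H₁ X]
  {E : Type*} [NormedAddCommGroup E] [NormedSpace ℝ E]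
  {Q : Type*} [TopologicalSpace Q] [ChartedSpace E Q]
  {Ω : BilinField J₁ X} {η : BilinField 𝓘(ℝ, E) Q} {C : Set X}

/-- A curve with vanishing velocity is constant. -/
theorem eq_of_mfderiv_eq_zero [IsManifold 𝓘(ℝ, E) ∞ Q] {f : ℝ → Q}
    (hf : ∀ t, HasMFDerivAt 𝓘(ℝ, ℝ) 𝓘(ℝ, E) f t 0) (s t : ℝ) : f s = f t := by
  have hcont : Continuous f := continuous_iff_continuousAt.2 fun t => (hf t).continuousAt
  have hloc : IsLocallyConstant f := by
    rw [IsLocallyConstant.iff_eventually_eq]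
    intro t₀
    let c := extChartAt 𝓘(ℝ, E) (f t₀)
    have hev : ∀ᶠ t in 𝓝 t₀, f t ∈ c.source :=
      hcont.continuousAt.eventually ((isOpen_extChartAt_source _).mem_nhds
        (mem_extChartAt_source _))
    obtain ⟨ε, hε, hball⟩ := Metric.eventually_nhds_iff_ball.1 hev
    have hder : ∀ t ∈ Metric.ball t₀ ε, HasDerivAt (c ∘ f) 0 t := by
      intro t ht
      have hc : MDifferentiableAt 𝓘(ℝ, E) 𝓘(ℝ, E) c (f t) :=
        (contMDiffAt_extChartAt' (n := ∞) (by
          rw [← extChartAt_source 𝓘(ℝ, E)]; exact hball t ht)).mdifferentiableAt (by simp)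
      have h1 := (hc.hasMFDerivAt.comp t (hf t)).hasFDerivAt
      let A : E →L[ℝ] E := mfderiv 𝓘(ℝ, E) 𝓘(ℝ, E) c (f t)
      have h2 : HasFDerivAt (c ∘ f) (A.comp (0 : ℝ →L[ℝ] E)) t := h1
      rw [ContinuousLinearMap.comp_zero] at h2
      simpa using h2.hasDerivAt
    filter_upwards [Metric.ball_mem_nhds t₀ hε] with t ht
    have hconst := Metric.isOpen_ball.is_const_of_deriv_eq_zero (x := t₀) (y := t) (f := c ∘ f)
      (convex_ball t₀ ε).isPreconnected
      (fun r hr => (hder r hr).differentiableAt.differentiableWithinAt)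
      (fun r hr => (hder r hr).deriv) (Metric.mem_ball_self hε) ht
    exact c.injOn (hball t ht) (mem_extChartAt_source _) hconst.symm
  exact hloc.apply_eq_of_preconnectedSpace s t

namespace ImmersedSubmanifold

/-- A reduction map is constant on the leaves, since its derivative maps characteristic vectors to
vectors in the kernel of the nondegenerate form `η`. -/
theorem IsReductionMap.eq_of_charPath [IsManifold 𝓘(ℝ, E) ∞ Q] {Y : ImmersedSubmanifold J₁ C}
    {π : Y.carrier → Q} (hπ : Y.IsReductionMap Ω η π) (hη : IsAlmostSymplectic η)
    {p q : Y.carrier} (h : Y.CharPath Ω p q) : π p = π q := by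
  obtain ⟨γ, hγ, rfl, rfl, htan⟩ := h
  refine eq_of_mfderiv_eq_zero (E := E) (f := π ∘ γ) (fun t => ?_) 0 1
  have h1 := ((hπ.contMDiff (γ t)).mdifferentiableAt (by simp)).hasMFDerivAt.comp t
    ((hγ t).mdifferentiableAt (by simp)).hasMFDerivAt
  have hzero : mfderiv (𝓡 Y.dim) 𝓘(ℝ, E) π (γ t)
      (mfderiv 𝓘(ℝ, ℝ) (𝓡 Y.dim) γ t (1 : ℝ)) = 0 := by
    refine hη.nondegenerate _ _ fun w => ?_
    obtain ⟨b, rfl⟩ := hπ.submersion (γ t) w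
    rw [hπ.pullback_eq]
    exact htan t _ ⟨b, rfl⟩
  have hD : (mfderiv (𝓡 Y.dim) 𝓘(ℝ, E) π (γ t)).comp (mfderiv 𝓘(ℝ, ℝ) (𝓡 Y.dim) γ t) =
      (0 : ℝ →L[ℝ] E) := ContinuousLinearMap.ext_ring hzero
  rw [hD] at h1
  exact h1

end ImmersedSubmanifold

variable [T2Space X] [SecondCountableTopology X]
  {π : X → Q} {d d' : ℕ}

/-- Points of the same fibre of a reduction map which are close to each other lie on a common leaf:
in a local trivialization they are joined by a segment, reparametrized to be defined for all
times. -/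
theorem IsLocTriv.eventually_charPath (h : IsLocTriv J₁ 𝓘(ℝ, E) C π d) (hC : IsLocParam J₁ C d')
    (hπ : hC.submanifold.IsReductionMap Ω η fun p => π (hC.submanifold.incl p))
    (p : hC.submanifold.carrier) :
    ∀ᶠ q in 𝓝 p, π (hC.submanifold.incl q) = π (hC.submanifold.incl p) →
      hC.submanifold.CharPath Ω p q := by
  have hmem : ∀ p, hC.submanifold.incl p ∈ C := fun p => Subtype.property (p := (· ∈ C)) p
  obtain ⟨T, hT⟩ := h.exists_triv (hC.submanifold.incl p) (hmem p)
  set x := hC.submanifold.incl p with hx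
  have hV : (π x, T.κ x) ∈ T.V := T.mem_V x ⟨hmem p, hT⟩
  have hincl : ContinuousAt hC.submanifold.incl p :=
    (hC.submanifold.contMDiff_incl p).continuousAt
  have hU : ∀ᶠ q in 𝓝 p, hC.submanifold.incl q ∈ T.U := hincl (T.isOpen_U.mem_nhds hT)
  have hκc : ContinuousAt (fun q => T.κ (hC.submanifold.incl q)) p := by
    have h1 : ContinuousWithinAt T.κ (C ∩ T.U) x :=
      (T.smooth_κ x ⟨hmem p, hT⟩).continuousWithinAt
    exact h1.tendsto.comp (tendsto_nhdsWithin_iff.2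
      ⟨hincl, hU.mono fun q hq => ⟨hmem q, hq⟩⟩)
  have hslice : IsOpen {k | (π x, k) ∈ T.V} := T.isOpen_V.preimage (by fun_prop)
  obtain ⟨ε, hε, hball⟩ := Metric.isOpen_iff.1 hslice _ hV
  filter_upwards [hU, hκc (Metric.ball_mem_nhds (T.κ x) hε)] with q hqU hqκ hqπ
  have hqκ' : T.κ (hC.submanifold.incl q) ∈ Metric.ball (T.κ x) ε := hqκ
  let k : ℝ → Euc d := fun t =>
    T.κ x + Real.smoothTransition t • (T.κ (hC.submanifold.incl q) - T.κ x)
  have hk : ∀ t, (π x, k t) ∈ T.V := fun t => hball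
    ((convex_ball (T.κ x) ε).add_smul_sub_mem (Metric.mem_ball_self hε) hqκ'
      ⟨Real.smoothTransition.nonneg t, Real.smoothTransition.le_one t⟩)
  have hk0 : k 0 = T.κ x := by simp [k, Real.smoothTransition.zero]
  have hk1 : k 1 = T.κ (hC.submanifold.incl q) := by simp [k, Real.smoothTransition.one]
  have hksm : ContDiff ℝ ∞ k :=
    contDiff_const.add (Real.smoothTransition.contDiff.smul contDiff_const)
  let γ : ℝ → hC.submanifold.carrier := fun t => ⟨T.ψ (π x, k t), (T.mapsTo_ψ _ (hk t)).1⟩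
  have hγincl : ∀ t, hC.submanifold.incl (γ t) = T.ψ (π x, k t) := fun t => rfl
  have hγ : ContMDiff 𝓘(ℝ, ℝ) (𝓡 hC.submanifold.dim) ∞ γ := by
    intro t
    refine hC.submanifold_contMDiffAt ?_
    exact ContMDiffAt.comp (g := T.ψ) t (T.smooth_ψ.contMDiffAt (T.isOpen_V.mem_nhds (hk t)))
      (contMDiffAt_const.prodMk hksm.contMDiff.contMDiffAt)
  refine ⟨γ, hγ, ?_, ?_, fun t w hw => ?_⟩
  · refine hC.submanifold.injective_incl ?_
    rw [hγincl, hk0, T.ψ_κ x ⟨hmem p, hT⟩]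
  · refine hC.submanifold.injective_incl ?_
    rw [hγincl, hk1, ← hqπ, T.ψ_κ _ ⟨hmem q, hqU⟩]
  · -- the path stays in a fibre, so the reduction map kills its velocity
    obtain ⟨b, rfl⟩ := hw
    have hconst : (fun p => π (hC.submanifold.incl p)) ∘ γ = fun _ => π x := by
      funext t
      rw [Function.comp_apply, hγincl, T.π_ψ _ (hk t)]
    have hd := mfderiv_comp t ((hπ.contMDiff (γ t)).mdifferentiableAt (by simp))
      ((hγ t).mdifferentiableAt (by simp))
    rw [hconst, mfderiv_const] at hd
    have hd1 : mfderiv (𝓡 hC.submanifold.dim) 𝓘(ℝ, E) (fun p => π (hC.submanifold.incl p)) (γ t)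
        (mfderiv 𝓘(ℝ, ℝ) (𝓡 hC.submanifold.dim) γ t (1 : ℝ)) = 0 :=
      (congrArg (fun A => A (1 : ℝ)) hd).symm
    have := hπ.pullback_eq (γ t) (mfderiv 𝓘(ℝ, ℝ) (𝓡 hC.submanifold.dim) γ t (1 : ℝ)) b
    rw [hd1, map_zero, LinearMap.zero_apply] at this
    exact this.symm

/-- If the fibres of a reduction map are connected, it identifies the reduced space with its
target. -/
theorem IsLocTriv.exists_reduced_equiv [IsManifold 𝓘(ℝ, E) ∞ Q]
    (h : IsLocTriv J₁ 𝓘(ℝ, E) C π d) (hC : IsLocParam J₁ C d')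
    (hπ : hC.submanifold.IsReductionMap Ω η fun p => π (hC.submanifold.incl p))
    (hη : IsAlmostSymplectic η) (hconn : ∀ q, IsPreconnected {c ∈ C | π c = q}) :
    ∃ e : hC.submanifold.Reduced Ω ≃ Q,
      ∀ p, e (hC.submanifold.leaf Ω p) = π (hC.submanifold.incl p) := by
  let f : hC.submanifold.Reduced Ω → Q :=
    Quot.lift (fun p => π (hC.submanifold.incl p)) fun _ _ hpq => hπ.eq_of_charPath hη hpq
  have hf : Function.Bijective f := by
    refine ⟨?_, fun q => ?_⟩
    · rintro ⟨p⟩ ⟨q⟩ hpq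
      have hpq' : π (hC.submanifold.incl p) = π (hC.submanifold.incl q) := hpq
      let F : Set hC.submanifold.carrier :=
        {c | π (hC.submanifold.incl c) = π (hC.submanifold.incl p)}
      have himage : hC.submanifold.incl '' F = {c ∈ C | π c = π (hC.submanifold.incl p)} := by
        ext c
        constructor
        · rintro ⟨c, hc, rfl⟩
          exact ⟨Subtype.property (p := (· ∈ C)) c, hc⟩
        · rintro ⟨hc, hc'⟩
          exact ⟨⟨c, hc⟩, hc', rfl⟩
      have hF : IsPreconnected F := by
        rw [← hC.submanifold_isEmbedded.isInducing.isPreconnected_image, himage]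
        exact hconn _
      have : PreconnectedSpace F := isPreconnected_iff_preconnectedSpace.1 hF
      have hloc : IsLocallyConstant fun c : F => hC.submanifold.leaf Ω c := by
        rw [IsLocallyConstant.iff_eventually_eq]
        intro c
        have hev := continuous_subtype_val.continuousAt.eventually
          (h.eventually_charPath hC hπ (c : hC.submanifold.carrier))
        filter_upwards [hev] with c' hc'
        exact (Quot.sound (hc' (c'.2.trans c.2.symm))).symm
      exact hloc.apply_eq_of_preconnectedSpace (⟨p, rfl⟩ : F) ⟨q, hpq'.symm⟩
    · obtain ⟨p, hp⟩ := hπ.surjective q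
      exact ⟨hC.submanifold.leaf Ω p, hp⟩
  exact ⟨Equiv.ofBijective f hf, fun p => rfl⟩

end Leaves

section Fibres

variable {E : Type*} [NormedAddCommGroup E] [NormedSpace ℝ E]
  {B : Type*} [NormedAddCommGroup B] [NormedSpace ℝ B]
  {G : Type*} {M : Type*} [TopologicalSpace G] [ChartedSpace E G]
  [TopologicalSpace M] [ChartedSpace B M]

namespace LieGroupoid

variable (𝓖 : LieGroupoid E B G M)

theorem continuous_unitString (n : ℕ) : Continuous (𝓖.unitString n) := by
  refine continuous_pi fun k => ?_
  induction k using Fin.cases with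
  | zero => exact continuous_id
  | succ k => exact 𝓖.smooth_unit.continuous.comp 𝓖.smooth_tgt.continuous

/-- The fibres of the product of strings are connected if the source fibres are. By induction, a
string `(h, β)` with product `g` can be moved inside the fibre to `(h, h⁻¹ g, 1, …, 1)`, where `h`
runs through the source fibre of `g`. -/
theorem isPreconnected_fibre_strProd (hconn : 𝓖.SourceConnected) (n : ℕ) (g : G) :
    IsPreconnected {α ∈ 𝓖.composable (n + 1) | 𝓖.strProd n α = g} := by
  induction n generalizing g with
  | zero =>
    refine Set.Subsingleton.isPreconnected ?_
    rintro α ⟨-, hα⟩ β ⟨-, hβ⟩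
    funext k
    have hk : k = 0 := Fin.ext (by simp only [Fin.val_zero]; omega)
    rw [hk]
    exact Eq.trans hα (Eq.symm hβ)
  | succ n ih =>
    let c : G → Fin (n + 2) → G := fun h =>
      Fin.cons h (𝓖.unitString n (𝓖.mul (𝓖.inv h) g))
    let F : Set G := 𝓖.src ⁻¹' {𝓖.src g}
    have hpair : ∀ h ∈ F, 𝓖.tgt (𝓖.inv h) = 𝓖.src g := fun h hh => (𝓖.tgt_inv h).trans hh
    have hmem : ∀ h ∈ F, ∀ β ∈ 𝓖.composable (n + 1), 𝓖.strProd n β = 𝓖.mul (𝓖.inv h) g →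
        (Fin.cons h β : Fin (n + 2) → G) ∈
          {α ∈ 𝓖.composable (n + 2) | 𝓖.strProd (n + 1) α = g} := by
      intro h hh β hβ hβ'
      refine ⟨𝓖.mem_composable_succ_iff_strProd.2 ⟨hβ, ?_⟩, ?_⟩
      · change 𝓖.tgt h = 𝓖.src (𝓖.strProd n β)
        rw [hβ', 𝓖.src_mul _ _ (hpair h hh), 𝓖.src_inv]
      · change 𝓖.mul h (𝓖.strProd n β) = g
        rw [hβ']
        exact 𝓖.mul_inv_cancel_left hh
    have hccont : ContinuousOn c F := by
      have h1 : ContinuousOn (fun h => 𝓖.mul (𝓖.inv h) g) F :=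
        𝓖.contMDiffOn_mul.continuousOn.comp (f := fun h => (𝓖.inv h, g))
          (𝓖.smooth_inv.continuous.prodMk continuous_const).continuousOn hpair
      refine continuousOn_pi.2 fun k => ?_
      induction k using Fin.cases with
      | zero => exact continuousOn_id
      | succ k =>
        exact ((continuous_apply k).comp (𝓖.continuous_unitString n)).comp_continuousOn h1
    have hcF : IsPreconnected (c '' F) := (hconn (𝓖.src g)).isPreconnected.image c hccont
    have hcsub : c '' F ⊆ {α ∈ 𝓖.composable (n + 2) | 𝓖.strProd (n + 1) α = g} := by
      rintro _ ⟨h, hh, rfl⟩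
      exact hmem h hh _ (𝓖.unitString_mem _ _) (𝓖.strProd_unitString _ _)
    refine isPreconnected_of_forall (c g) ?_
    rintro α ⟨hα, hαg⟩
    have hα' := 𝓖.mem_composable_succ_iff_strProd.1 hα
    have hαg' : 𝓖.mul (α 0) (𝓖.strProd n (Fin.tail α)) = g := hαg
    have hh : α 0 ∈ F := by
      change 𝓖.src (α 0) = 𝓖.src g
      rw [← hαg', 𝓖.src_mul _ _ hα'.2]
    have htail : 𝓖.strProd n (Fin.tail α) = 𝓖.mul (𝓖.inv (α 0)) g := by
      rw [← hαg', 𝓖.inv_mul_cancel_left hα'.2]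
    let A : Set (Fin (n + 2) → G) := (fun β => Fin.cons (α 0) β) ''
      {β ∈ 𝓖.composable (n + 1) | 𝓖.strProd n β = 𝓖.mul (𝓖.inv (α 0)) g}
    have hA : IsPreconnected A := by
      refine (ih _).image _ (Continuous.continuousOn (continuous_pi fun k => ?_))
      induction k using Fin.cases with
      | zero => exact continuous_const
      | succ k => exact continuous_apply k
    have hA1 : α ∈ A := ⟨Fin.tail α, ⟨hα'.1, htail⟩, Fin.cons_self_tail α⟩
    have hA2 : c (α 0) ∈ A :=
      ⟨_, ⟨𝓖.unitString_mem _ _, 𝓖.strProd_unitString _ _⟩, rfl⟩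
    have hAsub : A ⊆ {α ∈ 𝓖.composable (n + 2) | 𝓖.strProd (n + 1) α = g} := by
      rintro _ ⟨β, hβ, rfl⟩
      exact hmem _ hh β hβ.1 hβ.2
    exact ⟨A ∪ c '' F, union_subset hAsub hcsub, Or.inr ⟨g, rfl, rfl⟩, Or.inl hA1,
      hA.union (c (α 0)) hA2 ⟨α 0, hh, rfl⟩ hcF⟩

end LieGroupoid

end Fibres

/-! ### The relations of the powers, pointwise -/

section Relations

variable {E : Type*} [NormedAddCommGroup E] [NormedSpace ℝ E]
  {B : Type*} [NormedAddCommGroup B] [NormedSpace ℝ B]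
  {G : Type*} {M : Type*} [TopologicalSpace G] [ChartedSpace E G]
  [TopologicalSpace M] [ChartedSpace B M]

namespace LieGroupoid

variable (𝓖 : LieGroupoid E B G M)

/-- On the power, `L₃` is the graph of the product, read on the products of strings. -/
theorem mem_L₃_powRel {n : ℕ} {α β γ : Fin (n + 1) → G} :
    ((α, β), γ) ∈ L₃ (𝓖.powRel n) (𝓖.powInv n) ↔
      α ∈ 𝓖.composable (n + 1) ∧ β ∈ 𝓖.composable (n + 1) ∧ γ ∈ 𝓖.composable (n + 1) ∧
        𝓖.tgt (𝓖.strProd n α) = 𝓖.src (𝓖.strProd n β) ∧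
        𝓖.strProd n γ = 𝓖.mul (𝓖.strProd n α) (𝓖.strProd n β) := by
  constructor
  · rintro ⟨δ, ⟨hα, hβ, hδ, ht, hm⟩, rfl⟩
    refine ⟨hα, hβ, 𝓖.powInv_mem_composable hδ, ht, ?_⟩
    rw [𝓖.strProd_powInv hδ, show 𝓖.strProd n δ = _ from hm, 𝓖.inv_inv]
  · rintro ⟨hα, hβ, hγ, ht, hm⟩
    refine ⟨𝓖.powInv n γ, ⟨hα, hβ, 𝓖.powInv_mem_composable hγ, ht, ?_⟩, 𝓖.powInv_powInv γ⟩
    exact (𝓖.strProd_powInv hγ).trans (congrArg 𝓖.inv hm)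

theorem mem_L₁_powRel {n : ℕ} {α : Fin (n + 1) → G} :
    α ∈ L₁ (𝓖.powRel n) (𝓖.powInv n) ↔
      α ∈ 𝓖.composable (n + 1) ∧ 𝓖.strProd n α ∈ range 𝓖.unit := by
  constructor
  · rintro ⟨⟨β, γ⟩, hβγ, h⟩
    obtain rfl : 𝓖.powInv n β = γ := hβγ
    obtain ⟨hβ, -, hα, -, hm⟩ := 𝓖.mem_L₃_powRel.1 h
    refine ⟨hα, 𝓖.src (𝓖.strProd n β), ?_⟩
    rw [hm, 𝓖.strProd_powInv hβ, 𝓖.mul_inv]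
  · rintro ⟨hα, x, hx⟩
    refine ⟨(α, 𝓖.powInv n α), rfl,
      𝓖.mem_L₃_powRel.2 ⟨hα, 𝓖.powInv_mem_composable hα, hα, ?_, ?_⟩⟩
    · rw [𝓖.strProd_powInv hα, 𝓖.src_inv]
    · rw [𝓖.strProd_powInv hα, 𝓖.mul_inv, ← hx, 𝓖.src_unit]

theorem mem_L₂_powRel {n : ℕ} {α β : Fin (n + 1) → G} :
    (α, β) ∈ L₂ (𝓖.powRel n) (𝓖.powInv n) ↔
      α ∈ 𝓖.composable (n + 1) ∧ β ∈ 𝓖.composable (n + 1) ∧ 𝓖.strProd n α = 𝓖.strProd n β := by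
  constructor
  · rintro ⟨ε, hε, h⟩
    obtain ⟨-, x, hx⟩ := 𝓖.mem_L₁_powRel.1 hε
    obtain ⟨-, hα, hβ, ht, hm⟩ := 𝓖.mem_L₃_powRel.1 h
    refine ⟨hα, hβ, ?_⟩
    rw [← hx, 𝓖.tgt_unit] at ht
    rw [hm, ← hx, ht, 𝓖.unit_mul]
  · rintro ⟨hα, hβ, hm⟩
    obtain ⟨ε, hε, hx⟩ := 𝓖.exists_strProd_eq n (𝓖.unit (𝓖.src (𝓖.strProd n α)))
    refine ⟨ε, 𝓖.mem_L₁_powRel.2 ⟨hε, _, hx.symm⟩, 𝓖.mem_L₃_powRel.2 ⟨hε, hα, hβ, ?_, ?_⟩⟩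
    · rw [hx, 𝓖.tgt_unit]
    · rw [hx, 𝓖.unit_mul, hm]

theorem mem_assoc_powRel {n : ℕ} {α β γ δ : Fin (n + 1) → G} :
    (((α, β), γ), δ) ∈
        relProd (L₃ (𝓖.powRel n) (𝓖.powInv n)) SetRel.id ○ L₃ (𝓖.powRel n) (𝓖.powInv n) ↔
      α ∈ 𝓖.composable (n + 1) ∧ β ∈ 𝓖.composable (n + 1) ∧ γ ∈ 𝓖.composable (n + 1) ∧
        δ ∈ 𝓖.composable (n + 1) ∧
        (((𝓖.strProd n α, 𝓖.strProd n β), 𝓖.strProd n γ), 𝓖.strProd n δ) ∈ 𝓖.tripleGraph := by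
  constructor
  · rintro ⟨⟨ε, ε'⟩, ⟨h, hγ⟩, h'⟩
    obtain rfl : γ = ε' := hγ
    obtain ⟨hα, hβ, -, ht, hm⟩ := 𝓖.mem_L₃_powRel.1 h
    obtain ⟨-, hγ, hδ, ht', hm'⟩ := 𝓖.mem_L₃_powRel.1 h'
    rw [hm] at ht' hm'
    rw [𝓖.tgt_mul _ _ ht] at ht'
    exact ⟨hα, hβ, hγ, hδ, ⟨ht, ht'⟩, hm'⟩
  · rintro ⟨hα, hβ, hγ, hδ, ⟨ht, ht'⟩, hm⟩
    obtain ⟨ε, hε, hx⟩ := 𝓖.exists_strProd_eq n (𝓖.mul (𝓖.strProd n α) (𝓖.strProd n β))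
    refine ⟨(ε, γ), ⟨𝓖.mem_L₃_powRel.2 ⟨hα, hβ, hε, ht, hx⟩, rfl⟩,
      𝓖.mem_L₃_powRel.2 ⟨hε, hγ, hδ, ?_, ?_⟩⟩
    · rw [hx]
      exact (𝓖.tgt_mul _ _ ht).trans ht'
    · rw [hx]
      exact hm

theorem powRel_assoc (n : ℕ) :
    relProd (L₃ (𝓖.powRel n) (𝓖.powInv n)) SetRel.id ○ L₃ (𝓖.powRel n) (𝓖.powInv n) =
      Function.graph (Equiv.prodAssoc (Fin (n + 1) → G) (Fin (n + 1) → G) (Fin (n + 1) → G)) ○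
        relProd SetRel.id (L₃ (𝓖.powRel n) (𝓖.powInv n)) ○ L₃ (𝓖.powRel n) (𝓖.powInv n) := by
  ext ⟨⟨⟨α, β⟩, γ⟩, δ⟩
  rw [𝓖.mem_assoc_powRel]
  constructor
  · rintro ⟨hα, hβ, hγ, hδ, ⟨ht, ht'⟩, hm⟩
    obtain ⟨ε, hε, hx⟩ := 𝓖.exists_strProd_eq n (𝓖.mul (𝓖.strProd n β) (𝓖.strProd n γ))
    refine ⟨(α, ε), ⟨(α, (β, γ)), rfl, rfl, 𝓖.mem_L₃_powRel.2 ⟨hβ, hγ, hε, ht', hx⟩⟩,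
      𝓖.mem_L₃_powRel.2 ⟨hα, hε, hδ, ?_, ?_⟩⟩
    · rw [hx]
      exact ht.trans (𝓖.src_mul _ _ ht').symm
    · rw [hx]
      exact Eq.trans hm (𝓖.mul_assoc _ _ _ ht ht')
  · rintro ⟨⟨α', ε⟩, ⟨⟨α'', β', γ'⟩, he, hα', h⟩, h'⟩
    obtain ⟨rfl, rfl, rfl⟩ : α = α'' ∧ β = β' ∧ γ = γ' := by
      have he' : (α, (β, γ)) = (α'', (β', γ')) := he
      simpa using he'
    obtain rfl : α = α' := hα'
    obtain ⟨hβ, hγ, -, ht', hm'⟩ := 𝓖.mem_L₃_powRel.1 h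
    obtain ⟨hα, -, hδ, ht, hm⟩ := 𝓖.mem_L₃_powRel.1 h'
    rw [hm'] at ht hm
    rw [𝓖.src_mul _ _ ht'] at ht
    exact ⟨hα, hβ, hγ, hδ, ⟨ht, ht'⟩, hm.trans (𝓖.mul_assoc _ _ _ ht ht').symm⟩

/-- The relation `g h k = 1` is invariant under cyclic permutations. -/
theorem rel_cyclic {g h k : G} (hp : ((g, h), k) ∈ 𝓖.rel) : ((h, k), g) ∈ 𝓖.rel := by
  obtain ⟨ht, hk⟩ := hp
  have ht : 𝓖.tgt g = 𝓖.src h := ht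
  have hk : k = 𝓖.inv (𝓖.mul g h) := hk
  rw [𝓖.mul_inv_rev ht] at hk
  have ht1 : 𝓖.src h = 𝓖.src (𝓖.inv g) := by rw [𝓖.src_inv, ht]
  have ht2 : 𝓖.tgt (𝓖.inv h) = 𝓖.src (𝓖.inv g) := (𝓖.tgt_inv h).trans ht1
  refine ⟨?_, ?_⟩
  · change 𝓖.tgt h = 𝓖.src k
    rw [hk, 𝓖.src_mul _ _ ht2, 𝓖.src_inv]
  · change g = 𝓖.inv (𝓖.mul h k)
    rw [hk, 𝓖.mul_inv_cancel_left ht1, 𝓖.inv_inv]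

theorem powRel_inv_comp (n : ℕ) : 𝓖.powRel n ○ Function.graph (𝓖.powInv n) =
    relProd (Function.graph (𝓖.powInv n)) (Function.graph (𝓖.powInv n)) ○
      Function.graph (Prod.swap : (Fin (n + 1) → G) × (Fin (n + 1) → G) → _) ○ 𝓖.powRel n := by
  ext ⟨⟨α, β⟩, γ⟩
  have hswap : ((α, β), γ) ∈ relProd (Function.graph (𝓖.powInv n)) (Function.graph (𝓖.powInv n)) ○
      Function.graph (Prod.swap : (Fin (n + 1) → G) × (Fin (n + 1) → G) → _) ○ 𝓖.powRel n ↔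
      ((𝓖.powInv n β, 𝓖.powInv n α), γ) ∈ 𝓖.powRel n := by
    constructor
    · rintro ⟨_, ⟨⟨α', β'⟩, ⟨h1, h2⟩, rfl⟩, h⟩
      obtain rfl : 𝓖.powInv n α = α' := h1
      obtain rfl : 𝓖.powInv n β = β' := h2
      exact h
    · exact fun h => ⟨_, ⟨(𝓖.powInv n α, 𝓖.powInv n β), ⟨rfl, rfl⟩, rfl⟩, h⟩
  rw [hswap]
  refine 𝓖.mem_L₃_powRel.trans ?_
  constructor
  · rintro ⟨hα, hβ, hγ, ht, hm⟩
    refine ⟨𝓖.powInv_mem_composable hβ, 𝓖.powInv_mem_composable hα, hγ, ?_⟩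
    rw [𝓖.strProd_powInv hα, 𝓖.strProd_powInv hβ, hm]
    refine ⟨?_, ?_⟩
    · exact (𝓖.tgt_inv _).trans (ht.symm.trans (𝓖.src_inv _).symm)
    · rw [← 𝓖.mul_inv_rev ht, 𝓖.inv_inv]
  · rintro ⟨hβ, hα, hγ, ht, hm⟩
    have hα := 𝓖.powInv_mem_composable_iff.1 hα
    have hβ := 𝓖.powInv_mem_composable_iff.1 hβ
    rw [𝓖.strProd_powInv hα, 𝓖.strProd_powInv hβ] at ht hm
    have ht : 𝓖.tgt (𝓖.inv (𝓖.strProd n β)) = 𝓖.src (𝓖.inv (𝓖.strProd n α)) := ht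
    rw [𝓖.tgt_inv, 𝓖.src_inv] at ht
    refine ⟨hα, hβ, hγ, ht.symm, Eq.trans hm ?_⟩
    rw [← 𝓖.mul_inv_rev ht.symm, 𝓖.inv_inv]

theorem image_L₃_powRel (n : ℕ) : (L₃ (𝓖.powRel n) (𝓖.powInv n)).image
    (L₁ (𝓖.powRel n) (𝓖.powInv n) ×ˢ L₁ (𝓖.powRel n) (𝓖.powInv n)) =
      L₁ (𝓖.powRel n) (𝓖.powInv n) := by
  ext γ
  constructor
  · rintro ⟨⟨α, β⟩, ⟨hα, hβ⟩, h⟩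
    obtain ⟨-, x, hx⟩ := 𝓖.mem_L₁_powRel.1 hα
    obtain ⟨-, y, hy⟩ := 𝓖.mem_L₁_powRel.1 hβ
    obtain ⟨-, -, hγ, ht, hm⟩ := 𝓖.mem_L₃_powRel.1 h
    refine 𝓖.mem_L₁_powRel.2 ⟨hγ, y, ?_⟩
    rw [← hx, 𝓖.tgt_unit] at ht
    rw [hm, ← hx, ht, 𝓖.unit_mul, hy]
  · intro hγ
    obtain ⟨hγ', x, hx⟩ := 𝓖.mem_L₁_powRel.1 hγ
    refine ⟨(γ, γ), ⟨hγ, hγ⟩, 𝓖.mem_L₃_powRel.2 ⟨hγ', hγ', hγ', ?_, ?_⟩⟩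
    · rw [← hx, 𝓖.tgt_unit, 𝓖.src_unit]
    · have := 𝓖.unit_mul (𝓖.unit x)
      rw [𝓖.src_unit] at this
      rw [← hx, this]

/-- `P_i ∘ P_j^op` relates strings with the same product. -/
theorem mem_inv_P_comp_P {i j : ℕ} {α : Fin (j + 1) → G} {β : Fin (i + 1) → G} :
    (α, β) ∈ (𝓖.P j).inv ○ 𝓖.P i ↔
      α ∈ 𝓖.composable (j + 1) ∧ β ∈ 𝓖.composable (i + 1) ∧ 𝓖.strProd j α = 𝓖.strProd i β := by
  constructor
  · rintro ⟨g, ⟨hα, h1⟩, hβ, h2⟩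
    exact ⟨hα, hβ, Eq.trans h1 (Eq.symm h2)⟩
  · rintro ⟨hα, hβ, h⟩
    exact ⟨𝓖.strProd j α, ⟨hα, rfl⟩, hβ, h.symm⟩

theorem inv_inv_P_comp_P (i j : ℕ) : ((𝓖.P j).inv ○ 𝓖.P i).inv = (𝓖.P i).inv ○ 𝓖.P j := by
  ext ⟨α, β⟩
  refine 𝓖.mem_inv_P_comp_P.trans (Iff.trans ?_ 𝓖.mem_inv_P_comp_P.symm)
  exact ⟨fun h => ⟨h.2.1, h.1, h.2.2.symm⟩, fun h => ⟨h.2.1, h.1, h.2.2.symm⟩⟩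

theorem graph_powInv_comp (i j : ℕ) :
    Function.graph (𝓖.powInv j) ○ ((𝓖.P j).inv ○ 𝓖.P i) =
      ((𝓖.P j).inv ○ 𝓖.P i) ○ Function.graph (𝓖.powInv i) := by
  ext ⟨α, β⟩
  constructor
  · rintro ⟨_, rfl, h⟩
    obtain ⟨hα, hβ, h⟩ := 𝓖.mem_inv_P_comp_P.1 h
    have hα := 𝓖.powInv_mem_composable_iff.1 hα
    refine ⟨𝓖.powInv i β, 𝓖.mem_inv_P_comp_P.2 ⟨hα, 𝓖.powInv_mem_composable hβ, ?_⟩,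
      𝓖.powInv_powInv β⟩
    rw [𝓖.strProd_powInv hβ, ← h, 𝓖.strProd_powInv hα, 𝓖.inv_inv]
  · rintro ⟨β', h, rfl⟩
    obtain ⟨hα, hβ, h⟩ := 𝓖.mem_inv_P_comp_P.1 h
    refine ⟨𝓖.powInv j α, rfl, 𝓖.mem_inv_P_comp_P.2
      ⟨𝓖.powInv_mem_composable hα, 𝓖.powInv_mem_composable hβ, ?_⟩⟩
    rw [𝓖.strProd_powInv hβ, 𝓖.strProd_powInv hα, h]

theorem image_powRel (i j : ℕ) :
    (relProd (relProd ((𝓖.P j).inv ○ 𝓖.P i) ((𝓖.P j).inv ○ 𝓖.P i))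
      ((𝓖.P j).inv ○ 𝓖.P i)).image (𝓖.powRel j) = 𝓖.powRel i := by
  ext ⟨⟨α, β⟩, γ⟩
  constructor
  · rintro ⟨⟨⟨α', β'⟩, γ'⟩, ⟨-, -, -, h⟩, ⟨hα, hβ⟩, hγ⟩
    obtain ⟨-, hα, eα⟩ := 𝓖.mem_inv_P_comp_P.1 hα
    obtain ⟨-, hβ, eβ⟩ := 𝓖.mem_inv_P_comp_P.1 hβ
    obtain ⟨-, hγ, eγ⟩ := 𝓖.mem_inv_P_comp_P.1 hγ
    refine ⟨hα, hβ, hγ, ?_⟩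
    rw [← eα, ← eβ, ← eγ]
    exact h
  · rintro ⟨hα, hβ, hγ, h⟩
    obtain ⟨α', hα', eα⟩ := 𝓖.exists_strProd_eq j (𝓖.strProd i α)
    obtain ⟨β', hβ', eβ⟩ := 𝓖.exists_strProd_eq j (𝓖.strProd i β)
    obtain ⟨γ', hγ', eγ⟩ := 𝓖.exists_strProd_eq j (𝓖.strProd i γ)
    refine ⟨((α', β'), γ'), ⟨hα', hβ', hγ', ?_⟩, ⟨𝓖.mem_inv_P_comp_P.2 ⟨hα', hα, eα⟩,
      𝓖.mem_inv_P_comp_P.2 ⟨hβ', hβ, eβ⟩⟩, 𝓖.mem_inv_P_comp_P.2 ⟨hγ', hγ, eγ⟩⟩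
    rw [eα, eβ, eγ]
    exact h

end LieGroupoid

end Relations

/-! ### The powers as relational symplectic groupoids -/

section Powers

variable {E : Type*} [NormedAddCommGroup E] [NormedSpace ℝ E]
  {B : Type*} [NormedAddCommGroup B] [NormedSpace ℝ B]
  {G : Type*} {M : Type*} [TopologicalSpace G] [ChartedSpace E G] [IsManifold 𝓘(ℝ, E) ∞ G]
  [TopologicalSpace M] [ChartedSpace B M]
  {𝓖 : LieGroupoid E B G M} {Ω : BilinField 𝓘(ℝ, E) G}

namespace LieGroupoid

theorem contMDiff_powInv (𝓖 : LieGroupoid E B G M) (n : ℕ) :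
    ContMDiff (powModel 𝓘(ℝ, E) (n + 1)) (powModel 𝓘(ℝ, E) (n + 1)) ∞ (𝓖.powInv n) :=
  contMDiff_pow.2 fun k => 𝓖.smooth_inv.comp (contMDiff_eval k.rev)

theorem IsSymplectic.isAlmostSymplectic_powForm (hΩ : 𝓖.IsSymplectic Ω) (n : ℕ) :
    IsAlmostSymplectic (powForm Ω n) :=
  (hΩ.isSymplecticForm.powForm n).isAlmostSymplectic

/-- The involution of the power is antisymplectic. -/
theorem IsSymplectic.powForm_powInv [FiniteDimensional ℝ E] (hΩ : 𝓖.IsSymplectic Ω) (n : ℕ)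
    (α : Fin (n + 1) → G) (v w : TangentSpace (powModel 𝓘(ℝ, E) (n + 1)) α) :
    powForm Ω (n + 1) (𝓖.powInv n α)
      (mfderiv (powModel 𝓘(ℝ, E) (n + 1)) (powModel 𝓘(ℝ, E) (n + 1)) (𝓖.powInv n) α v)
      (mfderiv (powModel 𝓘(ℝ, E) (n + 1)) (powModel 𝓘(ℝ, E) (n + 1)) (𝓖.powInv n) α w) =
      -powForm Ω (n + 1) α v w := by
  have hpull : PullsBack (powForm Ω (n + 1)) (-powForm Ω (n + 1)) univ (𝓖.powInv n) := by
    intro m f z hf _ a b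
    have hI : ContMDiffAt (𝓡 m) (powModel 𝓘(ℝ, E) (n + 1)) ∞ (fun y => 𝓖.powInv n (f y)) z :=
      (𝓖.contMDiff_powInv n _).comp z hf
    have h1 : pullForm (powForm Ω (n + 1)) (fun y => 𝓖.powInv n (f y)) z a b =
        -pullForm (powForm Ω (n + 1)) f z a b := by
      rw [pullForm_powForm hI, pullForm_powForm hf, ← Finset.sum_neg_distrib]
      refine Fintype.sum_equiv Fin.revPerm _ _ fun k => ?_
      exact hΩ.pullForm_inv (contMDiffAt_pow.1 hf k.rev) a b
    exact neg_eq_iff_eq_neg.2 h1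
  have h := hpull.apply_of_contMDiffAt (𝓖.contMDiff_powInv n).contMDiffOn
    (contMDiffAt_id (x := α)) (Filter.Eventually.of_forall fun _ => trivial) v w
  rw [mfderiv_id] at h
  exact neg_eq_iff_eq_neg.1 h

end LieGroupoid

end Powers

section SymplecticPowers

variable {E : Type*} [NormedAddCommGroup E] [NormedSpace ℝ E] [FiniteDimensional ℝ E]
  {B : Type*} [NormedAddCommGroup B] [NormedSpace ℝ B]
  {G : Type u} {M : Type*} [TopologicalSpace G] [ChartedSpace E G] [IsManifold 𝓘(ℝ, E) ∞ G]
  [TopologicalSpace M] [ChartedSpace B M] [IsManifold 𝓘(ℝ, B) ∞ M]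
  {𝓖 : LieGroupoid E B G M} {Ω : BilinField 𝓘(ℝ, E) G}

namespace LieGroupoid

namespace IsSymplectic

variable [T2Space G] [SecondCountableTopology G]

/-- The dimensions in `isReduction_strProd` are those of a coisotropic reduction. -/
theorem finrank_pow_eq (hΩ : 𝓖.IsSymplectic Ω) (n : ℕ) (hG : Nonempty (Fin (n + 1) → G)) :
    Module.finrank ℝ E = 2 * 𝓖.fibreDim ∧
      Module.finrank ℝ (Fin (n + 1) → E) = 2 * (𝓖.fibreDim + n * 𝓖.fibreDim) := by
  have hG : Nonempty G := hG.map fun α => α 0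
  have h : Module.finrank ℝ E = 2 * 𝓖.fibreDim := by
    rw [hΩ.fibreDim_eq hG, hΩ.finrank_eq hG]
  refine ⟨h, ?_⟩
  rw [Module.finrank_pi_fintype, Finset.sum_const, Finset.card_univ, Fintype.card_fin, h,
    smul_eq_mul]
  ring

/-- `G` is the symplectic reduction of the composable strings. -/
theorem exists_reduction_composable (hΩ : 𝓖.IsSymplectic Ω) (n : ℕ) :
    ∃ Y : ImmersedSubmanifold (powModel 𝓘(ℝ, E) (n + 1)) (𝓖.composable (n + 1)),
      Y.IsEmbedded ∧ Y.IsCoisotropic (powForm Ω (n + 1)) ∧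
      Y.IsReductionMap (powForm Ω (n + 1)) Ω (fun p => 𝓖.strProd n (Y.incl p)) ∧
      (𝓖.SourceConnected → ∃ e : Y.Reduced (powForm Ω (n + 1)) ≃ G,
        ∀ p : Y.carrier, e (Y.leaf (powForm Ω (n + 1)) p) = 𝓖.strProd n (Y.incl p)) := by
  have h := hΩ.isReduction_strProd n
  have hC := h.isLocTriv.isLocParam
  have hπ := h.isLocTriv.isReductionMap hC (𝓖.exists_strProd_eq n) h.pullsBack
  refine ⟨hC.submanifold, hC.submanifold_isEmbedded,
    hπ.isCoisotropic (hΩ.isAlmostSymplectic_powForm _) fun hG => ?_, hπ, fun hconn =>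
    h.isLocTriv.exists_reduced_equiv hC hπ hΩ.isSymplecticForm.isAlmostSymplectic
      (𝓖.isPreconnected_fibre_strProd hconn n)⟩
  obtain ⟨h1, h2⟩ := hΩ.finrank_pow_eq n hG
  change _ = 2 * (Module.finrank ℝ E + n * 𝓖.fibreDim)
  rw [h2, h1]
  ring

theorem isImmersedLagrangian_powRel (hΩ : 𝓖.IsSymplectic Ω) (n : ℕ) :
    IsImmersedLagrangian (prodForm (prodForm (powForm Ω (n + 1)) (powForm Ω (n + 1)))
      (powForm Ω (n + 1))) (𝓖.powRel n) := by
  have h := hΩ.isReduction_strProd n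
  have hs := hΩ.isAlmostSymplectic_powForm (n + 1)
  have key := ((h.prod h).prod h).isImmersedLagrangian_preimage ((hs.prodForm hs).prodForm hs)
    hΩ.isIsotropicParam_rel fun hG => by
      obtain ⟨h1, h2⟩ := hΩ.finrank_pow_eq n (hG.map Prod.snd)
      rw [Module.finrank_prod, Module.finrank_prod, h2, h1]
      ring
  convert key using 1
  ext ⟨⟨α, β⟩, γ⟩
  exact ⟨fun ⟨hα, hβ, hγ, h⟩ => ⟨⟨⟨hα, hβ⟩, hγ⟩, h⟩, fun ⟨⟨⟨hα, hβ⟩, hγ⟩, h⟩ => ⟨hα, hβ, hγ, h⟩⟩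

theorem isImmersedLagrangian_assoc_powRel (hΩ : 𝓖.IsSymplectic Ω) (n : ℕ) :
    IsImmersedLagrangian (prodForm (-prodForm (prodForm (powForm Ω (n + 1)) (powForm Ω (n + 1)))
      (powForm Ω (n + 1))) (powForm Ω (n + 1)))
      (relProd (L₃ (𝓖.powRel n) (𝓖.powInv n)) SetRel.id ○ L₃ (𝓖.powRel n) (𝓖.powInv n)) := by
  have h := hΩ.isReduction_strProd n
  have hs := hΩ.isAlmostSymplectic_powForm (n + 1)
  have key := (((h.prod h).prod h).neg.prod h).isImmersedLagrangian_preimage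
    (((hs.prodForm hs).prodForm hs).neg.prodForm hs) hΩ.isIsotropicParam_tripleGraph fun hG => by
      obtain ⟨h1, h2⟩ := hΩ.finrank_pow_eq n (hG.map Prod.snd)
      rw [Module.finrank_prod, Module.finrank_prod, Module.finrank_prod, h2, h1]
      ring
  convert key using 1
  ext ⟨⟨⟨α, β⟩, γ⟩, δ⟩
  refine 𝓖.mem_assoc_powRel.trans ?_
  exact ⟨fun ⟨hα, hβ, hγ, hδ, h⟩ => ⟨⟨⟨⟨hα, hβ⟩, hγ⟩, hδ⟩, h⟩,
    fun ⟨⟨⟨⟨hα, hβ⟩, hγ⟩, hδ⟩, h⟩ => ⟨hα, hβ, hγ, hδ, h⟩⟩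

theorem isImmersedLagrangian_L₁_powRel [FiniteDimensional ℝ B] (hΩ : 𝓖.IsSymplectic Ω) (n : ℕ) :
    IsImmersedLagrangian (powForm Ω (n + 1)) (L₁ (𝓖.powRel n) (𝓖.powInv n)) := by
  have key := (hΩ.isReduction_strProd n).isImmersedLagrangian_preimage
    (hΩ.isAlmostSymplectic_powForm (n + 1)) hΩ.isIsotropicParam_unit fun hG => by
      rw [(hΩ.finrank_pow_eq n hG).2, ← hΩ.fibreDim_eq (hG.map fun α => α 0)]
  convert key using 1
  ext α
  exact 𝓖.mem_L₁_powRel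

/-- The pairs of strings with equal products form a Lagrangian submanifold, the preimage of the
diagonal. -/
theorem isImmersedLagrangian_eq_strProd (hΩ : 𝓖.IsSymplectic Ω) (i j : ℕ) :
    IsImmersedLagrangian (prodForm (powForm Ω (j + 1)) (-powForm Ω (i + 1)))
      ((𝓖.P j).inv ○ 𝓖.P i) := by
  have key := ((hΩ.isReduction_strProd j).prod
    (hΩ.isReduction_strProd i).neg).isImmersedLagrangian_preimage
    ((hΩ.isAlmostSymplectic_powForm (j + 1)).prodForm (hΩ.isAlmostSymplectic_powForm (i + 1)).neg)
    (isIsotropicParam_diagonal Ω) fun hG => by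
      obtain ⟨h1, h2⟩ := hΩ.finrank_pow_eq j (hG.map Prod.fst)
      obtain ⟨-, h3⟩ := hΩ.finrank_pow_eq i (hG.map Prod.snd)
      rw [Module.finrank_prod, h2, h3, h1]
      ring
  convert key using 1
  ext ⟨α, β⟩
  refine 𝓖.mem_inv_P_comp_P.trans ?_
  exact ⟨fun ⟨hα, hβ, h⟩ => ⟨⟨hα, hβ⟩, h⟩, fun ⟨⟨hα, hβ⟩, h⟩ => ⟨hα, hβ, h⟩⟩

theorem isImmersedLagrangian_L₂_powRel (hΩ : 𝓖.IsSymplectic Ω) (n : ℕ) :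
    IsImmersedLagrangian (prodForm (-powForm Ω (n + 1)) (powForm Ω (n + 1)))
      (L₂ (𝓖.powRel n) (𝓖.powInv n)) := by
  have h := hΩ.isReduction_strProd n
  have hs := hΩ.isAlmostSymplectic_powForm (n + 1)
  have hd := isIsotropicParam_diagonal (-Ω)
  have hneg : (- -Ω : BilinField 𝓘(ℝ, E) G) = Ω := funext fun x => neg_neg (Ω x)
  rw [hneg] at hd
  have key := (h.neg.prod h).isImmersedLagrangian_preimage (hs.neg.prodForm hs) hd fun hG => by
      obtain ⟨h1, h2⟩ := hΩ.finrank_pow_eq n (hG.map Prod.fst)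
      rw [Module.finrank_prod, h2, h1]
      ring
  convert key using 1
  ext ⟨α, β⟩
  refine 𝓖.mem_L₂_powRel.trans ?_
  exact ⟨fun ⟨hα, hβ, h⟩ => ⟨⟨hα, hβ⟩, h⟩, fun ⟨⟨hα, hβ⟩, h⟩ => ⟨hα, hβ, h⟩⟩

theorem isRelationalSymplecticGroupoid_pow [FiniteDimensional ℝ B] (hΩ : 𝓖.IsSymplectic Ω)
    (n : ℕ) :
    IsRelationalSymplecticGroupoid (powForm Ω (n + 1)) (𝓖.powRel n) (𝓖.powInv n) where
  isSymplecticManifold :=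
    { finiteDimensional := inferInstance
      boundaryless := inferInstance
      isManifold := inferInstance
      t2 := inferInstance
      secondCountable := inferInstance
      isSymplecticForm := hΩ.isSymplecticForm.powForm _ }
  lagrangian_L := hΩ.isImmersedLagrangian_powRel n
  smooth_I := 𝓖.contMDiff_powInv n
  bijective_I := Function.Involutive.bijective 𝓖.powInv_powInv
  anti_I := hΩ.powForm_powInv n
  cyclic := fun _ _ _ ⟨hα, hβ, hγ, h⟩ => ⟨hβ, hγ, hα, 𝓖.rel_cyclic h⟩
  involutive := 𝓖.powInv_powInv
  inv_comp := 𝓖.powRel_inv_comp n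
  assoc := 𝓖.powRel_assoc n
  lagrangian_assoc := hΩ.isImmersedLagrangian_assoc_powRel n
  lagrangian_L₁ := hΩ.isImmersedLagrangian_L₁_powRel n
  L₃_L₁ := 𝓖.image_L₃_powRel n
  lagrangian_L₂ := hΩ.isImmersedLagrangian_L₂_powRel n

theorem isMorphism_inv_P_comp_P (hΩ : 𝓖.IsSymplectic Ω) (i j : ℕ) :
    IsMorphism (powForm Ω (j + 1)) (𝓖.powRel j) (𝓖.powInv j)
      (powForm Ω (i + 1)) (𝓖.powRel i) (𝓖.powInv i) ((𝓖.P j).inv ○ 𝓖.P i) where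
  lagrangian := hΩ.isImmersedLagrangian_eq_strProd i j
  comp_inv := 𝓖.graph_powInv_comp i j
  map_L := 𝓖.image_powRel i j

end IsSymplectic

end LieGroupoid

end SymplecticPowers

end RelSympl

end

open RelSympl

theorem mainTheorem4 {E B : Type*} [NormedAddCommGroup E] [NormedSpace ℝ E]
    [FiniteDimensional ℝ E] [NormedAddCommGroup B] [NormedSpace ℝ B] [FiniteDimensional ℝ B]
    {G M : Type*} [TopologicalSpace G] [ChartedSpace E G] [IsManifold 𝓘(ℝ, E) ∞ G] [T2Space G]
    [SecondCountableTopology G] [TopologicalSpace M] [ChartedSpace B M]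
    [IsManifold 𝓘(ℝ, B) ∞ M] [T2Space M] [SecondCountableTopology M]
    (𝓖 : LieGroupoid E B G M) (Ω : BilinField 𝓘(ℝ, E) G) (hΩ : 𝓖.IsSymplectic Ω) :
    (∀ n : ℕ, ∃ Y : ImmersedSubmanifold (powModel 𝓘(ℝ, E) (n + 1)) (𝓖.composable (n + 1)),
      Y.IsEmbedded ∧ Y.IsCoisotropic (powForm Ω (n + 1)) ∧
      Y.IsReductionMap (powForm Ω (n + 1)) Ω (fun p => 𝓖.strProd n (Y.incl p)) ∧
      (𝓖.SourceConnected → ∃ e : Y.Reduced (powForm Ω (n + 1)) ≃ G,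
        ∀ p : Y.carrier, e (Y.leaf (powForm Ω (n + 1)) p) = 𝓖.strProd n (Y.incl p))) ∧
    (∀ n : ℕ, IsRelationalSymplecticGroupoid (powForm Ω (n + 1)) (𝓖.powRel n) (𝓖.powInv n)) ∧
    (∀ i j : ℕ, IsEquivalence (powForm Ω (j + 1)) (𝓖.powRel j) (𝓖.powInv j)
      (powForm Ω (i + 1)) (𝓖.powRel i) (𝓖.powInv i) ((𝓖.P j).inv ○ 𝓖.P i)) := by
  refine ⟨hΩ.exists_reduction_composable, hΩ.isRelationalSymplecticGroupoid_pow, fun i j =>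
    ⟨hΩ.isMorphism_inv_P_comp_P i j, ?_⟩⟩
  rw [𝓖.inv_inv_P_comp_P]
  exact hΩ.isMorphism_inv_P_comp_P j i
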